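/- **Setting.** Let $Y=(Y_{ij})_{i,j\ge 1}$ be an infinite random real matrix which is row-column exchangeable, i.e. $(Y_{\sigma_1(i)\sigma_2(j)})_{i,j}$ has the same law as $Y$ for all permutations $\sigma_1,\sigma_2$ of $\mathbb N$, and dissociated, i.e. $(Y_{ij})_{i\le m,j\le n}$ is independent of $(Y_{ij})_{i>m,j>n}$ for all $m,n$. Fix an Aldous–Hoover–Kallenberg representation of $Y$: jointly independent variables $(\xi_i),(\eta_j),(\zeta_{ij})$, uniform on $[0,1]$ (possibly on another probability space), and a measurable function $\phi$ such that $Y$ has the same law as $(\phi(\xi_i,\eta_j,\zeta_{ij}))_{i,j}$. Let $h:\mathcal M_{p,q}(\mathbb R)\to\mathbb R$ be measurable, invariant under permutations of the rows and of the columns of its argument, with $\mathbb E[h(Y_{[p],[q]})^2]<\infty$. Put $$U_{m,n}=\binom mp^{-1}\binom nq^{-1}\sum_{I\subseteq[m],\,|I|=p}\ \sum_{J\subseteq[n],\,|J|=q}h(Y_{I,J}),\qquad h_{I,J}=h\big((\phi(\xi_i,\eta_j,\zeta_{ij}))_{i\in I,j\in J}\big).$$ **Projections.** For a finite bipartite graph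 $G=(V_1(G),V_2(G),E(G))$ with $V_1(G),V_2(G)\subset\mathbb N$ and $E(G)\subseteq V_1(G)\times V_2(G)$, let $H(G)=\big((\xi_i)_{i\in V_1(G)},(\eta_j)_{j\in V_2(G)},(\zeta_{ij})_{(i,j)\in E(G)}\big)$, $v_1(G)=|V_1(G)|$, $v_2(G)=|V_2(G)|$, and let $K_{I,J}=(I,J,I\times J)$, $K_{p,q}=K_{[p],[q]}$. For a square-integrable $X$ define recursively over subgraphs $$p^{\emptyset}(X)=\mathbb E[X],\qquad p^F(X)=\mathbb E[X\mid H(F)]-\sum_{F'\subsetneq F}p^{F'}(X).$$ For $G\subseteq K_{I,J}$ with $|I|=p$, $|J|=q$ write $p^G=p^G(h_{I,J})$ (up to null sets it does not depend on the choice of $(I,J)$), and $p^\emptyset=\mathbb E[h(Y_{[p],[q]})]$. **Principal degree and principal support graphs.** For $1\le k\le p+q$ let $p^{(k)}=\sum_{G\subseteq K_{p,q},\,v_1(G)+v_2(G)=k}p^G$. Assume that some $p^{(k)}$ is not almost surely $0$; the principal degree $d$ is the smallest such $k$. A principal support graph of $U_{m,n}$ is a graph $G\subseteq K_{m,n}$,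 contained in some $K_{I,J}$ with $I\subseteq[m]$, $J\subseteq[n]$, $|I|=p$, $|J|=q$, such that $v_1(G)+v_2(G)=d$ and $p^G$ is not almost surely $0$. **Variance terms.** Let $\Gamma_{r,c}$ contain exactly one representative of each isomorphism class of bipartite graphs with $r$ row nodes and $c$ column nodes, chosen among the graphs with node sets $[r]$ and $[c]$, and let $|\mathrm{Aut}(G)|$ be the number of pairs of permutations of the row nodes and of the column nodes that preserve $G$. For $r\le p$, $c\le q$ put $$V^{(r,c)}=\frac{p!^2\,q!^2}{(p-r)!^2\,(q-c)!^2}\sum_{G\in\Gamma_{r,c}}|\mathrm{Aut}(G)|^{-1}\,\mathbb E[(p^G)^2].$$ **Theorem.** Let $(m_N),(n_N)$ satisfy $m_N+n_N=N$ and $m_N/N\to\rho\in(0,1)$, and let $U_N=U_{m_N,n_N}$. If all principal support graphs of $U_N$ (for every $N$) are connected, then $$N^{d/2}\,(U_N-p^\emptyset)\xrightarrow[N\to\infty]{\mathcal D}\mathcal N(0,\sigma^2),\qquad \sigma^2=\sum_{\substack{(0,0)<(r,c)\le(p,q)\\ r+c=d}}\rho^{-r}(1-\rho)^{-c}\,V^{(r,c)}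 .$$ This includes the degenerate cases $d>1$. -/

import Mathlib

open MeasureTheory ProbabilityTheory Filter Topology

namespace RCE

/-! ### Bipartite graphs (row nodes and column nodes are natural numbers, `[n]` is `{0, …, n-1}`) -/

/-- A finite bipartite graph `G = (V₁(G), V₂(G), E(G))` with `E(G) ⊆ V₁(G) × V₂(G)`. -/
@[ext]
structure BGraph where
  rows : Finset ℕ
  cols : Finset ℕ
  edges : Finset (ℕ × ℕ)
  edges_subset : edges ⊆ rows ×ˢ cols

namespace BGraph

/-- `F ≤ G` is the subgraph relation `F ⊆ G`; `F < G` is the proper subgraph relation. -/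
instance : PartialOrder BGraph where
  le F G := F.rows ⊆ G.rows ∧ F.cols ⊆ G.cols ∧ F.edges ⊆ G.edges
  le_refl _ := ⟨Finset.Subset.refl _, Finset.Subset.refl _, Finset.Subset.refl _⟩
  le_trans _ _ _ h₁ h₂ := ⟨h₁.1.trans h₂.1, h₁.2.1.trans h₂.2.1, h₁.2.2.trans h₂.2.2⟩
  le_antisymm _ _ h₁ h₂ := BGraph.ext (Finset.Subset.antisymm h₁.1 h₂.1)
    (Finset.Subset.antisymm h₁.2.1 h₂.2.1) (Finset.Subset.antisymm h₁.2.2 h₂.2.2)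

/-- The total number of nodes `v₁(G) + v₂(G)`. -/
def numNodes (G : BGraph) : ℕ := G.rows.card + G.cols.card

/-- The empty graph. -/
def empty : BGraph := ⟨∅, ∅, ∅, Finset.empty_subset _⟩

/-- The complete bipartite graph `K_{I,J} = (I, J, I × J)`. -/
def complete (I J : Finset ℕ) : BGraph := ⟨I, J, I ×ˢ J, Finset.Subset.refl _⟩

theorem finite_le (G : BGraph) : {F : BGraph | F ≤ G}.Finite := by
  refine Set.Finite.of_finite_image
    (f := fun F : BGraph => (F.rows, F.cols, F.edges)) ?_ ?_
  · refine Set.Finite.subset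
      (G.rows.powerset ×ˢ (G.cols.powerset ×ˢ G.edges.powerset)).finite_toSet ?_
    rintro _ ⟨F, hF, rfl⟩
    have hF' : F ≤ G := hF
    have h1 : F.rows ⊆ G.rows ∧ F.cols ⊆ G.cols ∧ F.edges ⊆ G.edges := hF'
    simpa using h1
  · intro F _ F' _ h
    simp only [Prod.mk.injEq] at h
    exact BGraph.ext h.1 h.2.1 h.2.2

theorem finite_lt (G : BGraph) : {F : BGraph | F < G}.Finite :=
  G.finite_le.subset fun F hF => (show F < G from hF).le

/-- The finite set of all subgraphs `F ⊆ G`. -/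
noncomputable def subgraphs (G : BGraph) : Finset BGraph := G.finite_le.toFinset

/-- The finite set of all proper subgraphs `F ⊂ G`. -/
noncomputable def properSubgraphs (G : BGraph) : Finset BGraph := G.finite_lt.toFinset

theorem mem_subgraphs {F G : BGraph} : F ∈ G.subgraphs ↔ F ≤ G := by
  simp [subgraphs]

theorem mem_properSubgraphs {F G : BGraph} : F ∈ G.properSubgraphs ↔ F < G := by
  simp [properSubgraphs]

theorem card_lt_card {F G : BGraph} (h : F < G) :
    F.rows.card + F.cols.card + F.edges.card < G.rows.card + G.cols.card + G.edges.card := by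
  obtain ⟨⟨h1, h2, h3⟩, hn⟩ := lt_iff_le_and_ne.1 h
  have c1 := Finset.card_le_card h1
  have c2 := Finset.card_le_card h2
  have c3 := Finset.card_le_card h3
  by_contra hlt
  refine hn (BGraph.ext ?_ ?_ ?_)
  · exact Finset.eq_of_subset_of_card_le h1 (by omega)
  · exact Finset.eq_of_subset_of_card_le h2 (by omega)
  · exact Finset.eq_of_subset_of_card_le h3 (by omega)

/-- The graph `G` as a simple graph on the disjoint union of its row nodes and column nodes. -/
def toSimpleGraph (G : BGraph) : SimpleGraph (G.rows ⊕ G.cols) :=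
  SimpleGraph.fromRel fun u v =>
    ∃ (i : G.rows) (j : G.cols), u = Sum.inl i ∧ v = Sum.inr j ∧ (i.1, j.1) ∈ G.edges

/-- Connectedness of a bipartite graph (a connected graph is non-empty). -/
def Connected (G : BGraph) : Prop := G.toSimpleGraph.Connected

/-- Isomorphisms of bipartite graphs: pairs of bijections, of the row nodes and of the column
nodes, which carry the edges to the edges. -/
def Iso (G G' : BGraph) : Type :=
  {e : (G.rows ≃ G'.rows) × (G.cols ≃ G'.cols) //
    ∀ (i : G.rows) (j : G.cols),
      (i.1, j.1) ∈ G.edges ↔ ((e.1 i).1, (e.2 j).1) ∈ G'.edges}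

/-- `G ∼ G'`. -/
def Isomorphic (G G' : BGraph) : Prop := Nonempty (Iso G G')

theorem isomorphic_equivalence : Equivalence Isomorphic where
  refl G := ⟨⟨(Equiv.refl _, Equiv.refl _), fun _ _ => Iff.rfl⟩⟩
  symm := by
    rintro G G' ⟨⟨⟨e, f⟩, h⟩⟩
    refine ⟨⟨(e.symm, f.symm), fun i j => ?_⟩⟩
    have := h (e.symm i) (f.symm j)
    simpa using this.symm
  trans := by
    rintro G₁ G₂ G₃ ⟨⟨⟨e, f⟩, h⟩⟩ ⟨⟨⟨e', f'⟩, h'⟩⟩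
    exact ⟨⟨(e.trans e', f.trans f'), fun i j => (h i j).trans (h' (e i) (f j))⟩⟩

/-- `|Aut(G)|`, the number of pairs of permutations (of the row nodes and of the column nodes)
which leave `G` invariant. -/
noncomputable def autCard (G : BGraph) : ℕ := Nat.card (Iso G G)

/-- The subgraphs of `K_{r,c}` with exactly `r` row nodes and `c` column nodes. -/
def Spanning (r c : ℕ) : Type :=
  {G : BGraph // G.rows = Finset.range r ∧ G.cols = Finset.range c}

instance (r c : ℕ) : Finite (Spanning r c) := by
  refine Set.Finite.to_subtype
    ((complete (Finset.range r) (Finset.range c)).finite_le.subset ?_)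
  rintro G ⟨h1, h2⟩
  refine ⟨h1.subset, h2.subset, ?_⟩
  have h3 := G.edges_subset
  rw [h1, h2] at h3
  exact h3

/-- The isomorphism relation on the subgraphs of `K_{r,c}` with `r` row and `c` column nodes. -/
def isoSetoid (r c : ℕ) : Setoid (Spanning r c) where
  r G G' := Isomorphic G.1 G'.1
  iseqv := ⟨fun _ => isomorphic_equivalence.refl _, fun h => isomorphic_equivalence.symm h,
    fun h h' => isomorphic_equivalence.trans h h'⟩

/-- The minimal set `Γ_{r,c}`: one chosen representative of each isomorphism class of the
subgraphs of `K_{r,c}` with `r` row nodes and `c` column nodes. -/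
noncomputable def Gamma (r c : ℕ) : Finset BGraph :=
  (Set.finite_range fun x : Quotient (isoSetoid r c) => (Quotient.out x).1).toFinset

theorem mem_Gamma {r c : ℕ} {G : BGraph} :
    G ∈ Gamma r c ↔ ∃ x : Quotient (isoSetoid r c), (Quotient.out x).1 = G := by
  simp [Gamma]

/-- Every graph with `r` row nodes and `c` column nodes is isomorphic to exactly one element
of `Γ_{r,c}`. -/
theorem existsUnique_mem_Gamma {r c : ℕ} (G : BGraph)
    (hr : G.rows.card = r) (hc : G.cols.card = c) :
    ∃! G' : BGraph, G' ∈ Gamma r c ∧ Isomorphic G G' := by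
  obtain ⟨S, hS⟩ : ∃ S : Spanning r c, Isomorphic G S.1 := by
    let e : G.rows ≃ Finset.range r :=
      Fintype.equivOfCardEq (by simp [hr])
    let f : G.cols ≃ Finset.range c :=
      Fintype.equivOfCardEq (by simp [hc])
    let E : Finset (ℕ × ℕ) := (Finset.range r ×ˢ Finset.range c).filter fun x =>
      ∃ (hx : x.1 ∈ Finset.range r) (hy : x.2 ∈ Finset.range c),
        ((e.symm ⟨x.1, hx⟩).1, (f.symm ⟨x.2, hy⟩).1) ∈ G.edges
    refine ⟨⟨⟨Finset.range r, Finset.range c, E, Finset.filter_subset _ _⟩, rfl, rfl⟩,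
      ⟨⟨(e, f), fun i j => ?_⟩⟩⟩
    constructor
    · intro hij
      refine Finset.mem_filter.2 ⟨Finset.mk_mem_product (e i).2 (f j).2, (e i).2, (f j).2, ?_⟩
      simpa using hij
    · intro hij
      obtain ⟨_, hx, hy, h⟩ := Finset.mem_filter.1 hij
      simpa using h
  refine ⟨(Quotient.out (Quotient.mk (isoSetoid r c) S)).1, ⟨mem_Gamma.2 ⟨_, rfl⟩, ?_⟩, ?_⟩
  · have h : Isomorphic (Quotient.out (Quotient.mk (isoSetoid r c) S)).1 S.1 :=
      Quotient.mk_out (s := isoSetoid r c) S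
    exact isomorphic_equivalence.trans hS (isomorphic_equivalence.symm h)
  · rintro G' ⟨hG', hiso⟩
    obtain ⟨x, rfl⟩ := mem_Gamma.1 hG'
    have h : Isomorphic S.1 (Quotient.out x).1 :=
      isomorphic_equivalence.trans (isomorphic_equivalence.symm hS) hiso
    have h2 : Quotient.mk (isoSetoid r c) S = x := by
      rw [← Quotient.out_eq x]
      exact Quotient.sound (s := isoSetoid r c) h
    rw [h2]

end BGraph

/-! ### Dissociated row-column exchangeable matrices and their `U`-statistics -/

section Matrices

variable {Ω : Type*} [MeasurableSpace Ω]

/-- `Y` is row-column exchangeable: its law is invariant under separate permutations of its rows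
and of its columns. -/
def IsRowColExchangeable (P : Measure Ω) (Y : ℕ → ℕ → Ω → ℝ) : Prop :=
  ∀ σ τ : Equiv.Perm ℕ,
    IdentDistrib (fun ω (i j : ℕ) => Y (σ i) (τ j) ω) (fun ω (i j : ℕ) => Y i j ω) P P

/-- `Y` is dissociated: for all `(m, n)`, the block of the first `m` rows and first `n` columns is
independent of the block of the remaining rows and remaining columns. -/
def IsDissociated (P : Measure Ω) (Y : ℕ → ℕ → Ω → ℝ) : Prop :=
  ∀ m n : ℕ,
    IndepFun (fun ω (i : Fin m) (j : Fin n) => Y i j ω)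
      (fun ω (i j : ℕ) => Y (m + i) (n + j) ω) P

/-- A `p × q` kernel is symmetric: it is invariant under permutations of the rows and of the
columns of its argument. -/
def IsSymmetricKernel {p q : ℕ} (h : (Fin p → Fin q → ℝ) → ℝ) : Prop :=
  ∀ (σ : Equiv.Perm (Fin p)) (τ : Equiv.Perm (Fin q)) (y : Fin p → Fin q → ℝ),
    h (fun k l => y (σ k) (τ l)) = h y

/-- The submatrix `y_{I,J}` with rows in `I` and columns in `J`, in increasing order. -/
noncomputable def submatrix {p q : ℕ} (y : ℕ → ℕ → ℝ) (I J : Finset ℕ)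
    (hI : I.card = p) (hJ : J.card = q) : Fin p → Fin q → ℝ :=
  fun k l => y (I.orderEmbOfFin hI k) (J.orderEmbOfFin hJ l)

/-- The `U`-statistic with kernel `h` on the first `m` rows and `n` columns of `y`: the average
of `h (y_{I,J})` over all `I ∈ P_p([m])` and `J ∈ P_q([n])`. -/
noncomputable def uStat {p q : ℕ} (h : (Fin p → Fin q → ℝ) → ℝ) (m n : ℕ)
    (y : ℕ → ℕ → ℝ) : ℝ :=
  ((m.choose p : ℝ))⁻¹ * ((n.choose q : ℝ))⁻¹ *
    ∑ I : {I // I ∈ (Finset.range m).powersetCard p},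
      ∑ J : {J // J ∈ (Finset.range n).powersetCard q},
        h (submatrix y I.1 J.1 (Finset.mem_powersetCard.1 I.2).2
          (Finset.mem_powersetCard.1 J.2).2)

end Matrices

/-! ### Aldous–Hoover–Kallenberg variables and graph-indexed projections -/

section AHK

variable {Ω : Type*} [MeasurableSpace Ω] {Ω' : Type*} [MeasurableSpace Ω']

/-- The Aldous–Hoover–Kallenberg variables: arrays `(ξ_i)`, `(η_j)`, `(ζ_{ij})` of (jointly)
independent random variables with the uniform distribution on `[0,1]`. -/
structure IsAHKVariables (Q : Measure Ω') (ξ η : ℕ → Ω' → ℝ) (ζ : ℕ → ℕ → Ω' → ℝ) : Prop where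
  measurable_row : ∀ i, Measurable (ξ i)
  measurable_col : ∀ j, Measurable (η j)
  measurable_edge : ∀ i j, Measurable (ζ i j)
  uniform_row : ∀ i, Q.map (ξ i) = volume.restrict (Set.Icc 0 1)
  uniform_col : ∀ j, Q.map (η j) = volume.restrict (Set.Icc 0 1)
  uniform_edge : ∀ i j, Q.map (ζ i j) = volume.restrict (Set.Icc 0 1)
  independent : iIndepFun
    (fun a : ℕ ⊕ ℕ ⊕ ℕ × ℕ =>
      Sum.elim ξ (Sum.elim η (fun ij : ℕ × ℕ => ζ ij.1 ij.2)) a) Q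

/-- The array `(φ(ξ_i, η_j, ζ_{ij}))_{i,j}`. -/
def ahkMatrix (φ : ℝ × ℝ × ℝ → ℝ) (ξ η : ℕ → Ω' → ℝ) (ζ : ℕ → ℕ → Ω' → ℝ) (ω : Ω') :
    ℕ → ℕ → ℝ :=
  fun i j => φ (ξ i ω, η j ω, ζ i j ω)

/-- `(φ, ξ, η, ζ)` is an Aldous–Hoover–Kallenberg representation of `Y`. The variables may live on
another probability space (for instance an extension of the original one) and equality in law of
the whole arrays is required; on a common space this is implied by `Y_{ij} = φ(ξ_i, η_j, ζ_{ij})`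
almost surely. -/
structure IsAHKRepresentation (P : Measure Ω) (Y : ℕ → ℕ → Ω → ℝ)
    (Q : Measure Ω') (φ : ℝ × ℝ × ℝ → ℝ) (ξ η : ℕ → Ω' → ℝ) (ζ : ℕ → ℕ → Ω' → ℝ) : Prop where
  isAHKVariables : IsAHKVariables Q ξ η ζ
  measurable_fun : Measurable φ
  identDistrib : IdentDistrib (fun ω (i j : ℕ) => Y i j ω) (ahkMatrix φ ξ η ζ) P Q

/-- The σ-algebra `σ(H(G))` generated by the variables `ξ_i`, `i ∈ V₁(G)`, `η_j`, `j ∈ V₂(G)`, and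
`ζ_{ij}`, `(i,j) ∈ E(G)`. -/
abbrev graphSigma (ξ η : ℕ → Ω' → ℝ) (ζ : ℕ → ℕ → Ω' → ℝ) (G : BGraph) : MeasurableSpace Ω' :=
  (⨆ i ∈ G.rows, MeasurableSpace.comap (ξ i) inferInstance) ⊔
  (⨆ j ∈ G.cols, MeasurableSpace.comap (η j) inferInstance) ⊔
  (⨆ ij ∈ G.edges, MeasurableSpace.comap (ζ ij.1 ij.2) inferInstance)

/-- The projections, defined recursively by
`p^F(X) = E[X | H(F)] - ∑_{F' ⊂ F} p^{F'}(X)`, so that `p^∅(X) = E[X]`. -/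
noncomputable def proj (Q : Measure Ω') (ξ η : ℕ → Ω' → ℝ) (ζ : ℕ → ℕ → Ω' → ℝ)
    (X : Ω' → ℝ) (F : BGraph) : Ω' → ℝ :=
  Q[X | graphSigma ξ η ζ F] -
    ∑ F' : {F' // F' ∈ F.properSubgraphs}, proj Q ξ η ζ X F'.1
termination_by F.rows.card + F.cols.card + F.edges.card
decreasing_by exact BGraph.card_lt_card (BGraph.mem_properSubgraphs.1 F'.2)

theorem proj_empty (Q : Measure Ω') [IsProbabilityMeasure Q] (ξ η : ℕ → Ω' → ℝ)
    (ζ : ℕ → ℕ → Ω' → ℝ) (X : Ω' → ℝ) :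
    proj Q ξ η ζ X BGraph.empty = fun _ => ∫ ω, X ω ∂Q := by
  have h1 : graphSigma ξ η ζ BGraph.empty = ⊥ := by
    simp [graphSigma, BGraph.empty]
  have h2 : BGraph.empty.properSubgraphs = ∅ := by
    refine Finset.eq_empty_of_forall_notMem fun F hF => ?_
    have := BGraph.card_lt_card (BGraph.mem_properSubgraphs.1 hF)
    simp [BGraph.empty] at this
  have : IsEmpty {F' // F' ∈ BGraph.empty.properSubgraphs} := by
    rw [h2]; infer_instance
  rw [proj, h1, condExp_bot]
  simp

/-- The random variable `h_{I,J} = h((φ(ξ_i, η_j, ζ_{ij}))_{i ∈ I, j ∈ J})`. -/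
noncomputable def kernelVar {p q : ℕ} (h : (Fin p → Fin q → ℝ) → ℝ) (φ : ℝ × ℝ × ℝ → ℝ)
    (ξ η : ℕ → Ω' → ℝ) (ζ : ℕ → ℕ → Ω' → ℝ) (I J : Finset ℕ)
    (hI : I.card = p) (hJ : J.card = q) : Ω' → ℝ :=
  fun ω => h (submatrix (ahkMatrix φ ξ η ζ ω) I J hI hJ)

/-- `p^G = p^G(h_{[p],[q]})`, for `G ⊆ K_{p,q}`. -/
noncomputable def kernelProj {p q : ℕ} (Q : Measure Ω') (h : (Fin p → Fin q → ℝ) → ℝ)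
    (φ : ℝ × ℝ × ℝ → ℝ) (ξ η : ℕ → Ω' → ℝ) (ζ : ℕ → ℕ → Ω' → ℝ) (G : BGraph) : Ω' → ℝ :=
  proj Q ξ η ζ (kernelVar h φ ξ η ζ (Finset.range p) (Finset.range q)
    (Finset.card_range p) (Finset.card_range q)) G

/-- `p^{(k)}`, the sum of `p^G` over all `G ⊆ K_{p,q}` with `v₁(G) + v₂(G) = k`. -/
noncomputable def levelProj {p q : ℕ} (Q : Measure Ω') (h : (Fin p → Fin q → ℝ) → ℝ)
    (φ : ℝ × ℝ × ℝ → ℝ) (ξ η : ℕ → Ω' → ℝ) (ζ : ℕ → ℕ → Ω' → ℝ) (k : ℕ) : Ω' → ℝ :=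
  ∑ G ∈ (BGraph.complete (Finset.range p) (Finset.range q)).subgraphs with G.numNodes = k,
    kernelProj Q h φ ξ η ζ G

/-- `d` is the principal degree: the smallest `k ∈ {1, …, p + q}` such that `p^{(k)} ≠ 0`
(as an element of `L²`). -/
def IsPrincipalDegree {p q : ℕ} (Q : Measure Ω') (h : (Fin p → Fin q → ℝ) → ℝ)
    (φ : ℝ × ℝ × ℝ → ℝ) (ξ η : ℕ → Ω' → ℝ) (ζ : ℕ → ℕ → Ω' → ℝ) (d : ℕ) : Prop :=
  IsLeast {k : ℕ | 1 ≤ k ∧ k ≤ p + q ∧ ¬ levelProj Q h φ ξ η ζ k =ᵐ[Q] 0} d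

/-- `G` is a principal support graph of `U_{m,n}`, where `d` is the principal degree:
`G ⊆ K_{m,n}`, `G` has `d` nodes, and `p^G ≠ 0`, where `p^G = p^G(h_{I,J})` for
`I ∈ P_p([m])` and `J ∈ P_q([n])` such that `G ⊆ K_{I,J}`. -/
def IsPrincipalSupportGraph {p q : ℕ} (Q : Measure Ω') (h : (Fin p → Fin q → ℝ) → ℝ)
    (φ : ℝ × ℝ × ℝ → ℝ) (ξ η : ℕ → Ω' → ℝ) (ζ : ℕ → ℕ → Ω' → ℝ) (d m n : ℕ)
    (G : BGraph) : Prop :=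
  G.numNodes = d ∧
  ∃ (I J : Finset ℕ) (hI : I.card = p) (hJ : J.card = q),
    I ⊆ Finset.range m ∧ J ⊆ Finset.range n ∧ G ≤ BGraph.complete I J ∧
    ¬ proj Q ξ η ζ (kernelVar h φ ξ η ζ I J hI hJ) G =ᵐ[Q] 0

/-- `V^{(r,c)} = (p!² q!² / ((p-r)!² (q-c)!²)) ∑_{G ∈ Γ_{r,c}} |Aut(G)|⁻¹ E[(p^G)²]`, for
`r ≤ p` and `c ≤ q`. -/
noncomputable def varTerm {p q : ℕ} (Q : Measure Ω') (h : (Fin p → Fin q → ℝ) → ℝ)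
    (φ : ℝ × ℝ × ℝ → ℝ) (ξ η : ℕ → Ω' → ℝ) (ζ : ℕ → ℕ → Ω' → ℝ) (r c : ℕ) : ℝ :=
  ((p.factorial : ℝ) ^ 2 * (q.factorial : ℝ) ^ 2) /
      (((p - r).factorial : ℝ) ^ 2 * ((q - c).factorial : ℝ) ^ 2) *
    ∑ G ∈ BGraph.Gamma r c,
      (G.autCard : ℝ)⁻¹ * ∫ ω, (kernelProj Q h φ ξ η ζ G ω) ^ 2 ∂Q

/-- `σ² = ∑ ρ^{-r} (1-ρ)^{-c} V^{(r,c)}` over `(0,0) < (r,c) ≤ (p,q)` with `r + c = d`. -/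
noncomputable def limitVariance {p q : ℕ} (Q : Measure Ω') (h : (Fin p → Fin q → ℝ) → ℝ)
    (φ : ℝ × ℝ × ℝ → ℝ) (ξ η : ℕ → Ω' → ℝ) (ζ : ℕ → ℕ → Ω' → ℝ) (d : ℕ) (ρ : ℝ) : ℝ :=
  ∑ rc ∈ Finset.range (p + 1) ×ˢ Finset.range (q + 1) with rc ≠ (0, 0) ∧ rc.1 + rc.2 = d,
    (ρ ^ rc.1)⁻¹ * ((1 - ρ) ^ rc.2)⁻¹ * varTerm Q h φ ξ η ζ rc.1 rc.2

end AHK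

end RCE

/-!
Write `p^G` for the projection of the kernel on the graph `G`. It is measurable with respect to the
variables `H(G)` and centred given the variables of any graph that does not contain `G`
(`IsAHKVariables.condExp_proj_eq_zero`), so projections on different graphs are orthogonal, and
by the symmetry of the kernel the law of `p^G` depends on the isomorphism class of `G` only
(`identDistrib_proj_kernelVar_map`). Summing the expansions of the variables `h_{I,J}` gives
`U_{m,n} = ∑ b_G p^G` over the subgraphs `G` of `K_{m,n}`, where `b_G` is the proportion of the
pairs `(I, J)` with `G ⊆ K_{I,J}` (`IsSquareIntegrableKernel.uStat_ae_eq_sum`).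

*Variances.* By orthogonality the graphs with `k` nodes contribute a variance of order `N^{-k}`,
with an explicit limit (`IsSquareIntegrableKernel.tendsto_levelVar`). The levels `0 < k < d` vanish, those with `k > d`
are negligible at the scale `N^{d/2}`, and on the level `d` only connected graphs remain
(`IsSquareIntegrableKernel.integral_remainder_sq_le`). Counting labelled graphs by isomorphism classes
(`BGraph.sum_spanning_eq_sum_Gamma`) identifies the limit of the variance with `σ²`.

*Normal approximation.* Let `W` be the rescaled sum over the connected graphs with `d` nodes, and
group its terms by node sets, `W = ∑ Z_A` over the sets `A` of `d` nodes. If `S_v` is the sum of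
the `Z_A` with `v ∈ A`, then `W - S_v` does not involve the node `v`, so `S_v` is centred given
`W - S_v`, and

`d E[W e^{itW}] = ∑_v E[S_v (e^{itW} - e^{it(W - S_v)})] ≈ it E[(∑_v S_v²) e^{itW}]`.

When `∑_v S_v²` concentrates around its mean `d E[W²]`, the characteristic function of `W` almost
satisfies `ψ' = -t E[W²] ψ`, hence is almost Gaussian (`IsDegenerateFamily.norm_charFun_sub_le`).
The concentration follows from mixed fourth moments of projections. Such a moment vanishes
unless every graph of the quadruple is covered by the three others; if there are `2d` nodes or
more, every node then lies in exactly two of the four graphs, and a connected graph has to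
have the same nodes as one of the others (`BGraph.card_verts_quad_lt`). This is where connectedness
enters: the quadruple then consists of two pairs on disjoint sets of nodes, which are independent
and contribute nothing to the variance of `∑_v S_v²`. Only the quadruples with fewer than `2d` nodes
remain, and there are `O(N^{2d-1})` of them.

The moment bounds need a bounded kernel. Truncating the kernel at a level that grows slowly with
`N` changes `W` by a quantity that vanishes in `L²`
(`IsSquareIntegrableKernel.tendsto_integral_cexp_uStat`).
-/

set_option linter.unusedSectionVars false

namespace RCE

/-! ### Quadruples of sets with few points -/

section Counting

variable {ν : Type*} [DecidableEq ν]

/-- The union of a quadruple of finite sets. -/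
def quadUnion (q : (Finset ν × Finset ν) × (Finset ν × Finset ν)) : Finset ν :=
  (q.1.1 ∪ q.1.2) ∪ (q.2.1 ∪ q.2.2)

/-- A quadruple of subsets of `V` whose union is non-empty with at most `k` points is the image,
under a map `Fin k → V`, of a quadruple of subsets of `Fin k`. -/
theorem card_quadUnion_le (V : Finset ν) (P : Finset (Finset ν))
    (hP : ∀ A ∈ P, A ⊆ V ∧ A.Nonempty) (k : ℕ) :
    (((P ×ˢ P) ×ˢ (P ×ˢ P)).filter fun q => (quadUnion q).card ≤ k).card ≤
      2 ^ (4 * k) * V.card ^ k := by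
  classical
  let F : (Fin k → V) × ((Finset (Fin k) × Finset (Fin k)) × (Finset (Fin k) × Finset (Fin k))) →
      (Finset ν × Finset ν) × (Finset ν × Finset ν) := fun x =>
    ((x.2.1.1.image fun i => (x.1 i : ν), x.2.1.2.image fun i => (x.1 i : ν)),
      (x.2.2.1.image fun i => (x.1 i : ν), x.2.2.2.image fun i => (x.1 i : ν)))
  have hsub : (((P ×ˢ P) ×ˢ (P ×ˢ P)).filter fun q => (quadUnion q).card ≤ k) ⊆
      Finset.univ.image F := by
    rintro ⟨⟨A, B⟩, ⟨C, D⟩⟩ hq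
    simp only [Finset.mem_filter, Finset.mem_product] at hq
    obtain ⟨⟨⟨hA, hB⟩, hC, hD⟩, hk⟩ := hq
    set U := quadUnion ((A, B), (C, D)) with hU
    have hAU : A ⊆ U := by intro x hx; simp [hU, quadUnion, hx]
    have hBU : B ⊆ U := by intro x hx; simp [hU, quadUnion, hx]
    have hCU : C ⊆ U := by intro x hx; simp [hU, quadUnion, hx]
    have hDU : D ⊆ U := by intro x hx; simp [hU, quadUnion, hx]
    have hUV : U ⊆ V := by
      intro x hx
      simp only [hU, quadUnion, Finset.mem_union] at hx
      rcases hx with (h | h) | (h | h)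
      exacts [(hP _ hA).1 h, (hP _ hB).1 h, (hP _ hC).1 h, (hP _ hD).1 h]
    obtain ⟨a, ha⟩ := (hP _ hA).2
    obtain ⟨e⟩ : Nonempty (U ↪ Fin k) :=
      Function.Embedding.nonempty_of_card_le (by simpa using hk)
    have : Nonempty U := ⟨⟨a, hAU ha⟩⟩
    let f : Fin k → V := fun i => ⟨(Function.invFun e i).1, hUV (Function.invFun e i).2⟩
    have key : ∀ S : Finset ν, S ⊆ U →
        ∃ S' : Finset (Fin k), S'.image (fun i => (f i : ν)) = S := by
      intro S hS
      refine ⟨Finset.univ.filter fun i => ∃ x : U, x.1 ∈ S ∧ e x = i, ?_⟩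
      ext x
      simp only [Finset.mem_image, Finset.mem_filter, Finset.mem_univ, true_and]
      constructor
      · rintro ⟨i, ⟨y, hy, rfl⟩, rfl⟩
        simpa [f, Function.leftInverse_invFun e.injective y] using hy
      · intro hx
        refine ⟨e ⟨x, hS hx⟩, ⟨⟨x, hS hx⟩, hx, rfl⟩, ?_⟩
        simp [f, Function.leftInverse_invFun e.injective ⟨x, hS hx⟩]
    obtain ⟨A', hA'⟩ := key A hAU
    obtain ⟨B', hB'⟩ := key B hBU
    obtain ⟨C', hC'⟩ := key C hCU
    obtain ⟨D', hD'⟩ := key D hDU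
    refine Finset.mem_image.2 ⟨(f, ((A', B'), (C', D'))), Finset.mem_univ _, ?_⟩
    exact Prod.ext (Prod.ext hA' hB') (Prod.ext hC' hD')
  refine (Finset.card_le_card hsub).trans (Finset.card_image_le.trans ?_)
  rw [Finset.card_univ]
  simp only [Fintype.card_prod, Fintype.card_pi, Finset.prod_const, Finset.card_univ,
    Fintype.card_fin, Fintype.card_coe, Fintype.card_finset]
  rw [mul_comm (V.card ^ k)]
  refine Nat.mul_le_mul_right _ (le_of_eq ?_)
  ring

/-- A sum over quadruples in which only quadruples with at most `k` points contribute. -/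
theorem abs_sum_quad_le (V : Finset ν) (P : Finset (Finset ν))
    (hP : ∀ A ∈ P, A ⊆ V ∧ A.Nonempty) (k : ℕ)
    (F : (Finset ν × Finset ν) × (Finset ν × Finset ν) → ℝ) {c : ℝ}
    (hF : ∀ q ∈ (P ×ˢ P) ×ˢ (P ×ˢ P), |F q| ≤ c)
    (hF0 : ∀ q ∈ (P ×ˢ P) ×ˢ (P ×ˢ P), k < (quadUnion q).card → F q = 0) (hc : 0 ≤ c) :
    |∑ q ∈ (P ×ˢ P) ×ˢ (P ×ˢ P), F q| ≤ c * (2 ^ (4 * k) * (V.card : ℝ) ^ k) := by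
  have h1 : ∑ q ∈ (P ×ˢ P) ×ˢ (P ×ˢ P), F q =
      ∑ q ∈ ((P ×ˢ P) ×ˢ (P ×ˢ P)).filter (fun q => (quadUnion q).card ≤ k), F q := by
    symm
    refine Finset.sum_subset (Finset.filter_subset _ _) fun q hq hq' => hF0 q hq ?_
    by_contra hlt
    exact hq' (Finset.mem_filter.2 ⟨hq, not_lt.1 hlt⟩)
  rw [h1]
  refine (Finset.abs_sum_le_sum_abs _ _).trans
    ((Finset.sum_le_card_nsmul _ _ c fun q hq => hF q (Finset.mem_filter.1 hq).1).trans ?_)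
  rw [nsmul_eq_mul, mul_comm]
  refine mul_le_mul_of_nonneg_left ?_ hc
  exact_mod_cast card_quadUnion_le V P hP k

end Counting

/-! ### A normal approximation for degenerate sums over sets of nodes -/

section SteinBound

variable {Ω : Type*} [MeasurableSpace Ω] {ν : Type*} [DecidableEq ν]

/-- Bounded random variables `Z_A`, indexed by the `d`-element subsets `A` of a finite set `V` of
nodes, which are degenerate: `Z_A` is centred given everything that avoids one node of `A`. The
fourth mixed moments factorise over disjoint sets of nodes, and vanish for overlapping
configurations with at least `2d` nodes. -/
structure IsDegenerateFamily (Q : Measure Ω) (V : Finset ν) (d : ℕ) (β : ℝ)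
    (Z : Finset ν → Ω → ℝ) : Prop where
  measurable : ∀ A, Measurable (Z A)
  bound : ∀ A ∈ V.powersetCard d, ∀ᵐ ω ∂Q, |Z A ω| ≤ β
  integral_mul_eq_zero : ∀ A ∈ V.powersetCard d, ∀ v ∈ A, ∀ g : ℝ → ℝ, Measurable g →
    (∃ C, ∀ x, |g x| ≤ C) →
    ∫ ω, Z A ω * g (∑ B ∈ V.powersetCard d with v ∉ B, Z B ω) ∂Q = 0
  orthogonal : ∀ A ∈ V.powersetCard d, ∀ B ∈ V.powersetCard d, A ≠ B →
    ∫ ω, Z A ω * Z B ω ∂Q = 0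
  integral_disjoint : ∀ A ∈ V.powersetCard d, ∀ B ∈ V.powersetCard d,
    ∀ C ∈ V.powersetCard d, ∀ D ∈ V.powersetCard d, Disjoint (A ∪ B) (C ∪ D) →
    ∫ ω, (Z A ω * Z B ω) * (Z C ω * Z D ω) ∂Q =
      (∫ ω, Z A ω * Z B ω ∂Q) * ∫ ω, Z C ω * Z D ω ∂Q
  integral_overlap : ∀ A ∈ V.powersetCard d, ∀ B ∈ V.powersetCard d,
    ∀ C ∈ V.powersetCard d, ∀ D ∈ V.powersetCard d, ¬ Disjoint A B →
    ¬ Disjoint (A ∪ B) (C ∪ D) → 2 * d ≤ ((A ∪ B) ∪ (C ∪ D)).card →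
    ∫ ω, (Z A ω * Z B ω) * (Z C ω * Z D ω) ∂Q = 0

namespace IsDegenerateFamily

variable {Q : Measure Ω} [IsProbabilityMeasure Q] {V : Finset ν} {d : ℕ} {β : ℝ}
  {Z : Finset ν → Ω → ℝ}

theorem memLp_top (h : IsDegenerateFamily Q V d β Z) {A : Finset ν}
    (hA : A ∈ V.powersetCard d) : MemLp (Z A) ⊤ Q :=
  memLp_top_of_bound (h.measurable A).aestronglyMeasurable β
    (by simpa [Real.norm_eq_abs] using h.bound A hA)

/-- The part of the sum that involves the node `v`. -/
def nodeSum (V : Finset ν) (d : ℕ) (Z : Finset ν → Ω → ℝ) (v : ν) (ω : Ω) : ℝ :=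
  ∑ A ∈ V.powersetCard d with v ∈ A, Z A ω

/-- The total sum. -/
def total (V : Finset ν) (d : ℕ) (Z : Finset ν → Ω → ℝ) (ω : Ω) : ℝ :=
  ∑ A ∈ V.powersetCard d, Z A ω

theorem memLp_total (h : IsDegenerateFamily Q V d β Z) : MemLp (total V d Z) ⊤ Q :=
  memLp_finsetSum _ fun _ hA => h.memLp_top hA

theorem memLp_nodeSum (h : IsDegenerateFamily Q V d β Z) (v : ν) :
    MemLp (nodeSum V d Z v) ⊤ Q :=
  memLp_finsetSum _ fun _ hA => h.memLp_top (Finset.mem_filter.1 hA).1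

theorem measurable_total (h : IsDegenerateFamily Q V d β Z) : Measurable (total V d Z) :=
  Finset.measurable_sum _ fun A _ => h.measurable A

theorem measurable_nodeSum (h : IsDegenerateFamily Q V d β Z) (v : ν) :
    Measurable (nodeSum V d Z v) :=
  Finset.measurable_sum _ fun A _ => h.measurable A

theorem _root_.MeasureTheory.MemLp.mul_top {f g : Ω → ℝ} (hf : MemLp f ⊤ Q) (hg : MemLp g ⊤ Q) :
    MemLp (fun ω => f ω * g ω) ⊤ Q :=
  hg.mul (p := ⊤) (q := ⊤) (r := ⊤) hf

theorem sum_nodeSum (V : Finset ν) (d : ℕ) (Z : Finset ν → Ω → ℝ) (ω : Ω) :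
    ∑ v ∈ V, nodeSum V d Z v ω = d * total V d Z ω := by
  simp only [nodeSum, total, Finset.sum_filter]
  rw [Finset.sum_comm, Finset.mul_sum]
  refine Finset.sum_congr rfl fun A hA => ?_
  obtain ⟨hAV, hAd⟩ := Finset.mem_powersetCard.1 hA
  rw [← Finset.sum_filter, Finset.sum_const, nsmul_eq_mul, Finset.filter_mem_eq_inter,
    Finset.inter_eq_right.2 hAV, hAd]

theorem total_sub_nodeSum (V : Finset ν) (d : ℕ) (Z : Finset ν → Ω → ℝ) (v : ν) (ω : Ω) :
    total V d Z ω - nodeSum V d Z v ω = ∑ B ∈ V.powersetCard d with v ∉ B, Z B ω := by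
  rw [sub_eq_iff_eq_add, total, nodeSum, add_comm, Finset.sum_filter_add_sum_filter_not]

theorem sum_nodeSum_sq (V : Finset ν) (d : ℕ) (Z : Finset ν → Ω → ℝ) (ω : Ω) :
    ∑ v ∈ V, nodeSum V d Z v ω ^ 2 =
      ∑ q ∈ V.powersetCard d ×ˢ V.powersetCard d,
        ((V.filter fun v => v ∈ q.1 ∧ v ∈ q.2).card : ℝ) * (Z q.1 ω * Z q.2 ω) := by
  have h1 : ∀ v, nodeSum V d Z v ω ^ 2 = ∑ q ∈ V.powersetCard d ×ˢ V.powersetCard d,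
      if v ∈ q.1 ∧ v ∈ q.2 then Z q.1 ω * Z q.2 ω else 0 := by
    intro v
    rw [sq, nodeSum, Finset.sum_mul_sum, ← Finset.sum_product', ← Finset.filter_product,
      Finset.sum_filter]
  simp only [h1]
  rw [Finset.sum_comm]
  refine Finset.sum_congr rfl fun q _ => ?_
  rw [← Finset.sum_filter, Finset.sum_const, nsmul_eq_mul]

theorem sum_nodeSum_pow_four (V : Finset ν) (d : ℕ) (Z : Finset ν → Ω → ℝ) (ω : Ω) :
    ∑ v ∈ V, nodeSum V d Z v ω ^ 4 =
      ∑ q ∈ (V.powersetCard d ×ˢ V.powersetCard d) ×ˢ (V.powersetCard d ×ˢ V.powersetCard d),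
        ((V.filter fun v => (v ∈ q.1.1 ∧ v ∈ q.1.2) ∧ (v ∈ q.2.1 ∧ v ∈ q.2.2)).card : ℝ) *
          ((Z q.1.1 ω * Z q.1.2 ω) * (Z q.2.1 ω * Z q.2.2 ω)) := by
  have h1 : ∀ v, nodeSum V d Z v ω ^ 2 = ∑ q ∈ V.powersetCard d ×ˢ V.powersetCard d with
      v ∈ q.1 ∧ v ∈ q.2, Z q.1 ω * Z q.2 ω := by
    intro v
    rw [sq, nodeSum, Finset.sum_mul_sum, ← Finset.sum_product', ← Finset.filter_product]
  have h2 : ∀ v, nodeSum V d Z v ω ^ 4 =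
      ∑ q ∈ (V.powersetCard d ×ˢ V.powersetCard d) ×ˢ (V.powersetCard d ×ˢ V.powersetCard d),
        if (v ∈ q.1.1 ∧ v ∈ q.1.2) ∧ (v ∈ q.2.1 ∧ v ∈ q.2.2) then
          (Z q.1.1 ω * Z q.1.2 ω) * (Z q.2.1 ω * Z q.2.2 ω) else 0 := by
    intro v
    rw [show nodeSum V d Z v ω ^ 4 = nodeSum V d Z v ω ^ 2 * nodeSum V d Z v ω ^ 2 by ring, h1,
      Finset.sum_mul_sum, ← Finset.sum_product', ← Finset.filter_product, Finset.sum_filter]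
  simp only [h2]
  rw [Finset.sum_comm]
  refine Finset.sum_congr rfl fun q _ => ?_
  rw [← Finset.sum_filter, Finset.sum_const, nsmul_eq_mul]

theorem filter_card_le {A : Finset ν} (hA : A ∈ V.powersetCard d) {p : ν → Prop}
    [DecidablePred p] (hp : ∀ v, p v → v ∈ A) : ((V.filter p).card : ℝ) ≤ d := by
  have : (V.filter p).card ≤ A.card :=
    Finset.card_le_card fun v hv => hp v (Finset.mem_filter.1 hv).2
  rw [(Finset.mem_powersetCard.1 hA).2] at this
  exact_mod_cast this

theorem abs_integral_quad_le (h : IsDegenerateFamily Q V d β Z) (hβ : 0 ≤ β) {A B C D : Finset ν}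
    (hA : A ∈ V.powersetCard d) (hB : B ∈ V.powersetCard d) (hC : C ∈ V.powersetCard d)
    (hD : D ∈ V.powersetCard d) :
    |∫ ω, (Z A ω * Z B ω) * (Z C ω * Z D ω) ∂Q| ≤ β ^ 4 := by
  have := norm_integral_le_of_norm_le_const (μ := Q) (C := β ^ 4)
    (f := fun ω => (Z A ω * Z B ω) * (Z C ω * Z D ω)) (by
      filter_upwards [h.bound A hA, h.bound B hB, h.bound C hC, h.bound D hD] with ω h1 h2 h3 h4
      rw [Real.norm_eq_abs, abs_mul, abs_mul, abs_mul,
        show β ^ 4 = (β * β) * (β * β) by ring]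
      gcongr)
  simpa using this

theorem abs_integral_pair_le (h : IsDegenerateFamily Q V d β Z) (hβ : 0 ≤ β) {A B : Finset ν}
    (hA : A ∈ V.powersetCard d) (hB : B ∈ V.powersetCard d) :
    |∫ ω, Z A ω * Z B ω ∂Q| ≤ β ^ 2 := by
  have := norm_integral_le_of_norm_le_const (μ := Q) (C := β ^ 2)
    (f := fun ω => Z A ω * Z B ω) (by
      filter_upwards [h.bound A hA, h.bound B hB] with ω h1 h2
      rw [Real.norm_eq_abs, abs_mul, sq]
      gcongr)
  simpa using this

theorem integrable_quad (h : IsDegenerateFamily Q V d β Z) {A B C D : Finset ν}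
    (hA : A ∈ V.powersetCard d) (hB : B ∈ V.powersetCard d) (hC : C ∈ V.powersetCard d)
    (hD : D ∈ V.powersetCard d) :
    Integrable (fun ω => (Z A ω * Z B ω) * (Z C ω * Z D ω)) Q :=
  ((((h.memLp_top hA).mul_top (h.memLp_top hB)).mul_top
    ((h.memLp_top hC).mul_top (h.memLp_top hD)))).integrable le_top

theorem integrable_pair (h : IsDegenerateFamily Q V d β Z) {A B : Finset ν}
    (hA : A ∈ V.powersetCard d) (hB : B ∈ V.powersetCard d) :
    Integrable (fun ω => Z A ω * Z B ω) Q :=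
  ((h.memLp_top hA).mul_top (h.memLp_top hB)).integrable le_top

theorem powersetCard_prop (hd : 1 ≤ d) : ∀ A ∈ V.powersetCard d, A ⊆ V ∧ A.Nonempty := by
  intro A hA
  obtain ⟨h1, h2⟩ := Finset.mem_powersetCard.1 hA
  exact ⟨h1, Finset.card_pos.1 (by omega)⟩

/-- Quadruples with a common node have fewer than `2d` nodes or a vanishing mixed moment. -/
theorem sum_integral_nodeSum_pow_four_le (h : IsDegenerateFamily Q V d β Z) (hβ : 0 ≤ β)
    (hd : 1 ≤ d) :
    ∫ ω, ∑ v ∈ V, nodeSum V d Z v ω ^ 4 ∂Q ≤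
      d * β ^ 4 * (2 ^ (4 * (2 * d - 1)) * (V.card : ℝ) ^ (2 * d - 1)) := by
  simp only [sum_nodeSum_pow_four]
  rw [integral_finsetSum]
  · refine (le_abs_self _).trans
      (abs_sum_quad_le V _ (powersetCard_prop hd) _ _ ?_ ?_ (by positivity))
    · rintro ⟨⟨A, B⟩, ⟨C, D⟩⟩ hq
      simp only [Finset.mem_product] at hq
      obtain ⟨⟨hA, hB⟩, hC, hD⟩ := hq
      rw [integral_const_mul, abs_mul, Nat.abs_cast]
      exact mul_le_mul (filter_card_le hA fun v hv => hv.1.1)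
        (h.abs_integral_quad_le hβ hA hB hC hD) (abs_nonneg _) (Nat.cast_nonneg _)
    · rintro ⟨⟨A, B⟩, ⟨C, D⟩⟩ hq hlt
      simp only [Finset.mem_product] at hq
      obtain ⟨⟨hA, hB⟩, hC, hD⟩ := hq
      rw [integral_const_mul]
      rcases Finset.eq_empty_or_nonempty
        (V.filter fun v => (v ∈ A ∧ v ∈ B) ∧ (v ∈ C ∧ v ∈ D)) with he | ⟨v, hv⟩
      · simp [he]
      · obtain ⟨-, ⟨hvA, hvB⟩, hvC, hvD⟩ := Finset.mem_filter.1 hv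
        rw [h.integral_overlap A hA B hB C hC D hD
          (Finset.not_disjoint_iff.2 ⟨v, hvA, hvB⟩)
          (Finset.not_disjoint_iff.2 ⟨v, Finset.mem_union_left _ hvA, Finset.mem_union_left _ hvC⟩)
          (by simp only [quadUnion] at hlt; omega), mul_zero]
  · rintro ⟨⟨A, B⟩, ⟨C, D⟩⟩ hq
    simp only [Finset.mem_product] at hq
    exact (h.integrable_quad hq.1.1 hq.1.2 hq.2.1 hq.2.2).const_mul _

theorem integrable_sum_nodeSum_sq (h : IsDegenerateFamily Q V d β Z) :
    Integrable (fun ω => ∑ v ∈ V, nodeSum V d Z v ω ^ 2) Q := by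
  simp only [sum_nodeSum_sq]
  refine integrable_finsetSum _ fun q hq => ?_
  rw [Finset.mem_product] at hq
  exact (h.integrable_pair hq.1 hq.2).const_mul _

/-- By orthogonality only the diagonal contributes, and each `Z_A` is counted once for each of its
`d` nodes. -/
theorem integral_sum_nodeSum_sq (h : IsDegenerateFamily Q V d β Z) :
    ∫ ω, ∑ v ∈ V, nodeSum V d Z v ω ^ 2 ∂Q = d * ∫ ω, total V d Z ω ^ 2 ∂Q := by
  have h1 : ∀ ω, total V d Z ω ^ 2 = ∑ q ∈ V.powersetCard d ×ˢ V.powersetCard d,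
      Z q.1 ω * Z q.2 ω := by
    intro ω
    rw [sq, total, Finset.sum_mul_sum, ← Finset.sum_product']
  simp only [h1, sum_nodeSum_sq]
  rw [integral_finsetSum, integral_finsetSum, Finset.mul_sum]
  · refine Finset.sum_congr rfl fun q hq => ?_
    obtain ⟨hA, hB⟩ := Finset.mem_product.1 hq
    rw [integral_const_mul]
    by_cases hAB : q.1 = q.2
    · obtain ⟨hAV, hAd⟩ := Finset.mem_powersetCard.1 hB
      rw [hAB]
      simp only [and_self]
      rw [Finset.filter_mem_eq_inter, Finset.inter_eq_right.2 hAV, hAd]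
    · rw [h.orthogonal _ hA _ hB hAB, mul_zero, mul_zero]
  · intro q hq
    obtain ⟨hA, hB⟩ := Finset.mem_product.1 hq
    exact h.integrable_pair hA hB
  · intro q hq
    obtain ⟨hA, hB⟩ := Finset.mem_product.1 hq
    exact (h.integrable_pair hA hB).const_mul _

/-- The variance of the sum of the squared node sums: two pairs of sets with disjoint unions do
not contribute since their moments factorise; the other quadruples have fewer than `2d` nodes or a
vanishing contribution. -/
theorem integral_sum_nodeSum_sq_sub_sq_le (h : IsDegenerateFamily Q V d β Z) (hβ : 0 ≤ β)
    (hd : 1 ≤ d) :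
    ∫ ω, (∑ v ∈ V, nodeSum V d Z v ω ^ 2 - d * ∫ ω, total V d Z ω ^ 2 ∂Q) ^ 2 ∂Q ≤
      2 * d ^ 2 * β ^ 4 * (2 ^ (4 * (2 * d - 1)) * (V.card : ℝ) ^ (2 * d - 1)) := by
  rw [← h.integral_sum_nodeSum_sq]
  set w : Finset ν × Finset ν → ℝ := fun q => ((V.filter fun v => v ∈ q.1 ∧ v ∈ q.2).card : ℝ)
    with hw
  set e : Finset ν × Finset ν → ℝ := fun q => ∫ ω, Z q.1 ω * Z q.2 ω ∂Q with he
  have hmean : ∫ ω, ∑ v ∈ V, nodeSum V d Z v ω ^ 2 ∂Q =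
      ∑ q ∈ V.powersetCard d ×ˢ V.powersetCard d, w q * e q := by
    simp only [sum_nodeSum_sq]
    rw [integral_finsetSum]
    · exact Finset.sum_congr rfl fun q _ => integral_const_mul _ _
    · intro q hq
      obtain ⟨hA, hB⟩ := Finset.mem_product.1 hq
      exact (h.integrable_pair hA hB).const_mul _
  have hexp : ∀ ω, (∑ v ∈ V, nodeSum V d Z v ω ^ 2 -
        ∫ ω, ∑ v ∈ V, nodeSum V d Z v ω ^ 2 ∂Q) ^ 2 =
      ∑ q ∈ (V.powersetCard d ×ˢ V.powersetCard d) ×ˢ (V.powersetCard d ×ˢ V.powersetCard d),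
        w q.1 * w q.2 * ((Z q.1.1 ω * Z q.1.2 ω - e q.1) * (Z q.2.1 ω * Z q.2.2 ω - e q.2)) := by
    intro ω
    rw [hmean, sum_nodeSum_sq, ← Finset.sum_sub_distrib, sq, Finset.sum_mul_sum,
      ← Finset.sum_product']
    refine Finset.sum_congr rfl fun q _ => ?_
    simp only [hw]
    ring
  have hcov : ∀ A ∈ V.powersetCard d, ∀ B ∈ V.powersetCard d, ∀ C ∈ V.powersetCard d,
      ∀ D ∈ V.powersetCard d,
      Integrable (fun ω => (Z A ω * Z B ω - e (A, B)) * (Z C ω * Z D ω - e (C, D))) Q ∧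
      ∫ ω, (Z A ω * Z B ω - e (A, B)) * (Z C ω * Z D ω - e (C, D)) ∂Q =
        ∫ ω, (Z A ω * Z B ω) * (Z C ω * Z D ω) ∂Q - e (A, B) * e (C, D) := by
    intro A hA B hB C hC D hD
    have i1 := h.integrable_quad hA hB hC hD
    have i2 := (h.integrable_pair hA hB).mul_const (e (C, D))
    have i3 := (h.integrable_pair hC hD).const_mul (e (A, B))
    have hfun : (fun ω => (Z A ω * Z B ω - e (A, B)) * (Z C ω * Z D ω - e (C, D))) =
        fun ω => ((Z A ω * Z B ω) * (Z C ω * Z D ω) - Z A ω * Z B ω * e (C, D)) -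
          (e (A, B) * (Z C ω * Z D ω) - e (A, B) * e (C, D)) := by
      funext ω; ring
    rw [hfun]
    refine ⟨(i1.sub i2).sub (i3.sub (integrable_const _)), ?_⟩
    have e1 := integral_sub (i1.sub i2) (i3.sub (integrable_const (e (A, B) * e (C, D))))
    simp only [Pi.sub_apply] at e1
    rw [e1, integral_sub i1 i2,
      integral_sub i3 (integrable_const _), integral_mul_const, integral_const_mul]
    simp [he]
  simp only [hexp]
  rw [integral_finsetSum]
  · refine (le_abs_self _).trans
      (abs_sum_quad_le V _ (powersetCard_prop hd) _ _ ?_ ?_ (by positivity))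
    · rintro ⟨⟨A, B⟩, ⟨C, D⟩⟩ hq
      simp only [Finset.mem_product] at hq
      obtain ⟨⟨hA, hB⟩, hC, hD⟩ := hq
      rw [integral_const_mul, (hcov A hA B hB C hC D hD).2, abs_mul, abs_mul]
      have b1 : |w (A, B)| ≤ d := by
        simp only [hw, Nat.abs_cast]
        exact filter_card_le hA fun v hv => hv.1
      have b2 : |w (C, D)| ≤ d := by
        simp only [hw, Nat.abs_cast]
        exact filter_card_le hC fun v hv => hv.1
      have b3 : |∫ ω, (Z A ω * Z B ω) * (Z C ω * Z D ω) ∂Q - e (A, B) * e (C, D)| ≤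
          2 * β ^ 4 := by
        refine (abs_sub _ _).trans ?_
        rw [abs_mul]
        have := h.abs_integral_quad_le hβ hA hB hC hD
        have := mul_le_mul (h.abs_integral_pair_le hβ hA hB) (h.abs_integral_pair_le hβ hC hD)
          (abs_nonneg _) (by positivity)
        simp only [he]
        nlinarith
      calc |w (A, B)| * |w (C, D)| *
            |∫ ω, (Z A ω * Z B ω) * (Z C ω * Z D ω) ∂Q - e (A, B) * e (C, D)|
          ≤ d * d * (2 * β ^ 4) := by gcongr
        _ = 2 * d ^ 2 * β ^ 4 := by ring
    · rintro ⟨⟨A, B⟩, ⟨C, D⟩⟩ hq hlt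
      simp only [Finset.mem_product] at hq
      obtain ⟨⟨hA, hB⟩, hC, hD⟩ := hq
      rw [integral_const_mul, (hcov A hA B hB C hC D hD).2]
      have hlt' : 2 * d ≤ ((A ∪ B) ∪ (C ∪ D)).card := by
        simp only [quadUnion] at hlt; omega
      by_cases hdis : Disjoint (A ∪ B) (C ∪ D)
      · rw [h.integral_disjoint A hA B hB C hC D hD hdis, sub_self, mul_zero]
      by_cases hAB : Disjoint A B
      · have : w (A, B) = 0 := by
          simp only [hw, Nat.cast_eq_zero, Finset.card_eq_zero]
          refine Finset.filter_eq_empty_iff.2 fun v _ hv => ?_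
          exact Finset.disjoint_left.1 hAB hv.1 hv.2
        simp [this]
      rw [h.integral_overlap A hA B hB C hC D hD hAB hdis hlt', zero_sub]
      have : e (A, B) * e (C, D) = 0 := by
        by_cases h1 : A = B
        · by_cases h2 : C = D
          · subst h1 h2
            exfalso
            rw [Finset.union_idempotent, Finset.union_idempotent] at hdis hlt'
            have c1 := Finset.card_union_add_card_inter A C
            rw [(Finset.mem_powersetCard.1 hA).2, (Finset.mem_powersetCard.1 hC).2] at c1
            exact hdis (Finset.disjoint_iff_inter_eq_empty.2 (Finset.card_eq_zero.1 (by omega)))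
          · simp only [he, h.orthogonal _ hC _ hD h2, mul_zero]
        · simp only [he, h.orthogonal _ hA _ hB h1, zero_mul]
      rw [this, neg_zero, mul_zero]
  · rintro ⟨⟨A, B⟩, ⟨C, D⟩⟩ hq
    simp only [Finset.mem_product] at hq
    exact (hcov A hq.1.1 B hq.1.2 C hq.2.1 D hq.2.2).1.const_mul _

end IsDegenerateFamily

end SteinBound

/-! ### Characteristic functions of degenerate sums -/

theorem norm_cexp_I_mul_sub_one_sub_le (x : ℝ) :
    ‖Complex.exp (x * Complex.I) - 1 - x * Complex.I‖ ≤ 2 * x ^ 2 := by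
  rcases le_or_gt |x| 1 with hx | hx
  · refine (Complex.norm_exp_sub_one_sub_id_le (by simpa using hx)).trans ?_
    have : ‖(x : ℂ) * Complex.I‖ ^ 2 = x ^ 2 := by simp
    rw [this]
    nlinarith [sq_nonneg x]
  · have h1 : ‖Complex.exp (x * Complex.I) - 1‖ ≤ |x| := by
      rw [mul_comm]
      exact Real.norm_exp_I_mul_ofReal_sub_one_le
    have h2 : ‖(x : ℂ) * Complex.I‖ = |x| := by simp
    refine (norm_sub_le _ _).trans ?_
    rw [h2, ← sq_abs]
    nlinarith

theorem norm_cexp_ofReal_mul_I_sub_le (x y : ℝ) :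
    ‖Complex.exp (x * Complex.I) - Complex.exp (y * Complex.I)‖ ≤ |x - y| := by
  have : Complex.exp (x * Complex.I) - Complex.exp (y * Complex.I) =
      Complex.exp (y * Complex.I) * (Complex.exp (Complex.I * ((x - y : ℝ) : ℂ)) - 1) := by
    rw [mul_sub, ← Complex.exp_add, mul_one]
    push_cast
    ring_nf
  rw [this, norm_mul, Complex.norm_exp_ofReal_mul_I, one_mul]
  exact Real.norm_exp_I_mul_ofReal_sub_one_le

/-- A function that almost solves the differential equation `f' = -s t f` of the Gaussian
characteristic function is close to it. -/
theorem norm_sub_exp_le_of_deriv {f f' : ℝ → ℂ} {s ε t : ℝ} (hs : 0 ≤ s)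
    (hf : ∀ x, HasDerivAt f (f' x) x) (h0 : f 0 = 1)
    (hε : ∀ x, |x| ≤ |t| → ‖f' x + s * x * f x‖ ≤ ε) :
    ‖f t - Complex.exp (-(s * t ^ 2 / 2 : ℝ))‖ ≤ ε * |t| := by
  have hε0 : 0 ≤ ε := (norm_nonneg _).trans (hε 0 (by simp))
  let g : ℝ → ℂ := fun x => f x * Complex.exp ((s * x ^ 2 / 2 : ℝ))
  have hg : ∀ x, HasDerivAt g ((f' x + s * x * f x) * Complex.exp ((s * x ^ 2 / 2 : ℝ))) x := by
    intro x
    have h1 : HasDerivAt (fun x : ℝ => s * x ^ 2 / 2) (s * x) x := by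
      have := ((hasDerivAt_pow 2 x).const_mul s).div_const 2
      refine this.congr_deriv ?_
      push_cast
      ring
    have h2 := (hf x).mul (h1.ofReal_comp.cexp)
    refine h2.congr_deriv ?_
    push_cast
    ring
  have hb : ∀ x ∈ Set.uIcc 0 t, ‖(f' x + s * x * f x) * Complex.exp ((s * x ^ 2 / 2 : ℝ))‖ ≤
      ε * Real.exp (s * t ^ 2 / 2) := by
    intro x hx
    have hx' : |x| ≤ |t| := by
      have := Set.abs_sub_left_of_mem_uIcc hx
      simpa using this
    rw [norm_mul, Complex.norm_exp, Complex.ofReal_re]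
    have : x ^ 2 ≤ t ^ 2 := sq_le_sq.2 hx'
    refine mul_le_mul (hε x hx') (Real.exp_le_exp.2 ?_) (Real.exp_pos _).le hε0
    nlinarith
  have hm := (convex_uIcc (0 : ℝ) t).norm_image_sub_le_of_norm_hasDerivWithin_le
    (fun x _ => (hg x).hasDerivWithinAt) hb Set.left_mem_uIcc Set.right_mem_uIcc
  have h3 : f t - Complex.exp (-(s * t ^ 2 / 2 : ℝ)) =
      (g t - g 0) * Complex.exp (-(s * t ^ 2 / 2 : ℝ)) := by
    simp only [g, h0]
    rw [sub_mul, mul_assoc, ← Complex.exp_add]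
    simp
  rw [h3, norm_mul]
  have h4 : ‖Complex.exp (-(s * t ^ 2 / 2 : ℝ))‖ = Real.exp (-(s * t ^ 2 / 2)) := by
    rw [← Complex.ofReal_neg, Complex.norm_exp, Complex.ofReal_re]
  rw [h4]
  calc ‖g t - g 0‖ * Real.exp (-(s * t ^ 2 / 2))
      ≤ (ε * Real.exp (s * t ^ 2 / 2) * ‖t - 0‖) * Real.exp (-(s * t ^ 2 / 2)) := by gcongr
    _ = ε * |t| * (Real.exp (s * t ^ 2 / 2) * Real.exp (-(s * t ^ 2 / 2))) := by
        rw [sub_zero, Real.norm_eq_abs]; ring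
    _ = ε * |t| := by rw [← Real.exp_add]; simp

section

variable {Ω : Type*} [MeasurableSpace Ω] {Q : Measure Ω} [IsProbabilityMeasure Q]

theorem integrable_mul_cexp {f W : Ω → ℝ} (hf : Integrable f Q) (hW : AEMeasurable W Q) (t : ℝ) :
    Integrable (fun ω => (f ω : ℂ) * Complex.exp ((t * W ω : ℝ) * Complex.I)) Q := by
  refine hf.ofReal.mul_bdd (c := 1) ?_ (Eventually.of_forall fun ω => ?_)
  · refine (Complex.measurable_exp.comp_aemeasurable ?_).aestronglyMeasurable
    exact (Complex.measurable_ofReal.comp_aemeasurable (hW.const_mul t)).mul_const _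
  · rw [Complex.norm_exp_ofReal_mul_I]

/-- The characteristic function of an integrable random variable is differentiable. -/
theorem hasDerivAt_integral_cexp {W : Ω → ℝ} (hW : Integrable W Q) (t : ℝ) :
    HasDerivAt (fun t : ℝ => ∫ ω, Complex.exp ((t * W ω : ℝ) * Complex.I) ∂Q)
      (Complex.I * ∫ ω, (W ω : ℂ) * Complex.exp ((t * W ω : ℝ) * Complex.I) ∂Q) t := by
  have hmeas : ∀ t : ℝ, AEStronglyMeasurable
      (fun ω => Complex.exp ((t * W ω : ℝ) * Complex.I)) Q := fun t => by
    have := integrable_mul_cexp (integrable_const (μ := Q) (1 : ℝ)) hW.aemeasurable t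
    simpa using this.aestronglyMeasurable
  have h := hasDerivAt_integral_of_dominated_loc_of_deriv_le (μ := Q) (𝕜 := ℝ) (x₀ := t)
    (s := Set.univ) (F := fun (t : ℝ) ω => Complex.exp ((t * W ω : ℝ) * Complex.I))
    (F' := fun (t : ℝ) ω => Complex.I * ((W ω : ℂ) * Complex.exp ((t * W ω : ℝ) * Complex.I)))
    (bound := fun ω => |W ω|) Filter.univ_mem (Eventually.of_forall hmeas)
    (by
      have := integrable_mul_cexp (integrable_const (μ := Q) (1 : ℝ)) hW.aemeasurable t
      simpa using this)
    (((integrable_mul_cexp hW hW.aemeasurable t).const_mul _).aestronglyMeasurable)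
    (Eventually.of_forall fun ω x _ => by
      rw [norm_mul, norm_mul, Complex.norm_exp_ofReal_mul_I]
      simp)
    hW.abs
    (Eventually.of_forall fun ω x _ => by
      have h1 : HasDerivAt (fun x : ℝ => x * W ω) (W ω) x := hasDerivAt_mul_const (W ω)
      have h2 := (h1.ofReal_comp.mul_const Complex.I).cexp
      refine h2.congr_deriv ?_
      ring)
  rw [← integral_const_mul]
  exact h.2

end

namespace IsDegenerateFamily

variable {Ω : Type*} [MeasurableSpace Ω] {ν : Type*} [DecidableEq ν]
variable {Q : Measure Ω} [IsProbabilityMeasure Q] {V : Finset ν} {d : ℕ} {β : ℝ}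
  {Z : Finset ν → Ω → ℝ}

/-- The part of the sum at a node is centred given the rest of the sum. -/
theorem integral_nodeSum_mul_cexp (h : IsDegenerateFamily Q V d β Z) (v : ν) (t : ℝ) :
    ∫ ω, (nodeSum V d Z v ω : ℂ) *
      Complex.exp ((t * (total V d Z ω - nodeSum V d Z v ω) : ℝ) * Complex.I) ∂Q = 0 := by
  have hR : Measurable fun ω => total V d Z ω - nodeSum V d Z v ω :=
    h.measurable_total.sub (h.measurable_nodeSum v)
  have hsum : ∀ ω, (nodeSum V d Z v ω : ℂ) *
      Complex.exp ((t * (total V d Z ω - nodeSum V d Z v ω) : ℝ) * Complex.I) =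
      ∑ A ∈ V.powersetCard d with v ∈ A, (Z A ω : ℂ) *
        Complex.exp ((t * (total V d Z ω - nodeSum V d Z v ω) : ℝ) * Complex.I) := by
    intro ω
    rw [← Finset.sum_mul]
    simp [nodeSum]
  simp only [hsum]
  rw [integral_finsetSum]
  · refine Finset.sum_eq_zero fun A hA => ?_
    obtain ⟨hA, hv⟩ := Finset.mem_filter.1 hA
    have hint := (h.memLp_top hA).integrable le_top
    have hc := h.integral_mul_eq_zero A hA v hv (fun x => Real.cos (t * x)) (by fun_prop)
      ⟨1, fun x => Real.abs_cos_le_one _⟩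
    have hs := h.integral_mul_eq_zero A hA v hv (fun x => Real.sin (t * x)) (by fun_prop)
      ⟨1, fun x => Real.abs_sin_le_one _⟩
    have ic : Integrable (fun ω => Z A ω *
        Real.cos (t * ∑ B ∈ V.powersetCard d with v ∉ B, Z B ω)) Q := by
      refine hint.mul_bdd (c := 1) ?_ (Eventually.of_forall fun ω => Real.abs_cos_le_one _)
      simp only [← total_sub_nodeSum]
      exact (Real.measurable_cos.comp (hR.const_mul t)).aestronglyMeasurable
    have is : Integrable (fun ω => Z A ω *
        Real.sin (t * ∑ B ∈ V.powersetCard d with v ∉ B, Z B ω)) Q := by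
      refine hint.mul_bdd (c := 1) ?_ (Eventually.of_forall fun ω => Real.abs_sin_le_one _)
      simp only [← total_sub_nodeSum]
      exact (Real.measurable_sin.comp (hR.const_mul t)).aestronglyMeasurable
    have hsplit : ∀ ω, (Z A ω : ℂ) *
        Complex.exp ((t * (total V d Z ω - nodeSum V d Z v ω) : ℝ) * Complex.I) =
        ((Z A ω * Real.cos (t * ∑ B ∈ V.powersetCard d with v ∉ B, Z B ω) : ℝ) : ℂ) +
        ((Z A ω * Real.sin (t * ∑ B ∈ V.powersetCard d with v ∉ B, Z B ω) : ℝ) : ℂ) *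
          Complex.I := by
      intro ω
      rw [total_sub_nodeSum, Complex.exp_mul_I, ← Complex.ofReal_cos, ← Complex.ofReal_sin]
      push_cast
      ring
    simp only [hsplit]
    rw [integral_add ic.ofReal (is.ofReal.mul_const _), integral_mul_const, integral_complex_ofReal,
      integral_complex_ofReal, hc, hs]
    simp
  · intro A hA
    exact integrable_mul_cexp ((h.memLp_top (Finset.mem_filter.1 hA).1).integrable le_top)
      hR.aemeasurable t

/-- **Normal approximation** for the sum of a degenerate family. With `W` the total sum and `S_v`
its part at the node `v`, one has `d E[W e^{itW}] = ∑_v E[S_v (e^{itW} - e^{it(W - S_v)})]`, which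
is `it E[∑_v S_v² e^{itW}]` up to third moments of the `S_v`. Since `∑_v S_v²` concentrates at
`d E[W²]`, the characteristic function of `W` almost solves the differential equation of the
Gaussian one. -/
theorem norm_charFun_sub_le (h : IsDegenerateFamily Q V d β Z) (hβ : 0 ≤ β) (hd : 1 ≤ d) {δ : ℝ}
    (hδ : 0 < δ)
    (hδβ : 2 * d ^ 2 * β ^ 4 * (2 ^ (4 * (2 * d - 1)) * (V.card : ℝ) ^ (2 * d - 1)) ≤ δ ^ 2)
    (t : ℝ) :
    ‖(∫ ω, Complex.exp ((t * total V d Z ω : ℝ) * Complex.I) ∂Q) -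
      Complex.exp (-((∫ ω, total V d Z ω ^ 2 ∂Q) * t ^ 2 / 2 : ℝ))‖ ≤
      δ * ((d * (∫ ω, total V d Z ω ^ 2 ∂Q) + 1) * t ^ 2 + |t|) * |t| := by
  set W := total V d Z with hWdef
  set S := nodeSum V d Z with hSdef
  set s := ∫ ω, W ω ^ 2 ∂Q with hs
  have hs0 : 0 ≤ s := integral_nonneg fun ω => sq_nonneg _
  have hd0 : (1 : ℝ) ≤ d := by exact_mod_cast hd
  have hWm : Measurable W := h.measurable_total
  have hWint : Integrable W Q := h.memLp_total.integrable le_top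
  have hSL : ∀ v, MemLp (S v) ⊤ Q := h.memLp_nodeSum
  have hS2 : ∀ v, Integrable (fun ω => S v ω ^ 2) Q := fun v => by
    simpa [sq] using ((hSL v).mul_top (hSL v)).integrable le_top
  have hS4 : ∀ v, Integrable (fun ω => S v ω ^ 4) Q := fun v => by
    have := (((hSL v).mul_top (hSL v)).mul_top ((hSL v).mul_top (hSL v))).integrable le_top
    refine this.congr (Eventually.of_forall fun ω => ?_)
    show S v ω * S v ω * (S v ω * S v ω) = S v ω ^ 4
    ring
  set T : Ω → ℝ := fun ω => ∑ v ∈ V, S v ω ^ 2 with hT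
  have hTint : Integrable T Q := h.integrable_sum_nodeSum_sq
  have hTmean : ∫ ω, T ω ∂Q = d * s := h.integral_sum_nodeSum_sq
  have hTL : MemLp (fun ω => T ω - d * s) ⊤ Q := by
    have : MemLp T ⊤ Q := memLp_finsetSum _ fun v _ => by
      simpa [sq] using (hSL v).mul_top (hSL v)
    exact this.sub (memLp_const _)
  -- both moment bounds of the family, in terms of `δ`
  have hbd : 0 ≤ β ^ 4 * (2 ^ (4 * (2 * d - 1)) * (V.card : ℝ) ^ (2 * d - 1)) := by positivity
  have h4 : ∑ v ∈ V, ∫ ω, S v ω ^ 4 ∂Q ≤ δ ^ 2 := by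
    rw [← integral_finsetSum _ fun v _ => hS4 v]
    refine (h.sum_integral_nodeSum_pow_four_le hβ hd).trans (le_trans ?_ hδβ)
    rw [mul_assoc, mul_assoc (2 * (d : ℝ) ^ 2)]
    refine mul_le_mul_of_nonneg_right ?_ hbd
    nlinarith
  have hvar : ∫ ω, (T ω - d * s) ^ 2 ∂Q ≤ δ ^ 2 :=
    (h.integral_sum_nodeSum_sq_sub_sq_le hβ hd).trans hδβ
  have hT1 : ∫ ω, |T ω - d * s| ∂Q ≤ δ := by
    have hsq : Integrable (fun ω => (T ω - d * s) ^ 2) Q := by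
      simpa [sq] using (hTL.mul_top hTL).integrable le_top
    calc ∫ ω, |T ω - d * s| ∂Q ≤ ∫ ω, (δ + (T ω - d * s) ^ 2 / δ) / 2 ∂Q := by
          refine integral_mono (hTL.integrable le_top).abs
            (((integrable_const δ).add (hsq.div_const δ)).div_const 2) fun ω => ?_
          have : 0 ≤ (δ - |T ω - d * s|) ^ 2 := sq_nonneg _
          have h2 := sq_abs (T ω - d * s)
          rw [← h2]
          field_simp
          nlinarith
      _ = (δ + (∫ ω, (T ω - d * s) ^ 2 ∂Q) / δ) / 2 := by
          rw [integral_div, integral_add (integrable_const δ) (hsq.div_const δ), integral_div]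
          simp
      _ ≤ (δ + δ ^ 2 / δ) / 2 := by gcongr
      _ = δ := by field_simp; ring
  have hS3i : ∀ v, Integrable (fun ω => |S v ω| ^ 3) Q := fun v => by
    refine ((hS2 v).add (hS4 v)).mono'
      ((h.measurable_nodeSum v).abs.pow_const 3).aestronglyMeasurable
      (Eventually.of_forall fun ω => ?_)
    show ‖|S v ω| ^ 3‖ ≤ S v ω ^ 2 + S v ω ^ 4
    rw [Real.norm_of_nonneg (by positivity), ← sq_abs, ← Even.pow_abs (n := 4) (by decide)]
    nlinarith [sq_nonneg (|S v ω| * (|S v ω| - 1)), abs_nonneg (S v ω)]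
  have hS3 : ∑ v ∈ V, ∫ ω, |S v ω| ^ 3 ∂Q ≤ δ * (d * s + 1) / 2 := by
    have : ∀ v ∈ V, ∫ ω, |S v ω| ^ 3 ∂Q ≤
        (δ * ∫ ω, S v ω ^ 2 ∂Q + (∫ ω, S v ω ^ 4 ∂Q) / δ) / 2 := by
      intro v _
      rw [← integral_const_mul, ← integral_div, ← integral_add ((hS2 v).const_mul δ)
        ((hS4 v).div_const δ), ← integral_div]
      refine integral_mono (hS3i v) ((((hS2 v).const_mul δ).add
        ((hS4 v).div_const δ)).div_const 2) fun ω => ?_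
      have h1 : 0 ≤ (S v ω * (δ - |S v ω|)) ^ 2 := sq_nonneg _
      show |S v ω| ^ 3 ≤ (δ * S v ω ^ 2 + S v ω ^ 4 / δ) / 2
      rw [le_div_iff₀ two_pos, ← sub_nonneg]
      have h2 := sq_abs (S v ω)
      have h3 : δ * S v ω ^ 2 + S v ω ^ 4 / δ - |S v ω| ^ 3 * 2 =
          (S v ω * (δ - |S v ω|)) ^ 2 / δ := by
        rw [mul_pow, ← sq_abs (S v ω), ← Even.pow_abs (n := 4) (by decide)]
        field_simp
        ring
      rw [h3]
      positivity
    refine (Finset.sum_le_sum this).trans ?_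
    rw [← Finset.sum_div, Finset.sum_add_distrib, ← Finset.mul_sum, ← Finset.sum_div,
      ← integral_finsetSum _ fun v _ => hS2 v]
    have h5 : ∫ ω, ∑ v ∈ V, S v ω ^ 2 ∂Q = d * s := hTmean
    rw [h5]
    have : (∑ v ∈ V, ∫ ω, S v ω ^ 4 ∂Q) / δ ≤ δ := by
      rw [div_le_iff₀ hδ]; nlinarith
    linarith
  refine norm_sub_exp_le_of_deriv hs0 (fun x => hasDerivAt_integral_cexp hWint x) (by simp) ?_
  intro x hx
  -- the almost differential equation
  set E : Ω → ℂ := fun ω => Complex.exp ((x * W ω : ℝ) * Complex.I) with hE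
  have hEn : ∀ ω, ‖E ω‖ = 1 := fun ω => Complex.norm_exp_ofReal_mul_I _
  have iWE : Integrable (fun ω => (W ω : ℂ) * E ω) Q :=
    integrable_mul_cexp hWint hWm.aemeasurable x
  have iSE : ∀ v, Integrable (fun ω => (S v ω : ℂ) * E ω) Q := fun v =>
    integrable_mul_cexp ((hSL v).integrable le_top) hWm.aemeasurable x
  have iS2E : ∀ v, Integrable (fun ω => ((S v ω ^ 2 : ℝ) : ℂ) * E ω) Q := fun v =>
    integrable_mul_cexp (hS2 v) hWm.aemeasurable x
  have iTE : Integrable (fun ω => ((T ω - d * s : ℝ) : ℂ) * E ω) Q :=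
    integrable_mul_cexp (hTL.integrable le_top) hWm.aemeasurable x
  have iE : Integrable E Q := by
    have := integrable_mul_cexp (integrable_const (μ := Q) (1 : ℝ)) hWm.aemeasurable x
    simpa only [Complex.ofReal_one, one_mul] using this
  have hv : ∀ v ∈ V, ‖(∫ ω, (S v ω : ℂ) * E ω ∂Q) -
      x * Complex.I * ∫ ω, ((S v ω ^ 2 : ℝ) : ℂ) * E ω ∂Q‖ ≤
        2 * x ^ 2 * ∫ ω, |S v ω| ^ 3 ∂Q := by
    intro v _
    have h0 := h.integral_nodeSum_mul_cexp v x
    have iR : Integrable (fun ω => (S v ω : ℂ) *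
        Complex.exp ((x * (W ω - S v ω) : ℝ) * Complex.I)) Q :=
      integrable_mul_cexp ((hSL v).integrable le_top)
        (hWm.sub (h.measurable_nodeSum v)).aemeasurable x
    have e1 : (∫ ω, (S v ω : ℂ) * E ω ∂Q) -
        x * Complex.I * ∫ ω, ((S v ω ^ 2 : ℝ) : ℂ) * E ω ∂Q =
        ∫ ω, ((S v ω : ℂ) * E ω -
          (S v ω : ℂ) * Complex.exp ((x * (W ω - S v ω) : ℝ) * Complex.I)) -
          x * Complex.I * (((S v ω ^ 2 : ℝ) : ℂ) * E ω) ∂Q := by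
      have := integral_sub ((iSE v).sub iR) ((iS2E v).const_mul (x * Complex.I))
      simp only [Pi.sub_apply] at this
      rw [this, integral_sub (iSE v) iR, h0, sub_zero, integral_const_mul]
    rw [e1, ← integral_const_mul]
    refine norm_integral_le_of_norm_le ((hS3i v).const_mul _) (Eventually.of_forall fun ω => ?_)
    have e2 : ((S v ω : ℂ) * E ω -
          (S v ω : ℂ) * Complex.exp ((x * (W ω - S v ω) : ℝ) * Complex.I)) -
          x * Complex.I * (((S v ω ^ 2 : ℝ) : ℂ) * E ω) =
        -((S v ω : ℂ) * E ω * (Complex.exp ((-(x * S v ω) : ℝ) * Complex.I) - 1 -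
          ((-(x * S v ω) : ℝ) : ℂ) * Complex.I)) := by
      have : Complex.exp ((x * (W ω - S v ω) : ℝ) * Complex.I) =
          E ω * Complex.exp ((-(x * S v ω) : ℝ) * Complex.I) := by
        rw [hE, ← Complex.exp_add]
        push_cast
        ring_nf
      rw [this]
      push_cast
      ring
    rw [e2, norm_neg, norm_mul, norm_mul, hEn, mul_one, Complex.norm_real, Real.norm_eq_abs]
    calc |S v ω| * ‖Complex.exp ((-(x * S v ω) : ℝ) * Complex.I) - 1 -
          ((-(x * S v ω) : ℝ) : ℂ) * Complex.I‖
        ≤ |S v ω| * (2 * (-(x * S v ω)) ^ 2) := by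
          gcongr
          exact norm_cexp_I_mul_sub_one_sub_le _
      _ = 2 * x ^ 2 * |S v ω| ^ 3 := by
          rw [neg_sq, mul_pow, ← sq_abs (S v ω)]; ring
  have e3 : (d : ℂ) * ∫ ω, (W ω : ℂ) * E ω ∂Q = ∑ v ∈ V, ∫ ω, (S v ω : ℂ) * E ω ∂Q := by
    rw [← integral_finsetSum _ fun v _ => iSE v, ← integral_const_mul]
    refine integral_congr_ae (Eventually.of_forall fun ω => ?_)
    have := sum_nodeSum V d Z ω
    show (d : ℂ) * ((W ω : ℂ) * E ω) = ∑ v ∈ V, (S v ω : ℂ) * E ω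
    rw [← Finset.sum_mul, ← Complex.ofReal_sum, hSdef, this]
    push_cast
    ring
  have e4 : ∫ ω, ((T ω - d * s : ℝ) : ℂ) * E ω ∂Q =
      ∑ v ∈ V, ∫ ω, ((S v ω ^ 2 : ℝ) : ℂ) * E ω ∂Q - d * s * ∫ ω, E ω ∂Q := by
    have e := integral_sub (integrable_finsetSum V fun v _ => iS2E v)
      (iE.const_mul ((d : ℂ) * s))
    rw [integral_const_mul, integral_finsetSum _ fun v _ => iS2E v] at e
    rw [← e]
    refine integral_congr_ae (Eventually.of_forall fun ω => ?_)
    show ((T ω - d * s : ℝ) : ℂ) * E ω = ∑ v ∈ V, ((S v ω ^ 2 : ℝ) : ℂ) * E ω - d * s * E ω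
    rw [← Finset.sum_mul, ← Complex.ofReal_sum, hT]
    push_cast
    ring
  have e5 : (d : ℂ) * (Complex.I * ∫ ω, (W ω : ℂ) * E ω ∂Q + s * x * ∫ ω, E ω ∂Q) =
      Complex.I * (∑ v ∈ V, ((∫ ω, (S v ω : ℂ) * E ω ∂Q) -
        x * Complex.I * ∫ ω, ((S v ω ^ 2 : ℝ) : ℂ) * E ω ∂Q) +
        x * Complex.I * ∫ ω, ((T ω - d * s : ℝ) : ℂ) * E ω ∂Q) := by
    rw [e4, Finset.sum_sub_distrib, ← e3, ← Finset.mul_sum]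
    linear_combination ((d : ℂ) * s * x * ∫ ω, E ω ∂Q) * Complex.I_sq
  have hn : ‖∫ ω, ((T ω - d * s : ℝ) : ℂ) * E ω ∂Q‖ ≤ δ := by
    refine (norm_integral_le_of_norm_le (hTL.integrable le_top).abs
      (Eventually.of_forall fun ω => ?_)).trans hT1
    rw [norm_mul, hEn, mul_one, Complex.norm_real, Real.norm_eq_abs]
  have h6 : (d : ℝ) * ‖Complex.I * ∫ ω, (W ω : ℂ) * E ω ∂Q + s * x * ∫ ω, E ω ∂Q‖ ≤
      2 * x ^ 2 * (δ * (d * s + 1) / 2) + |x| * δ := by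
    have : (d : ℝ) = ‖(d : ℂ)‖ := by simp
    rw [this, ← norm_mul, e5, norm_mul, Complex.norm_I, one_mul]
    refine (norm_add_le _ _).trans (add_le_add ?_ ?_)
    · refine (norm_sum_le _ _).trans ((Finset.sum_le_sum hv).trans ?_)
      rw [← Finset.mul_sum]
      simp only [Complex.norm_natCast]
      gcongr
    · rw [norm_mul, norm_mul, Complex.norm_I, mul_one, Complex.norm_real, Real.norm_eq_abs]
      gcongr
  have h7 : ‖Complex.I * ∫ ω, (W ω : ℂ) * E ω ∂Q + s * x * ∫ ω, E ω ∂Q‖ ≤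
      2 * x ^ 2 * (δ * (d * s + 1) / 2) + |x| * δ := by
    refine le_trans ?_ h6
    exact le_mul_of_one_le_left (norm_nonneg _) hd0
  refine h7.trans ?_
  have h8 : x ^ 2 ≤ t ^ 2 := sq_le_sq.2 hx
  have h9 : 0 ≤ (d : ℝ) * s + 1 := by positivity
  calc 2 * x ^ 2 * (δ * (d * s + 1) / 2) + |x| * δ = δ * ((d * s + 1) * x ^ 2 + |x|) := by ring
    _ ≤ δ * ((d * s + 1) * t ^ 2 + |t|) := by gcongr

end IsDegenerateFamily

/-! ### Conditional expectations given families of independent variables -/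

section CondExp

variable {Ω : Type*} {m0 : MeasurableSpace Ω} {Q : Measure Ω} [IsProbabilityMeasure Q]

/-- Integrals over a supremum of two σ-algebras are determined on the intersections. -/
theorem setIntegral_eq_of_sup {mA mC : MeasurableSpace Ω} (hA : mA ≤ m0) (hC : mC ≤ m0)
    {f g : Ω → ℝ} (hf : Integrable f Q) (hg : Integrable g Q)
    (hfg : ∀ a c, MeasurableSet[mA] a → MeasurableSet[mC] c →
      ∫ ω in a ∩ c, f ω ∂Q = ∫ ω in a ∩ c, g ω ∂Q) {s : Set Ω} (hs : MeasurableSet[mA ⊔ mC] s) :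
    ∫ ω in s, f ω ∂Q = ∫ ω in s, g ω ∂Q := by
  let π : Set (Set Ω) := {s | ∃ a c, MeasurableSet[mA] a ∧ MeasurableSet[mC] c ∧ s = a ∩ c}
  have hgen : mA ⊔ mC = MeasurableSpace.generateFrom π := by
    refine le_antisymm (sup_le ?_ ?_) (MeasurableSpace.generateFrom_le ?_)
    · intro a ha
      exact MeasurableSpace.measurableSet_generateFrom
        ⟨a, Set.univ, ha, MeasurableSet.univ, by simp⟩
    · intro c hc
      exact MeasurableSpace.measurableSet_generateFrom
        ⟨Set.univ, c, MeasurableSet.univ, hc, by simp⟩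
    · rintro _ ⟨a, c, ha, hc, rfl⟩
      exact MeasurableSet.inter ((le_sup_left : mA ≤ mA ⊔ mC) _ ha)
        ((le_sup_right : mC ≤ mA ⊔ mC) _ hc)
  have hpi : IsPiSystem π := by
    rintro _ ⟨a, c, ha, hc, rfl⟩ _ ⟨a', c', ha', hc', rfl⟩ _
    exact ⟨a ∩ a', c ∩ c', MeasurableSet.inter ha ha', MeasurableSet.inter hc hc',
      Set.inter_inter_inter_comm _ _ _ _⟩
  have hle : mA ⊔ mC ≤ m0 := sup_le hA hC
  have huniv : ∫ ω, f ω ∂Q = ∫ ω, g ω ∂Q := by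
    simpa using hfg Set.univ Set.univ MeasurableSet.univ MeasurableSet.univ
  refine MeasurableSpace.induction_on_inter (m := mA ⊔ mC)
    (C := fun s _ => ∫ ω in s, f ω ∂Q = ∫ ω in s, g ω ∂Q) hgen hpi (by simp) ?_ ?_ ?_ s hs
  · rintro _ ⟨a, c, ha, hc, rfl⟩
    exact hfg a c ha hc
  · intro t ht h
    have h1 := integral_add_compl (hle _ ht) hf
    have h2 := integral_add_compl (hle _ ht) hg
    linarith
  · intro t hdisj ht h
    rw [integral_iUnion (fun i => hle _ (ht i)) hdisj hf.integrableOn,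
      integral_iUnion (fun i => hle _ (ht i)) hdisj hg.integrableOn]
    simp only [h]

theorem setIntegral_inter_of_indep {mA mC : MeasurableSpace Ω} (hA : mA ≤ m0) (hC : mC ≤ m0)
    (hind : Indep mA mC Q) {f : Ω → ℝ} (hf : Integrable f Q) (hfm : StronglyMeasurable[mA] f)
    {a c : Set Ω} (ha : MeasurableSet[mA] a) (hc : MeasurableSet[mC] c) :
    ∫ ω in a ∩ c, f ω ∂Q = Q.real c * ∫ ω in a, f ω ∂Q := by
  have h1 := condExp_indep_eq hA hC (hfm.indicator ha) hind
  have h2 := setIntegral_condExp hC (hf.indicator (hA _ ha)) hc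
  rw [setIntegral_congr_ae (g := fun _ => ∫ ω, a.indicator f ω ∂Q) (hC _ hc)
    (h1.mono fun ω h _ => h), setIntegral_const, setIntegral_indicator (hA _ ha),
    integral_indicator (hA _ ha)] at h2
  rw [Set.inter_comm, ← h2, smul_eq_mul]

/-- For independent σ-algebras `m i`, conditioning a variable that depends on the indices in `S`
on the indices in `R` only involves the indices in `S ∩ R`. -/
theorem condExp_iSup_inter {ι : Type*} {m : ι → MeasurableSpace Ω} (hle : ∀ i, m i ≤ m0)
    (hind : iIndep m Q) (S R : Set ι) {Y : Ω → ℝ} (hY : Integrable Y Q)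
    (hYm : StronglyMeasurable[⨆ i ∈ S, m i] Y) :
    Q[Y | ⨆ i ∈ R, m i] =ᵐ[Q] Q[Y | ⨆ i ∈ S ∩ R, m i] := by
  have hle' : ∀ T : Set ι, ⨆ i ∈ T, m i ≤ m0 := fun T => iSup₂_le fun i _ => hle i
  have hsplit : ⨆ i ∈ R, m i = (⨆ i ∈ S ∩ R, m i) ⊔ ⨆ i ∈ R \ S, m i := by
    rw [← iSup_union, Set.inter_comm, Set.inter_union_sdiff]
  have hindS : Indep (⨆ i ∈ S, m i) (⨆ i ∈ R \ S, m i) Q :=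
    indep_iSup_of_disjoint hle hind Set.disjoint_sdiff_right
  have hmono : ⨆ i ∈ S ∩ R, m i ≤ ⨆ i ∈ S, m i := biSup_mono fun i hi => hi.1
  have hg : StronglyMeasurable[⨆ i ∈ S ∩ R, m i] (Q[Y | ⨆ i ∈ S ∩ R, m i]) :=
    stronglyMeasurable_condExp
  symm
  refine ae_eq_condExp_of_forall_setIntegral_eq (hle' R) hY
    (fun _ _ _ => integrable_condExp.integrableOn) (fun s hs _ => ?_)
    (hg.mono (biSup_mono fun i hi => hi.2)).aestronglyMeasurable
  rw [hsplit] at hs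
  refine setIntegral_eq_of_sup (hle' _) (hle' _) integrable_condExp hY (fun a c ha hc => ?_) hs
  rw [setIntegral_inter_of_indep (hle' _) (hle' _) hindS integrable_condExp (hg.mono hmono)
      (hmono _ ha) hc,
    setIntegral_inter_of_indep (hle' _) (hle' _) hindS hY hYm (hmono _ ha) hc,
    setIntegral_condExp (hle' _) hY ha]

end CondExp

namespace BGraph

/-- The index set of the variables `H(G)`: row nodes, column nodes and edges. -/
def elems (G : BGraph) : Set (ℕ ⊕ ℕ ⊕ ℕ × ℕ) :=
  Sum.inl '' (G.rows : Set ℕ) ∪ ((Sum.inr ∘ Sum.inl) '' (G.cols : Set ℕ) ∪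
    (Sum.inr ∘ Sum.inr) '' (G.edges : Set (ℕ × ℕ)))

/-- The intersection of two bipartite graphs. -/
def inter (F G : BGraph) : BGraph where
  rows := F.rows ∩ G.rows
  cols := F.cols ∩ G.cols
  edges := F.edges ∩ G.edges
  edges_subset := fun x hx => by
    obtain ⟨h1, h2⟩ := Finset.mem_inter.1 hx
    have h3 := Finset.mem_product.1 (F.edges_subset h1)
    have h4 := Finset.mem_product.1 (G.edges_subset h2)
    exact Finset.mem_product.2 ⟨Finset.mem_inter.2 ⟨h3.1, h4.1⟩, Finset.mem_inter.2 ⟨h3.2, h4.2⟩⟩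

/-- The union of two bipartite graphs. -/
def union (F G : BGraph) : BGraph where
  rows := F.rows ∪ G.rows
  cols := F.cols ∪ G.cols
  edges := F.edges ∪ G.edges
  edges_subset := fun x hx => by
    rcases Finset.mem_union.1 hx with h | h
    · have h3 := Finset.mem_product.1 (F.edges_subset h)
      exact Finset.mem_product.2 ⟨Finset.mem_union_left _ h3.1, Finset.mem_union_left _ h3.2⟩
    · have h3 := Finset.mem_product.1 (G.edges_subset h)
      exact Finset.mem_product.2 ⟨Finset.mem_union_right _ h3.1, Finset.mem_union_right _ h3.2⟩

theorem elems_inter (F G : BGraph) : (F.inter G).elems = F.elems ∩ G.elems := by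
  ext (i | j | e) <;> simp [elems, inter]

theorem inter_le_left (F G : BGraph) : F.inter G ≤ F :=
  ⟨Finset.inter_subset_left, Finset.inter_subset_left, Finset.inter_subset_left⟩

theorem inter_le_right (F G : BGraph) : F.inter G ≤ G :=
  ⟨Finset.inter_subset_right, Finset.inter_subset_right, Finset.inter_subset_right⟩

theorem le_inter {H F G : BGraph} (h1 : H ≤ F) (h2 : H ≤ G) : H ≤ F.inter G :=
  ⟨Finset.subset_inter h1.1 h2.1, Finset.subset_inter h1.2.1 h2.2.1,
    Finset.subset_inter h1.2.2 h2.2.2⟩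

theorem le_union_left (F G : BGraph) : F ≤ F.union G :=
  ⟨Finset.subset_union_left, Finset.subset_union_left, Finset.subset_union_left⟩

theorem le_union_right (F G : BGraph) : G ≤ F.union G :=
  ⟨Finset.subset_union_right, Finset.subset_union_right, Finset.subset_union_right⟩

theorem subgraphs_eq_cons (G : BGraph) : G.subgraphs =
    Finset.cons G G.properSubgraphs (by simp [mem_properSubgraphs]) := by
  ext F
  rw [Finset.mem_cons, mem_subgraphs, mem_properSubgraphs, le_iff_eq_or_lt]

theorem card_properSubgraphs_le (G : BGraph) :
    G.properSubgraphs.card ≤ 2 ^ (G.rows.card + G.cols.card + G.edges.card) := by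
  have : G.properSubgraphs.card ≤
      (G.rows.powerset ×ˢ (G.cols.powerset ×ˢ G.edges.powerset)).card := by
    refine Finset.card_le_card_of_injOn (fun F => (F.rows, F.cols, F.edges)) ?_ ?_
    · intro F hF
      have hF' := (mem_properSubgraphs.1 hF).le
      simpa using ⟨hF'.1, hF'.2.1, hF'.2.2⟩
    · intro F _ F' _ h
      simp only [Prod.mk.injEq] at h
      exact BGraph.ext h.1 h.2.1 h.2.2
  refine this.trans (le_of_eq ?_)
  simp only [Finset.card_product, Finset.card_powerset]
  ring

end BGraph

/-! ### Graph-indexed projections -/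

section Projections

variable {Ω' : Type*} [MeasurableSpace Ω'] {Q : Measure Ω'}
  {ξ η : ℕ → Ω' → ℝ} {ζ : ℕ → ℕ → Ω' → ℝ}

/-- The variables `ξ_i`, `η_j`, `ζ_{ij}` as one family. -/
def ahkVar (ξ η : ℕ → Ω' → ℝ) (ζ : ℕ → ℕ → Ω' → ℝ) (a : ℕ ⊕ ℕ ⊕ ℕ × ℕ) : Ω' → ℝ :=
  Sum.elim ξ (Sum.elim η (fun ij : ℕ × ℕ => ζ ij.1 ij.2)) a

theorem graphSigma_eq_iSup (ξ η : ℕ → Ω' → ℝ) (ζ : ℕ → ℕ → Ω' → ℝ) (G : BGraph) :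
    graphSigma ξ η ζ G = ⨆ a ∈ G.elems, MeasurableSpace.comap (ahkVar ξ η ζ a) inferInstance := by
  rw [BGraph.elems, iSup_union, iSup_union, iSup_image, iSup_image, iSup_image, ← sup_assoc]
  rfl

theorem graphSigma_mono {F G : BGraph} (h : F ≤ G) : graphSigma ξ η ζ F ≤ graphSigma ξ η ζ G :=
  sup_le_sup (sup_le_sup (biSup_mono fun _ hi => h.1 hi) (biSup_mono fun _ hi => h.2.1 hi))
    (biSup_mono fun _ hi => h.2.2 hi)

theorem proj_eq (Q : Measure Ω') (ξ η : ℕ → Ω' → ℝ) (ζ : ℕ → ℕ → Ω' → ℝ) (X : Ω' → ℝ)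
    (F : BGraph) : proj Q ξ η ζ X F =
      Q[X | graphSigma ξ η ζ F] - ∑ F' ∈ F.properSubgraphs, proj Q ξ η ζ X F' := by
  rw [proj, Finset.sum_coe_sort F.properSubgraphs (fun F' => proj Q ξ η ζ X F')]

/-- The recursion solved for the conditional expectation. -/
theorem sum_subgraphs_proj (Q : Measure Ω') (ξ η : ℕ → Ω' → ℝ) (ζ : ℕ → ℕ → Ω' → ℝ)
    (X : Ω' → ℝ) (F : BGraph) :
    ∑ F' ∈ F.subgraphs, proj Q ξ η ζ X F' = Q[X | graphSigma ξ η ζ F] := by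
  rw [BGraph.subgraphs_eq_cons, Finset.sum_cons, proj_eq Q ξ η ζ X F, sub_add_cancel]

/-- Induction over proper subgraphs. -/
theorem BGraph.strongInduction {p : BGraph → Prop} (h : ∀ G, (∀ F, F < G → p F) → p G)
    (G : BGraph) : p G := by
  suffices ∀ k, ∀ G : BGraph, G.rows.card + G.cols.card + G.edges.card < k → p G from
    this _ G (Nat.lt_succ_self _)
  intro k
  induction k with
  | zero => intro G hG; omega
  | succ k ih =>
    intro G hG
    refine h G fun F hF => ih F ?_
    have := BGraph.card_lt_card hF
    omega

theorem stronglyMeasurable_proj (X : Ω' → ℝ) (G : BGraph) :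
    StronglyMeasurable[graphSigma ξ η ζ G] (proj Q ξ η ζ X G) := by
  induction G using BGraph.strongInduction with
  | h G ih =>
    rw [proj_eq]
    refine stronglyMeasurable_condExp.sub (Finset.stronglyMeasurable_sum _ fun F hF => ?_)
    have hF' := BGraph.mem_properSubgraphs.1 hF
    exact (ih F hF').mono (graphSigma_mono hF'.le)

theorem memLp_proj {X : Ω' → ℝ} {r : ENNReal} (hr : 1 ≤ r) (hX : MemLp X r Q) (G : BGraph) :
    MemLp (proj Q ξ η ζ X G) r Q := by
  induction G using BGraph.strongInduction with
  | h G ih =>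
    rw [proj_eq]
    exact (hX.condExp hr).sub
      (memLp_finsetSum' _ fun F hF => ih F (BGraph.mem_properSubgraphs.1 hF))

theorem integrable_proj {X : Ω' → ℝ} (hX : Integrable X Q) (G : BGraph) :
    Integrable (proj Q ξ η ζ X G) Q :=
  memLp_one_iff_integrable.1 (memLp_proj le_rfl (memLp_one_iff_integrable.2 hX) G)

theorem proj_sub {X X' : Ω' → ℝ} (hX : Integrable X Q) (hX' : Integrable X' Q) (G : BGraph) :
    proj Q ξ η ζ (X - X') G =ᵐ[Q] proj Q ξ η ζ X G - proj Q ξ η ζ X' G := by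
  induction G using BGraph.strongInduction with
  | h G ih =>
    rw [proj_eq, proj_eq, proj_eq]
    have h1 := condExp_sub hX hX' (graphSigma ξ η ζ G)
    have h2 : (∑ F ∈ G.properSubgraphs, proj Q ξ η ζ (X - X') F) =ᵐ[Q]
        ∑ F ∈ G.properSubgraphs, (proj Q ξ η ζ X F - proj Q ξ η ζ X' F) :=
      eventuallyEq_sum fun F hF => ih F (BGraph.mem_properSubgraphs.1 hF)
    refine (h1.sub h2).trans (Eventually.of_forall fun ω => ?_)
    rw [Finset.sum_sub_distrib]
    simp only [Pi.sub_apply]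
    ring

/-- Projections of bounded variables are bounded, uniformly over graphs of bounded size. -/
theorem exists_bound_proj (k : ℕ) : ∃ C : ℝ, 0 ≤ C ∧
    ∀ {Ω' : Type*} [MeasurableSpace Ω'] {Q : Measure Ω'} {ξ η : ℕ → Ω' → ℝ}
      {ζ : ℕ → ℕ → Ω' → ℝ} (G : BGraph), G.rows.card + G.cols.card + G.edges.card ≤ k →
    ∀ (X : Ω' → ℝ) (M : ℝ), 0 ≤ M → (∀ᵐ ω ∂Q, |X ω| ≤ M) →
      ∀ᵐ ω ∂Q, |proj Q ξ η ζ X G ω| ≤ C * M := by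
  have key : ∀ {Ω' : Type _} [MeasurableSpace Ω'] {Q : Measure Ω'} {ξ η : ℕ → Ω' → ℝ}
      {ζ : ℕ → ℕ → Ω' → ℝ} (G : BGraph) (X : Ω' → ℝ) (M C : ℝ), 0 ≤ M → 0 ≤ C →
      (∀ᵐ ω ∂Q, |X ω| ≤ M) →
      (∀ F, F < G → ∀ᵐ ω ∂Q, |proj Q ξ η ζ X F ω| ≤ C * M) →
      ∀ᵐ ω ∂Q, |proj Q ξ η ζ X G ω| ≤
        (1 + 2 ^ (G.rows.card + G.cols.card + G.edges.card) * C) * M := by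
    intro Ω' _ Q ξ η ζ G X M C hM hC hX hF
    have h1 := ae_bdd_abs_condExp_of_ae_bdd_abs (m := graphSigma ξ η ζ G) hX
    have h2 : ∀ᵐ ω ∂Q, ∀ F ∈ G.properSubgraphs, |proj Q ξ η ζ X F ω| ≤ C * M :=
      (Finset.eventually_all _).2 fun F hF' => hF F (BGraph.mem_properSubgraphs.1 hF')
    filter_upwards [h1, h2] with ω h1 h2
    rw [proj_eq, Pi.sub_apply, Finset.sum_apply]
    refine (abs_sub _ _).trans ?_
    rw [add_mul, one_mul]
    refine add_le_add h1 ((Finset.abs_sum_le_sum_abs _ _).trans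
      ((Finset.sum_le_card_nsmul _ _ _ h2).trans ?_))
    rw [nsmul_eq_mul, mul_assoc]
    refine mul_le_mul_of_nonneg_right ?_ (by positivity)
    exact_mod_cast BGraph.card_properSubgraphs_le G
  induction k with
  | zero =>
    refine ⟨1, zero_le_one, fun G hG X M hM hX => ?_⟩
    refine (key G X M 0 hM le_rfl hX fun F hF => ?_).mono fun ω h => by simpa using h
    have := BGraph.card_lt_card hF
    omega
  | succ k ih =>
    obtain ⟨C, hC, h⟩ := ih
    refine ⟨1 + 2 ^ (k + 1) * C, by positivity, fun G hG X M hM hX => ?_⟩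
    refine (key G X M C hM hC hX fun F hF => h F ?_ X M hM hX).mono fun ω hω => hω.trans ?_
    · have := BGraph.card_lt_card hF
      omega
    · refine mul_le_mul_of_nonneg_right ?_ hM
      gcongr
      norm_num

variable [IsProbabilityMeasure Q]

namespace IsAHKVariables

theorem measurable_ahkVar (h : IsAHKVariables Q ξ η ζ) (a : ℕ ⊕ ℕ ⊕ ℕ × ℕ) :
    Measurable (ahkVar ξ η ζ a) := by
  rcases a with i | j | e
  exacts [h.measurable_row i, h.measurable_col j, h.measurable_edge _ _]

theorem graphSigma_le (h : IsAHKVariables Q ξ η ζ) (G : BGraph) :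
    graphSigma ξ η ζ G ≤ ‹MeasurableSpace Ω'› := by
  rw [graphSigma_eq_iSup]
  exact iSup₂_le fun a _ => (h.measurable_ahkVar a).comap_le

theorem measurable_proj (h : IsAHKVariables Q ξ η ζ) (X : Ω' → ℝ) (G : BGraph) :
    Measurable (proj Q ξ η ζ X G) :=
  ((stronglyMeasurable_proj X G).mono (h.graphSigma_le G)).measurable

theorem condExp_graphSigma_inter (h : IsAHKVariables Q ξ η ζ) (F G : BGraph) {Y : Ω' → ℝ}
    (hY : Integrable Y Q) (hYm : StronglyMeasurable[graphSigma ξ η ζ G] Y) :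
    Q[Y | graphSigma ξ η ζ F] =ᵐ[Q] Q[Y | graphSigma ξ η ζ (G.inter F)] := by
  rw [graphSigma_eq_iSup] at hYm
  rw [graphSigma_eq_iSup, graphSigma_eq_iSup, BGraph.elems_inter]
  exact condExp_iSup_inter (fun a => (h.measurable_ahkVar a).comap_le)
    ((iIndepFun_iff_iIndep _ _ _).1 h.independent) _ _ hY hYm

/-- The projection on `G` is centred given the variables of any graph that does not contain
`G`. -/
theorem condExp_proj_eq_zero (h : IsAHKVariables Q ξ η ζ) {X : Ω' → ℝ} (hX : Integrable X Q)
    {F G : BGraph} (hGF : ¬ G ≤ F) :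
    Q[proj Q ξ η ζ X G | graphSigma ξ η ζ F] =ᵐ[Q] 0 := by
  induction G using BGraph.strongInduction with
  | h G ih =>
    have hlt : ∀ G', G' ≤ G.inter F ↔ G' < G ∧ G' ≤ F := fun G' =>
      ⟨fun h' => ⟨lt_of_le_of_ne (h'.trans (BGraph.inter_le_left G F)) fun he =>
        hGF (he ▸ h'.trans (BGraph.inter_le_right G F)), h'.trans (BGraph.inter_le_right G F)⟩,
        fun h' => BGraph.le_inter h'.1.le h'.2⟩
    have h1 : Q[proj Q ξ η ζ X G | graphSigma ξ η ζ F] =ᵐ[Q]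
        Q[Q[X | graphSigma ξ η ζ G] | graphSigma ξ η ζ F] -
          ∑ G' ∈ G.properSubgraphs, Q[proj Q ξ η ζ X G' | graphSigma ξ η ζ F] := by
      rw [proj_eq]
      refine (condExp_sub integrable_condExp
        (integrable_finsetSum' _ fun G' _ => integrable_proj hX G') _).trans ?_
      exact EventuallyEq.rfl.sub (condExp_finsetSum (fun G' _ => integrable_proj hX G') _)
    have h2 : Q[Q[X | graphSigma ξ η ζ G] | graphSigma ξ η ζ F] =ᵐ[Q]
        ∑ G' ∈ (G.inter F).subgraphs, proj Q ξ η ζ X G' := by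
      rw [sum_subgraphs_proj]
      exact (h.condExp_graphSigma_inter F G integrable_condExp stronglyMeasurable_condExp).trans
        (condExp_condExp_of_le (graphSigma_mono (BGraph.inter_le_left G F)) (h.graphSigma_le G))
    have h3 : (∑ G' ∈ G.properSubgraphs, Q[proj Q ξ η ζ X G' | graphSigma ξ η ζ F]) =ᵐ[Q]
        ∑ G' ∈ (G.inter F).subgraphs, proj Q ξ η ζ X G' := by
      classical
      have : (G.inter F).subgraphs = G.properSubgraphs.filter fun G' => G' ≤ F := by
        ext G'
        rw [BGraph.mem_subgraphs, hlt, Finset.mem_filter, BGraph.mem_properSubgraphs]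
      rw [this, Finset.sum_filter]
      refine eventuallyEq_sum fun G' hG' => ?_
      split_ifs with hle
      · rw [condExp_of_stronglyMeasurable (h.graphSigma_le F)
          ((stronglyMeasurable_proj X G').mono (graphSigma_mono hle)) (integrable_proj hX G')]
      · exact ih G' (BGraph.mem_properSubgraphs.1 hG') hle
    refine h1.trans ((h2.sub h3).trans (Eventually.of_forall fun ω => ?_))
    simp

theorem integral_proj_mul_eq_zero (h : IsAHKVariables Q ξ η ζ) {X : Ω' → ℝ} (hX : Integrable X Q)
    {F G : BGraph} (hGF : ¬ G ≤ F) {Z : Ω' → ℝ} (hZ : StronglyMeasurable[graphSigma ξ η ζ F] Z)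
    (hint : Integrable (proj Q ξ η ζ X G * Z) Q) :
    ∫ ω, proj Q ξ η ζ X G ω * Z ω ∂Q = 0 := by
  have h1 := condExp_mul_of_stronglyMeasurable_right hZ hint (integrable_proj hX G)
  have h2 := integral_condExp (μ := Q) (f := proj Q ξ η ζ X G * Z) (h.graphSigma_le F)
  have h3 : ∫ ω, (proj Q ξ η ζ X G * Z) ω ∂Q = 0 := by
    rw [← h2, integral_congr_ae (h1.trans ((h.condExp_proj_eq_zero hX hGF).mul EventuallyEq.rfl))]
    simp
  exact h3

/-- Projections on different graphs are orthogonal. -/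
theorem integral_proj_mul_proj (h : IsAHKVariables Q ξ η ζ) {X X' : Ω' → ℝ} (hX : MemLp X 2 Q)
    (hX' : MemLp X' 2 Q) {F G : BGraph} (hFG : F ≠ G) :
    ∫ ω, proj Q ξ η ζ X F ω * proj Q ξ η ζ X' G ω ∂Q = 0 := by
  have hF := memLp_proj (ξ := ξ) (η := η) (ζ := ζ) one_le_two hX F
  have hG := memLp_proj (ξ := ξ) (η := η) (ζ := ζ) one_le_two hX' G
  by_cases hle : F ≤ G
  · have hle' : ¬ G ≤ F := fun h' => hFG (le_antisymm hle h')
    have := h.integral_proj_mul_eq_zero (hX'.integrable one_le_two) hle'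
      (stronglyMeasurable_proj (Q := Q) X F) (hG.integrable_mul hF)
    simpa only [mul_comm] using this
  · exact h.integral_proj_mul_eq_zero (hX.integrable one_le_two) hle
      (stronglyMeasurable_proj (Q := Q) X' G) (hF.integrable_mul hG)

/-- In `L²` the projection on a graph is an orthogonal projection. -/
theorem integral_proj_sq_le (h : IsAHKVariables Q ξ η ζ) {X : Ω' → ℝ} (hX : MemLp X 2 Q)
    (G : BGraph) : ∫ ω, proj Q ξ η ζ X G ω ^ 2 ∂Q ≤ ∫ ω, X ω ^ 2 ∂Q := by
  have hG := memLp_proj (ξ := ξ) (η := η) (ζ := ζ) one_le_two hX G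
  have hXi := hX.integrable one_le_two
  have hXG : Integrable (fun ω => X ω * proj Q ξ η ζ X G ω) Q := hX.integrable_mul hG
  have h1 : ∫ ω, X ω * proj Q ξ η ζ X G ω ∂Q = ∫ ω, proj Q ξ η ζ X G ω ^ 2 ∂Q := by
    have e1 := condExp_mul_of_stronglyMeasurable_right
      (stronglyMeasurable_proj (Q := Q) (ξ := ξ) (η := η) (ζ := ζ) X G) hXG hXi
    have e2 := integral_condExp (μ := Q) (f := X * proj Q ξ η ζ X G) (h.graphSigma_le G)
    have e3 : ∫ ω, X ω * proj Q ξ η ζ X G ω ∂Q =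
        ∫ ω, (Q[X | graphSigma ξ η ζ G] * proj Q ξ η ζ X G) ω ∂Q := by
      rw [← integral_congr_ae e1, e2]
      rfl
    rw [e3, ← sum_subgraphs_proj]
    simp only [Pi.mul_apply, Finset.sum_apply, Finset.sum_mul]
    rw [integral_finsetSum, Finset.sum_eq_single G]
    · simp only [sq]
    · intro F _ hF
      exact h.integral_proj_mul_proj hX hX hF
    · intro hF
      exact absurd (BGraph.mem_subgraphs.2 le_rfl) hF
    · intro F _
      exact (memLp_proj one_le_two hX F).integrable_mul hG
  have h2 : 0 ≤ ∫ ω, (X ω - proj Q ξ η ζ X G ω) ^ 2 ∂Q := integral_nonneg fun ω => sq_nonneg _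
  have h3 : ∫ ω, (X ω - proj Q ξ η ζ X G ω) ^ 2 ∂Q =
      ∫ ω, X ω ^ 2 ∂Q - 2 * ∫ ω, X ω * proj Q ξ η ζ X G ω ∂Q +
        ∫ ω, proj Q ξ η ζ X G ω ^ 2 ∂Q := by
    have e := integral_add (hX.integrable_sq.sub (hXG.const_mul 2)) hG.integrable_sq
    simp only [Pi.sub_apply] at e
    rw [← integral_const_mul, ← integral_sub hX.integrable_sq (hXG.const_mul 2), ← e]
    refine integral_congr_ae (Eventually.of_forall fun ω => ?_)
    show (X ω - proj Q ξ η ζ X G ω) ^ 2 =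
      X ω ^ 2 - 2 * (X ω * proj Q ξ η ζ X G ω) + proj Q ξ η ζ X G ω ^ 2
    ring
  rw [h3, h1] at h2
  linarith

end IsAHKVariables

end Projections

/-! ### Invariance under relabelling -/

/-- Conditional expectations of a function of `T` are computed under the law of `T`. -/
theorem condExp_comp_map {Ω E : Type*} [MeasurableSpace Ω] {m mE : MeasurableSpace E}
    {Q : Measure Ω} [IsProbabilityMeasure Q] {T : Ω → E} (hT : Measurable T) (hm : m ≤ mE)
    {f : E → ℝ} (hf : Integrable f (Q.map T)) :
    Q[f ∘ T | m.comap T] =ᵐ[Q] (Q.map T)[f | m] ∘ T := by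
  have : IsProbabilityMeasure (Q.map T) := Measure.isProbabilityMeasure_map hT.aemeasurable
  have hle : m.comap T ≤ ‹MeasurableSpace Ω› := (MeasurableSpace.comap_mono hm).trans hT.comap_le
  have hg : StronglyMeasurable[m] ((Q.map T)[f | m]) := stronglyMeasurable_condExp
  have hgi : Integrable ((Q.map T)[f | m] ∘ T) Q :=
    (integrable_map_measure integrable_condExp.aestronglyMeasurable hT.aemeasurable).1
      integrable_condExp
  symm
  refine ae_eq_condExp_of_forall_setIntegral_eq hle
    ((integrable_map_measure hf.aestronglyMeasurable hT.aemeasurable).1 hf)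
    (fun _ _ _ => hgi.integrableOn) ?_ ?_
  · rintro _ ⟨b, hb, rfl⟩ _
    have h1 := setIntegral_map (hm _ hb)
      (integrable_condExp (μ := Q.map T) (m := m) (f := f)).aestronglyMeasurable hT.aemeasurable
    have h2 := setIntegral_map (hm _ hb) hf.aestronglyMeasurable hT.aemeasurable
    rw [setIntegral_condExp hm hf hb, h2] at h1
    exact h1.symm
  · exact (hg.comp_measurable (Measurable.of_comap_le le_rfl)).aestronglyMeasurable

section Perm

/-- A bijection between two finite sets of natural numbers extends to a permutation. -/
theorem exists_perm_extend {s t : Finset ℕ} (e : s ≃ t) :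
    ∃ σ : Equiv.Perm ℕ, ∀ i : s, σ i = e i := by
  have hs : Infinite ((s : Set ℕ)ᶜ : Set ℕ) := s.finite_toSet.infinite_compl.to_subtype
  have ht : Infinite ((t : Set ℕ)ᶜ : Set ℕ) := t.finite_toSet.infinite_compl.to_subtype
  obtain ⟨ds⟩ := nonempty_denumerable ((s : Set ℕ)ᶜ : Set ℕ)
  obtain ⟨dt⟩ := nonempty_denumerable ((t : Set ℕ)ᶜ : Set ℕ)
  let c : ((s : Set ℕ)ᶜ : Set ℕ) ≃ ((t : Set ℕ)ᶜ : Set ℕ) :=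
    (Denumerable.eqv _).trans (Denumerable.eqv _).symm
  classical
  let σ : Equiv.Perm ℕ := (Equiv.Set.sumCompl (s : Set ℕ)).symm.trans
    ((Equiv.sumCongr (show ((s : Set ℕ) : Type) ≃ ((t : Set ℕ) : Type) from e) c).trans
      (Equiv.Set.sumCompl (t : Set ℕ)))
  refine ⟨σ, fun i => ?_⟩
  have h1 : (Equiv.Set.sumCompl (s : Set ℕ)).symm i.1 = Sum.inl ⟨i.1, i.2⟩ :=
    Equiv.Set.sumCompl_symm_apply_of_mem i.2
  simp only [σ, Equiv.trans_apply, h1]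
  rfl

theorem map_eq_of_extend {s t : Finset ℕ} (e : s ≃ t) {σ : Equiv.Perm ℕ}
    (hσ : ∀ i : s, σ i = e i) : s.map σ.toEmbedding = t := by
  refine Finset.eq_of_subset_of_card_le (fun x hx => ?_) ?_
  · obtain ⟨i, hi, rfl⟩ := Finset.mem_map.1 hx
    have := hσ ⟨i, hi⟩
    simp only at this
    simp only [Equiv.coe_toEmbedding, this, Finset.coe_mem]
  · rw [Finset.card_map]
    have := Fintype.card_congr e
    simp only [Fintype.card_coe] at this
    exact this.ge

/-- A permutation that fixes `S` pointwise and maps `I ⊇ S` onto `I' ⊇ S`. -/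
theorem exists_perm_fix_map {S I I' : Finset ℕ} (hI : S ⊆ I) (hI' : S ⊆ I')
    (hc : I.card = I'.card) :
    ∃ σ : Equiv.Perm ℕ, (∀ i ∈ S, σ i = i) ∧ I.map σ.toEmbedding = I' := by
  classical
  obtain ⟨g, hg⟩ := Finset.exists_equiv_extend_of_card_eq (α := I) (t := I') (by simpa using hc)
    (s := Finset.univ.filter fun i : I => i.1 ∈ S) (f := fun i => i.1)
    (by
      intro x hx
      obtain ⟨i, hi, rfl⟩ := Finset.mem_image.1 hx
      exact hI' (Finset.mem_filter.1 hi).2)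
    (fun a _ b _ h => Subtype.ext h)
  obtain ⟨σ, hσ⟩ := exists_perm_extend g
  refine ⟨σ, fun i hi => ?_, map_eq_of_extend g hσ⟩
  rw [hσ ⟨i, hI hi⟩, hg ⟨i, hI hi⟩ (by simpa using hi)]

end Perm

namespace BGraph

/-- The image of a graph under permutations of the row labels and of the column labels. -/
def map (G : BGraph) (σ τ : Equiv.Perm ℕ) : BGraph where
  rows := G.rows.map σ.toEmbedding
  cols := G.cols.map τ.toEmbedding
  edges := G.edges.map (σ.prodCongr τ).toEmbedding
  edges_subset := fun x hx => by
    obtain ⟨e, he, rfl⟩ := Finset.mem_map.1 hx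
    have := Finset.mem_product.1 (G.edges_subset he)
    exact Finset.mem_product.2 ⟨Finset.mem_map_of_mem _ this.1, Finset.mem_map_of_mem _ this.2⟩

theorem map_le_map {F G : BGraph} {σ τ : Equiv.Perm ℕ} : F.map σ τ ≤ G.map σ τ ↔ F ≤ G := by
  show (_ ∧ _ ∧ _) ↔ (_ ∧ _ ∧ _)
  simp only [map, Finset.map_subset_map]

theorem map_injective (σ τ : Equiv.Perm ℕ) : Function.Injective fun G : BGraph => G.map σ τ :=
  fun _ _ h => le_antisymm (map_le_map.1 (le_of_eq h)) (map_le_map.1 (ge_of_eq h))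

theorem map_lt_map {F G : BGraph} {σ τ : Equiv.Perm ℕ} : F.map σ τ < G.map σ τ ↔ F < G := by
  rw [lt_iff_le_and_ne, lt_iff_le_and_ne, map_le_map, (map_injective σ τ).ne_iff]

theorem exists_map_eq (F : BGraph) (σ τ : Equiv.Perm ℕ) :
    ∃ F' : BGraph, F'.map σ τ = F := by
  refine ⟨F.map σ.symm τ.symm, BGraph.ext ?_ ?_ ?_⟩ <;>
  · simp only [map, Finset.map_map]
    convert Finset.map_refl
    ext <;> simp

theorem properSubgraphs_map (G : BGraph) (σ τ : Equiv.Perm ℕ) :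
    (G.map σ τ).properSubgraphs =
      G.properSubgraphs.map ⟨fun F => F.map σ τ, map_injective σ τ⟩ := by
  ext F
  simp only [Finset.mem_map, mem_properSubgraphs, Function.Embedding.coeFn_mk]
  constructor
  · intro h
    obtain ⟨F', rfl⟩ := exists_map_eq F σ τ
    exact ⟨F', map_lt_map.1 h, rfl⟩
  · rintro ⟨F', h, rfl⟩
    exact map_lt_map.2 h

theorem map_eq_self {G : BGraph} {σ τ : Equiv.Perm ℕ} (hσ : ∀ i ∈ G.rows, σ i = i)
    (hτ : ∀ j ∈ G.cols, τ j = j) : G.map σ τ = G := by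
  have key : ∀ {α : Type} (s : Finset α) (π : Equiv.Perm α), (∀ x ∈ s, π x = x) →
      s.map π.toEmbedding = s := by
    intro α s π h
    refine Finset.eq_of_subset_of_card_le (fun x hx => ?_) (by rw [Finset.card_map])
    obtain ⟨y, hy, rfl⟩ := Finset.mem_map.1 hx
    rwa [Equiv.coe_toEmbedding, h y hy]
  refine BGraph.ext (key _ _ hσ) (key _ _ hτ) (key _ _ fun e he => ?_)
  have := Finset.mem_product.1 (G.edges_subset he)
  exact Prod.ext (hσ _ this.1) (hτ _ this.2)

/-- An isomorphism of graphs extends to a relabelling. -/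
theorem Isomorphic.exists_map_eq {G G' : BGraph} (h : Isomorphic G G') :
    ∃ σ τ : Equiv.Perm ℕ, G.map σ τ = G' := by
  obtain ⟨⟨⟨e, f⟩, hef⟩⟩ := h
  obtain ⟨σ, hσ⟩ := exists_perm_extend e
  obtain ⟨τ, hτ⟩ := exists_perm_extend f
  refine ⟨σ, τ, BGraph.ext (map_eq_of_extend e hσ) (map_eq_of_extend f hτ) ?_⟩
  ext ⟨a, b⟩
  simp only [map, Finset.mem_map, Equiv.coe_toEmbedding, Equiv.prodCongr_apply, Prod.exists,
    Prod.map_apply, Prod.mk.injEq]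
  constructor
  · rintro ⟨i, j, hij, rfl, rfl⟩
    have hm := Finset.mem_product.1 (G.edges_subset hij)
    have := (hef ⟨i, hm.1⟩ ⟨j, hm.2⟩).1 hij
    rwa [← hσ, ← hτ] at this
  · intro hab
    have hm := Finset.mem_product.1 (G'.edges_subset hab)
    have h1 := hσ (e.symm ⟨a, hm.1⟩)
    have h2 := hτ (f.symm ⟨b, hm.2⟩)
    rw [Equiv.apply_symm_apply] at h1 h2
    refine ⟨_, _, (hef (e.symm ⟨a, hm.1⟩) (f.symm ⟨b, hm.2⟩)).2 ?_, h1, h2⟩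
    simpa using hab

end BGraph

section Relabel

variable {Ω' : Type*} [MeasurableSpace Ω'] {Q : Measure Ω'} {ξ η : ℕ → Ω' → ℝ}
  {ζ : ℕ → ℕ → Ω' → ℝ}

/-- Projections for relabelled variables are projections on the relabelled graph. -/
theorem proj_relabel (σ τ : Equiv.Perm ℕ) (X : Ω' → ℝ) (G : BGraph) :
    proj Q (fun i => ξ (σ i)) (fun j => η (τ j)) (fun i j => ζ (σ i) (τ j)) X G =
      proj Q ξ η ζ X (G.map σ τ) := by
  induction G using BGraph.strongInduction with
  | h G ih =>
    have h1 : graphSigma (fun i => ξ (σ i)) (fun j => η (τ j)) (fun i j => ζ (σ i) (τ j)) G =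
        graphSigma ξ η ζ (G.map σ τ) := by
      simp only [graphSigma, BGraph.map, Finset.map_eq_image, Finset.iSup_finset_image]
      rfl
    rw [proj_eq, proj_eq, h1, BGraph.properSubgraphs_map, Finset.sum_map]
    congr 1
    exact Finset.sum_congr rfl fun F hF => ih F (BGraph.mem_properSubgraphs.1 hF)

theorem IsAHKVariables.relabel (h : IsAHKVariables Q ξ η ζ) (σ τ : Equiv.Perm ℕ) :
    IsAHKVariables Q (fun i => ξ (σ i)) (fun j => η (τ j)) (fun i j => ζ (σ i) (τ j)) where
  measurable_row i := h.measurable_row _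
  measurable_col j := h.measurable_col _
  measurable_edge i j := h.measurable_edge _ _
  uniform_row i := h.uniform_row _
  uniform_col j := h.uniform_col _
  uniform_edge i j := h.uniform_edge _ _
  independent := by
    have hg : Function.Injective (Sum.map σ (Sum.map τ (Prod.map σ τ))) :=
      σ.injective.sumMap (τ.injective.sumMap (σ.injective.prodMap τ.injective))
    have := h.independent.precomp hg
    convert this using 1
    funext a
    rcases a with i | j | e <;> rfl

/-- The coordinate `ξ_i` on the space of all values of `ξ`, `η`, `ζ`. -/
def coordRow (i : ℕ) (x : ℕ ⊕ ℕ ⊕ ℕ × ℕ → ℝ) : ℝ := x (Sum.inl i)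

/-- The coordinate `η_j` on the space of all values of `ξ`, `η`, `ζ`. -/
def coordCol (j : ℕ) (x : ℕ ⊕ ℕ ⊕ ℕ × ℕ → ℝ) : ℝ := x (Sum.inr (Sum.inl j))

/-- The coordinate `ζ_{ij}` on the space of all values of `ξ`, `η`, `ζ`. -/
def coordEdge (i j : ℕ) (x : ℕ ⊕ ℕ ⊕ ℕ × ℕ → ℝ) : ℝ := x (Sum.inr (Sum.inr (i, j)))

theorem measurable_ahkVec [IsProbabilityMeasure Q] (h : IsAHKVariables Q ξ η ζ) :
    Measurable fun ω a => ahkVar ξ η ζ a ω :=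
  measurable_pi_lambda _ h.measurable_ahkVar

theorem graphSigma_eq_comap (ξ η : ℕ → Ω' → ℝ) (ζ : ℕ → ℕ → Ω' → ℝ) (G : BGraph) :
    graphSigma ξ η ζ G =
      (graphSigma coordRow coordCol coordEdge G).comap fun ω a => ahkVar ξ η ζ a ω := by
  simp only [graphSigma, MeasurableSpace.comap_sup, MeasurableSpace.comap_iSup,
    MeasurableSpace.comap_comp]
  rfl

theorem graphSigma_coord_le (G : BGraph) :
    graphSigma coordRow coordCol coordEdge G ≤ MeasurableSpace.pi := by
  refine sup_le (sup_le ?_ ?_) ?_ <;>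
  exact iSup₂_le fun _ _ => (measurable_pi_apply _).comap_le

/-- All families of these variables have the same law. -/
theorem map_ahkVec [IsProbabilityMeasure Q] (h : IsAHKVariables Q ξ η ζ) :
    Q.map (fun ω a => ahkVar ξ η ζ a ω) =
      Measure.infinitePi fun a : ℕ ⊕ ℕ ⊕ ℕ × ℕ => Q.map (ahkVar ξ η ζ a) :=
  (iIndepFun_iff_map_fun_eq_infinitePi_map h.measurable_ahkVar).1 h.independent

theorem map_ahkVec_relabel [IsProbabilityMeasure Q] (h : IsAHKVariables Q ξ η ζ)
    (σ τ : Equiv.Perm ℕ) :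
    Q.map (fun ω a =>
        ahkVar (fun i => ξ (σ i)) (fun j => η (τ j)) (fun i j => ζ (σ i) (τ j)) a ω) =
      Q.map fun ω a => ahkVar ξ η ζ a ω := by
  rw [map_ahkVec h, map_ahkVec (h.relabel σ τ)]
  congr 1
  funext a
  rcases a with i | j | e
  · exact (h.uniform_row _).trans (h.uniform_row _).symm
  · exact (h.uniform_col _).trans (h.uniform_col _).symm
  · exact (h.uniform_edge _ _).trans (h.uniform_edge _ _).symm

/-- Projections are computed on the space of all values of the variables. -/
theorem proj_comp_ahkVec [IsProbabilityMeasure Q] (h : IsAHKVariables Q ξ η ζ)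
    {f : (ℕ ⊕ ℕ ⊕ ℕ × ℕ → ℝ) → ℝ}
    (hf : Integrable f (Q.map fun ω a => ahkVar ξ η ζ a ω)) (G : BGraph) :
    proj Q ξ η ζ (fun ω => f fun a => ahkVar ξ η ζ a ω) G =ᵐ[Q]
      fun ω => proj (Q.map fun ω a => ahkVar ξ η ζ a ω) coordRow coordCol coordEdge f G
        fun a => ahkVar ξ η ζ a ω := by
  induction G using BGraph.strongInduction with
  | h G ih =>
    rw [proj_eq, proj_eq, graphSigma_eq_comap ξ η ζ G]
    have h1 := condExp_comp_map (measurable_ahkVec h) (graphSigma_coord_le G) hf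
    have h2 : (∑ F ∈ G.properSubgraphs,
        proj Q ξ η ζ (fun ω => f fun a => ahkVar ξ η ζ a ω) F) =ᵐ[Q]
        ∑ F ∈ G.properSubgraphs, fun ω => proj (Q.map fun ω a => ahkVar ξ η ζ a ω)
          coordRow coordCol coordEdge f F fun a => ahkVar ξ η ζ a ω :=
      eventuallyEq_sum fun F hF => ih F (BGraph.mem_properSubgraphs.1 hF)
    refine (h1.sub h2).trans (Eventually.of_forall fun ω => ?_)
    simp [Finset.sum_apply]

/-- A function that is measurable with respect to the variables `H(G)` only depends on them. -/
theorem eq_of_stronglyMeasurable_graphSigma {g : (ℕ ⊕ ℕ ⊕ ℕ × ℕ → ℝ) → ℝ} {G : BGraph}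
    (hg : StronglyMeasurable[graphSigma coordRow coordCol coordEdge G] g)
    {x y : ℕ ⊕ ℕ ⊕ ℕ × ℕ → ℝ} (hr : ∀ i ∈ G.rows, coordRow i x = coordRow i y)
    (hc : ∀ j ∈ G.cols, coordCol j x = coordCol j y)
    (he : ∀ e ∈ G.edges, coordEdge e.1 e.2 x = coordEdge e.1 e.2 y) : g x = g y := by
  -- the σ-algebra of the sets that do not separate `x` from `y`
  let m : MeasurableSpace (ℕ ⊕ ℕ ⊕ ℕ × ℕ → ℝ) :=
    { MeasurableSet' := fun s => x ∈ s ↔ y ∈ s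
      measurableSet_empty := by simp
      measurableSet_compl := fun s hs => not_congr hs
      measurableSet_iUnion := fun s hs => by
        simp only [Set.mem_iUnion]
        exact exists_congr hs }
  have hle : graphSigma coordRow coordCol coordEdge G ≤ m := by
    refine sup_le (sup_le ?_ ?_) ?_
    · refine iSup₂_le fun i hi => ?_
      rintro _ ⟨b, _, rfl⟩
      show coordRow i x ∈ b ↔ coordRow i y ∈ b
      rw [hr i hi]
    · refine iSup₂_le fun i hi => ?_
      rintro _ ⟨b, _, rfl⟩
      show coordCol i x ∈ b ↔ coordCol i y ∈ b
      rw [hc i hi]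
    · refine iSup₂_le fun i hi => ?_
      rintro _ ⟨b, _, rfl⟩
      show coordEdge i.1 i.2 x ∈ b ↔ coordEdge i.1 i.2 y ∈ b
      rw [he i hi]
  have hs : MeasurableSet[m] (g ⁻¹' {g x}) :=
    hle _ (hg.measurable (measurableSet_singleton _))
  exact ((hs : x ∈ g ⁻¹' {g x} ↔ y ∈ g ⁻¹' {g x}).1 rfl).symm

end Relabel

/-- The kernel variable `h_{I,J}` is measurable for every σ-algebra for which the variables
that it involves are measurable. -/
theorem measurable_kernelVar {Ω' : Type*} {mΩ : MeasurableSpace Ω'} {ξ η : ℕ → Ω' → ℝ}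
    {ζ : ℕ → ℕ → Ω' → ℝ} {p q : ℕ} {h : (Fin p → Fin q → ℝ) → ℝ} {φ : ℝ × ℝ × ℝ → ℝ}
    (hm : Measurable h) (hφ : Measurable φ) {I J : Finset ℕ} (hI : I.card = p) (hJ : J.card = q)
    (hξ : ∀ i ∈ I, Measurable (ξ i)) (hη : ∀ j ∈ J, Measurable (η j))
    (hζ : ∀ i ∈ I, ∀ j ∈ J, Measurable (ζ i j)) :
    Measurable (kernelVar h φ ξ η ζ I J hI hJ) := by
  refine hm.comp (measurable_pi_lambda _ fun k => measurable_pi_lambda _ fun l => ?_)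
  have hk := I.orderEmbOfFin_mem hI k
  have hl := J.orderEmbOfFin_mem hJ l
  exact hφ.comp ((hξ _ hk).prodMk ((hη _ hl).prodMk (hζ _ hk _ hl)))

section Kernel

variable {Ω' : Type*} [MeasurableSpace Ω'] {Q : Measure Ω'} {ξ η : ℕ → Ω' → ℝ}
  {ζ : ℕ → ℕ → Ω' → ℝ} {p q : ℕ} {h : (Fin p → Fin q → ℝ) → ℝ} {φ : ℝ × ℝ × ℝ → ℝ}

theorem exists_perm_orderEmbOfFin {I : Finset ℕ} {k : ℕ} (hI : I.card = k) (σ : Equiv.Perm ℕ)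
    (hI' : (I.map σ.toEmbedding).card = k) :
    ∃ π : Equiv.Perm (Fin k), ∀ i,
      σ (I.orderEmbOfFin hI i) = (I.map σ.toEmbedding).orderEmbOfFin hI' (π i) := by
  let e₁ := (I.orderIsoOfFin hI).toEquiv
  let e₂ := ((I.map σ.toEmbedding).orderIsoOfFin hI').toEquiv
  let s : I ≃ (I.map σ.toEmbedding : Finset ℕ) := σ.subtypeEquiv fun a => by simp
  refine ⟨(e₁.trans s).trans e₂.symm, fun i => ?_⟩
  have : (I.map σ.toEmbedding).orderEmbOfFin hI' (((e₁.trans s).trans e₂.symm) i) =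
      (e₂ (((e₁.trans s).trans e₂.symm) i)).1 := rfl
  rw [this]
  simp only [Equiv.trans_apply, Equiv.apply_symm_apply]
  rfl

theorem kernelVar_relabel (hsymm : IsSymmetricKernel h) (σ τ : Equiv.Perm ℕ) {I J : Finset ℕ}
    (hI : I.card = p) (hJ : J.card = q) :
    kernelVar h φ (fun i => ξ (σ i)) (fun j => η (τ j)) (fun i j => ζ (σ i) (τ j)) I J hI hJ =
      kernelVar h φ ξ η ζ (I.map σ.toEmbedding) (J.map τ.toEmbedding)
        ((Finset.card_map _).trans hI) ((Finset.card_map _).trans hJ) := by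
  funext ω
  obtain ⟨π, hπ⟩ := exists_perm_orderEmbOfFin hI σ ((Finset.card_map _).trans hI)
  obtain ⟨π', hπ'⟩ := exists_perm_orderEmbOfFin hJ τ ((Finset.card_map _).trans hJ)
  show h _ = h _
  rw [← hsymm π π' (submatrix (ahkMatrix φ ξ η ζ ω) (I.map σ.toEmbedding) (J.map τ.toEmbedding)
    ((Finset.card_map _).trans hI) ((Finset.card_map _).trans hJ))]
  congr 1
  funext k l
  simp only [submatrix, ahkMatrix, hπ, hπ']

theorem measurable_kernelVar_coord (hm : Measurable h) (hφ : Measurable φ) {I J : Finset ℕ}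
    (hI : I.card = p) (hJ : J.card = q) :
    Measurable (kernelVar h φ coordRow coordCol coordEdge I J hI hJ) :=
  measurable_kernelVar hm hφ hI hJ (fun _ _ => measurable_pi_apply _)
    (fun _ _ => measurable_pi_apply _) (fun _ _ _ _ => measurable_pi_apply _)

variable [IsProbabilityMeasure Q]

theorem identDistrib_kernelVar (hA : IsAHKVariables Q ξ η ζ) (hm : Measurable h)
    (hφ : Measurable φ) (hsymm : IsSymmetricKernel h) {I J I' J' : Finset ℕ} (hI : I.card = p)
    (hJ : J.card = q) (hI' : I'.card = p) (hJ' : J'.card = q) :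
    IdentDistrib (kernelVar h φ ξ η ζ I J hI hJ) (kernelVar h φ ξ η ζ I' J' hI' hJ') Q Q := by
  obtain ⟨σ, -, hσ⟩ := exists_perm_fix_map (Finset.empty_subset I) (Finset.empty_subset I')
    (hI.trans hI'.symm)
  obtain ⟨τ, -, hτ⟩ := exists_perm_fix_map (Finset.empty_subset J) (Finset.empty_subset J')
    (hJ.trans hJ'.symm)
  subst hσ hτ
  rw [← kernelVar_relabel hsymm σ τ hI hJ]
  have h1 : IdentDistrib (fun ω a => ahkVar ξ η ζ a ω) (fun ω a =>
      ahkVar (fun i => ξ (σ i)) (fun j => η (τ j)) (fun i j => ζ (σ i) (τ j)) a ω) Q Q :=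
    ⟨(measurable_ahkVec hA).aemeasurable, (measurable_ahkVec (hA.relabel σ τ)).aemeasurable,
      (map_ahkVec_relabel hA σ τ).symm⟩
  exact h1.comp (measurable_kernelVar_coord hm hφ hI hJ)

theorem proj_kernelVar_relabel (hA : IsAHKVariables Q ξ η ζ) (hm : Measurable h)
    (hφ : Measurable φ) (hsymm : IsSymmetricKernel h) {I J : Finset ℕ} (hI : I.card = p)
    (hJ : J.card = q) (hint : Integrable (kernelVar h φ ξ η ζ I J hI hJ) Q) (G : BGraph) :
    ∃ g : (ℕ ⊕ ℕ ⊕ ℕ × ℕ → ℝ) → ℝ,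
      StronglyMeasurable[graphSigma coordRow coordCol coordEdge G] g ∧
      (proj Q ξ η ζ (kernelVar h φ ξ η ζ I J hI hJ) G =ᵐ[Q]
        fun ω => g fun a => ahkVar ξ η ζ a ω) ∧
      ∀ σ τ : Equiv.Perm ℕ,
        proj Q ξ η ζ (kernelVar h φ ξ η ζ (I.map σ.toEmbedding) (J.map τ.toEmbedding)
          ((Finset.card_map _).trans hI) ((Finset.card_map _).trans hJ)) (G.map σ τ) =ᵐ[Q]
        fun ω => g fun a =>
          ahkVar (fun i => ξ (σ i)) (fun j => η (τ j)) (fun i j => ζ (σ i) (τ j)) a ω := by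
  have hf : Integrable (kernelVar h φ coordRow coordCol coordEdge I J hI hJ)
      (Q.map fun ω a => ahkVar ξ η ζ a ω) :=
    (integrable_map_measure (measurable_kernelVar_coord hm hφ hI hJ).aestronglyMeasurable
      (measurable_ahkVec hA).aemeasurable).2 hint
  refine ⟨proj (Q.map fun ω a => ahkVar ξ η ζ a ω) coordRow coordCol coordEdge
    (kernelVar h φ coordRow coordCol coordEdge I J hI hJ) G, stronglyMeasurable_proj _ _,
    proj_comp_ahkVec hA hf G, fun σ τ => ?_⟩
  rw [← kernelVar_relabel hsymm σ τ hI hJ, ← proj_relabel, ← map_ahkVec_relabel hA σ τ]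
  rw [← map_ahkVec_relabel hA σ τ] at hf
  exact proj_comp_ahkVec (hA.relabel σ τ) hf G

/-- The projection on `G` does not depend on the choice of the rows and columns of the kernel
variable, and isomorphic graphs have identically distributed projections. -/
theorem proj_kernelVar_ae_eq (hA : IsAHKVariables Q ξ η ζ) (hm : Measurable h)
    (hφ : Measurable φ) (hsymm : IsSymmetricKernel h) {I J I' J' : Finset ℕ} (hI : I.card = p)
    (hJ : J.card = q) (hI' : I'.card = p) (hJ' : J'.card = q)
    (hint : Integrable (kernelVar h φ ξ η ζ I J hI hJ) Q) {G : BGraph}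
    (hG : G ≤ BGraph.complete I J) (hG' : G ≤ BGraph.complete I' J') :
    proj Q ξ η ζ (kernelVar h φ ξ η ζ I J hI hJ) G =ᵐ[Q]
      proj Q ξ η ζ (kernelVar h φ ξ η ζ I' J' hI' hJ') G := by
  obtain ⟨σ, hσ, hσI⟩ := exists_perm_fix_map hG.1 hG'.1 (hI.trans hI'.symm)
  obtain ⟨τ, hτ, hτJ⟩ := exists_perm_fix_map hG.2.1 hG'.2.1 (hJ.trans hJ'.symm)
  subst hσI hτJ
  obtain ⟨g, hg, h1, h2⟩ := proj_kernelVar_relabel hA hm hφ hsymm hI hJ hint G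
  have h3 := h2 σ τ
  rw [BGraph.map_eq_self hσ hτ] at h3
  refine h1.trans (EventuallyEq.trans (Eventually.of_forall fun ω => ?_) h3.symm)
  refine eq_of_stronglyMeasurable_graphSigma hg (fun i hi => ?_) (fun j hj => ?_) fun e he => ?_
  · simp [coordRow, ahkVar, hσ i hi]
  · simp [coordCol, ahkVar, hτ j hj]
  · have hm := Finset.mem_product.1 (G.edges_subset he)
    simp [coordEdge, ahkVar, hσ _ hm.1, hτ _ hm.2]

theorem identDistrib_proj_kernelVar_map (hA : IsAHKVariables Q ξ η ζ) (hm : Measurable h)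
    (hφ : Measurable φ) (hsymm : IsSymmetricKernel h) {I J : Finset ℕ} (hI : I.card = p)
    (hJ : J.card = q) (hint : Integrable (kernelVar h φ ξ η ζ I J hI hJ) Q) (G : BGraph)
    (σ τ : Equiv.Perm ℕ) :
    IdentDistrib (proj Q ξ η ζ (kernelVar h φ ξ η ζ I J hI hJ) G)
      (proj Q ξ η ζ (kernelVar h φ ξ η ζ (I.map σ.toEmbedding) (J.map τ.toEmbedding)
          ((Finset.card_map _).trans hI) ((Finset.card_map _).trans hJ)) (G.map σ τ)) Q Q := by
  obtain ⟨g, hg, h1, h2⟩ := proj_kernelVar_relabel hA hm hφ hsymm hI hJ hint G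
  have hgm : Measurable g := (hg.mono (graphSigma_coord_le G)).measurable
  have h3 : IdentDistrib (fun ω a => ahkVar ξ η ζ a ω) (fun ω a =>
      ahkVar (fun i => ξ (σ i)) (fun j => η (τ j)) (fun i j => ζ (σ i) (τ j)) a ω) Q Q :=
    ⟨(measurable_ahkVec hA).aemeasurable, (measurable_ahkVec (hA.relabel σ τ)).aemeasurable,
      (map_ahkVec_relabel hA σ τ).symm⟩
  exact ((IdentDistrib.of_ae_eq (hA.measurable_proj _ _).aemeasurable h1).trans
    (h3.comp hgm)).trans
      (IdentDistrib.of_ae_eq (hA.measurable_proj _ _).aemeasurable (h2 σ τ)).symm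

end Kernel

/-! ### Quadruples of connected graphs -/

namespace BGraph

/-- The set of all nodes of a graph. -/
def verts (G : BGraph) : Finset (ℕ ⊕ ℕ) := G.rows.disjSum G.cols

theorem card_verts (G : BGraph) : G.verts.card = G.numNodes := Finset.card_disjSum _ _

theorem inl_mem_verts {G : BGraph} {i : ℕ} : Sum.inl i ∈ G.verts ↔ i ∈ G.rows := by
  simp [verts]

theorem inr_mem_verts {G : BGraph} {j : ℕ} : Sum.inr j ∈ G.verts ↔ j ∈ G.cols := by
  simp [verts]

theorem verts_mono {F G : BGraph} (h : F ≤ G) : F.verts ⊆ G.verts :=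
  Finset.disjSum_mono h.1 h.2.1

theorem verts_union (F G : BGraph) : (F.union G).verts = F.verts ∪ G.verts := by
  ext (i | j) <;> simp [verts, union]

theorem le_complete_iff {G : BGraph} {I J : Finset ℕ} :
    G ≤ complete I J ↔ G.rows ⊆ I ∧ G.cols ⊆ J :=
  ⟨fun h => ⟨h.1, h.2.1⟩, fun h => ⟨h.1, h.2,
    G.edges_subset.trans (Finset.product_subset_product h.1 h.2)⟩⟩

theorem le_complete_toLeft_toRight {G : BGraph} {A : Finset (ℕ ⊕ ℕ)} (h : G.verts ⊆ A) :
    G ≤ complete A.toLeft A.toRight :=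
  le_complete_iff.2 ⟨fun _ hi => Finset.mem_toLeft.2 (h (inl_mem_verts.2 hi)),
    fun _ hj => Finset.mem_toRight.2 (h (inr_mem_verts.2 hj))⟩

theorem verts_complete (A : Finset (ℕ ⊕ ℕ)) : (complete A.toLeft A.toRight).verts = A :=
  Finset.toLeft_disjSum_toRight

/-- The nodes of `F` that belong to `A` form a union of components of `F` if every edge of `F`
at a node of `A` stays in `A`. -/
theorem Connected.verts_subset {F : BGraph} (hF : F.Connected) {A : Finset (ℕ ⊕ ℕ)}
    (hA : ¬ Disjoint F.verts A)
    (hrow : ∀ e ∈ F.edges, Sum.inl e.1 ∈ A → Sum.inr e.2 ∈ A)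
    (hcol : ∀ e ∈ F.edges, Sum.inr e.2 ∈ A → Sum.inl e.1 ∈ A) : F.verts ⊆ A := by
  let node : F.rows ⊕ F.cols → ℕ ⊕ ℕ := Sum.map Subtype.val Subtype.val
  have hnode : ∀ v ∈ F.verts, ∃ u, node u = v := by
    rintro (i | j) hv
    · exact ⟨Sum.inl ⟨i, inl_mem_verts.1 hv⟩, rfl⟩
    · exact ⟨Sum.inr ⟨j, inr_mem_verts.1 hv⟩, rfl⟩
  have hadj : ∀ u w, F.toSimpleGraph.Adj u w → node u ∈ A → node w ∈ A := by
    intro u w huw hu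
    rcases (SimpleGraph.fromRel_adj _ _ _).1 huw with
      ⟨-, ⟨i, j, rfl, rfl, he⟩ | ⟨i, j, rfl, rfl, he⟩⟩
    · exact hrow _ he hu
    · exact hcol _ he hu
  obtain ⟨v, hv, hvA⟩ := Finset.not_disjoint_iff.1 hA
  obtain ⟨u, rfl⟩ := hnode v hv
  intro w hw
  obtain ⟨w, rfl⟩ := hnode w hw
  obtain ⟨walk⟩ := hF.preconnected u w
  clear hv hw
  induction walk with
  | nil => exact hvA
  | cons h _ ih => exact ih (hadj _ _ h hvA)

/-- If each of four graphs with `d` nodes is covered by the other three, and there are at least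
`2d` nodes in total, then every node belongs to exactly two of the graphs. -/
theorem card_filter_eq_two {ι ν : Type*} [Fintype ι] [DecidableEq ν] (A : ι → Finset ν) (d : ℕ)
    (hd : ∀ i, (A i).card = d) (U : Finset ν) (hU : ∀ i, A i ⊆ U)
    (hcov : ∀ v ∈ U, 2 ≤ (Finset.univ.filter fun i => v ∈ A i).card)
    (hcard : Fintype.card ι * d ≤ 2 * U.card) :
    ∀ v ∈ U, (Finset.univ.filter fun i => v ∈ A i).card = 2 := by
  have hsum : ∑ v ∈ U, (Finset.univ.filter fun i => v ∈ A i).card = Fintype.card ι * d := by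
    simp only [Finset.card_filter]
    rw [Finset.sum_comm]
    have : ∀ i, ∑ v ∈ U, (if v ∈ A i then 1 else 0) = d := fun i => by
      rw [← Finset.card_filter, Finset.filter_mem_eq_inter, Finset.inter_eq_right.2 (hU i), hd i]
    simp [this]
  intro v hv
  refine le_antisymm ?_ (hcov v hv)
  by_contra hlt
  have : ∑ v ∈ U, 2 < ∑ v ∈ U, (Finset.univ.filter fun i => v ∈ A i).card :=
    Finset.sum_lt_sum hcov ⟨v, hv, not_le.1 hlt⟩
  rw [hsum, Finset.sum_const, smul_eq_mul] at this
  omega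

/-- Four graphs with `d` nodes, each covered by the others and the first one connected, such that
the first two have a common node and the first two have a common node with the last two, have
fewer than `2d` nodes in total: otherwise every node belongs to exactly two graphs, hence every
edge of the first graph at a node of the second graph is an edge of the second graph, so that the
first two graphs have the same nodes. -/
theorem card_verts_quad_lt {d : ℕ} {G₁ G₂ G₃ G₄ : BGraph} (hconn : G₁.Connected)
    (h₁ : G₁.verts.card = d) (h₂ : G₂.verts.card = d) (h₃ : G₃.verts.card = d)
    (h₄ : G₄.verts.card = d) (c₁ : G₁ ≤ G₂.union (G₃.union G₄)) (c₂ : G₂ ≤ G₁.union (G₃.union G₄))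
    (c₃ : G₃ ≤ G₄.union (G₁.union G₂)) (c₄ : G₄ ≤ G₃.union (G₁.union G₂))
    (h12 : ¬ Disjoint G₁.verts G₂.verts)
    (hdis : ¬ Disjoint (G₁.verts ∪ G₂.verts) (G₃.verts ∪ G₄.verts)) :
    ((G₁.verts ∪ G₂.verts) ∪ (G₃.verts ∪ G₄.verts)).card < 2 * d := by
  by_contra hcard
  rw [not_lt] at hcard
  have v₁ := verts_mono c₁
  have v₂ := verts_mono c₂
  have v₃ := verts_mono c₃
  have v₄ := verts_mono c₄
  simp only [verts_union] at v₁ v₂ v₃ v₄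
  set U := (G₁.verts ∪ G₂.verts) ∪ (G₃.verts ∪ G₄.verts) with hU
  have key := card_filter_eq_two (ι := Fin 4) ![G₁.verts, G₂.verts, G₃.verts, G₄.verts] d
    (by intro i; fin_cases i <;> assumption) U
    (by
      intro i
      fin_cases i <;> intro x hx <;> simp [hU] at hx ⊢ <;> tauto)
    (by
      intro v hv
      simp only [Finset.card_filter, Fin.sum_univ_four, Matrix.cons_val_zero, Matrix.cons_val_one,
        Matrix.cons_val]
      have w₁ := @v₁ v
      have w₂ := @v₂ v
      have w₃ := @v₃ v
      have w₄ := @v₄ v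
      simp only [hU, Finset.mem_union] at hv w₁ w₂ w₃ w₄
      by_cases m₁ : v ∈ G₁.verts <;> by_cases m₂ : v ∈ G₂.verts <;>
      by_cases m₃ : v ∈ G₃.verts <;> by_cases m₄ : v ∈ G₄.verts <;>
      simp [m₁, m₂, m₃, m₄] at hv w₁ w₂ w₃ w₄ ⊢)
    (by simpa using by omega)
  have excl : ∀ v, v ∈ G₁.verts → v ∈ G₂.verts → v ∉ G₃.verts ∧ v ∉ G₄.verts := by
    intro v m₁ m₂
    have := key v (by simp [hU, m₁])
    simp only [Finset.card_filter, Fin.sum_univ_four, Matrix.cons_val_zero, Matrix.cons_val_one,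
      Matrix.cons_val, m₁, m₂, if_true] at this
    constructor <;> intro m <;> simp only [m, if_true] at this <;> split_ifs at this <;> omega
  have hedge : ∀ e ∈ G₁.edges, (Sum.inl e.1 ∈ G₂.verts ∨ Sum.inr e.2 ∈ G₂.verts) →
      e ∈ G₂.edges := by
    intro e he hor
    have he' := Finset.mem_product.1 (G₁.edges_subset he)
    have := c₁.2.2 he
    simp only [union, Finset.mem_union] at this
    rcases this with h | h | h
    · exact h
    · exfalso
      have h' := Finset.mem_product.1 (G₃.edges_subset h)
      rcases hor with m | m
      · exact (excl _ (inl_mem_verts.2 he'.1) m).1 (inl_mem_verts.2 h'.1)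
      · exact (excl _ (inr_mem_verts.2 he'.2) m).1 (inr_mem_verts.2 h'.2)
    · exfalso
      have h' := Finset.mem_product.1 (G₄.edges_subset h)
      rcases hor with m | m
      · exact (excl _ (inl_mem_verts.2 he'.1) m).2 (inl_mem_verts.2 h'.1)
      · exact (excl _ (inr_mem_verts.2 he'.2) m).2 (inr_mem_verts.2 h'.2)
  have hsub : G₁.verts ⊆ G₂.verts := hconn.verts_subset h12
    (fun e he m => inr_mem_verts.2
      (Finset.mem_product.1 (G₂.edges_subset (hedge e he (Or.inl m)))).2)
    (fun e he m => inl_mem_verts.2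
      (Finset.mem_product.1 (G₂.edges_subset (hedge e he (Or.inr m)))).1)
  have heq : G₁.verts = G₂.verts := Finset.eq_of_subset_of_card_le hsub (by omega)
  obtain ⟨w, hw, hw'⟩ := Finset.not_disjoint_iff.1 hdis
  rw [heq, Finset.union_idempotent] at hw
  have := excl w (heq ▸ hw) hw
  rcases Finset.mem_union.1 hw' with m | m
  exacts [this.1 m, this.2 m]

end BGraph

/-! ### Sums of projections on connected graphs are degenerate families -/

section Family

variable {Ω' : Type*} [MeasurableSpace Ω'] {Q : Measure Ω'} [IsProbabilityMeasure Q]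
  {ξ η : ℕ → Ω' → ℝ} {ζ : ℕ → ℕ → Ω' → ℝ}

/-- The sum of weighted projections over the graphs in `S` with node set `A`. -/
noncomputable def vertexSum (Q : Measure Ω') (ξ η : ℕ → Ω' → ℝ) (ζ : ℕ → ℕ → Ω' → ℝ)
    (S : Finset BGraph) (a : BGraph → ℝ) (X : BGraph → Ω' → ℝ) (A : Finset (ℕ ⊕ ℕ)) (ω : Ω') : ℝ :=
  ∑ G ∈ S with G.verts = A, a G * proj Q ξ η ζ (X G) G ω

theorem stronglyMeasurable_vertexSum (S : Finset BGraph) (a : BGraph → ℝ)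
    (X : BGraph → Ω' → ℝ) {A : Finset (ℕ ⊕ ℕ)} {F : BGraph}
    (hF : ∀ G ∈ S, G.verts = A → G ≤ F) :
    StronglyMeasurable[graphSigma ξ η ζ F] (vertexSum Q ξ η ζ S a X A) := by
  refine Finset.stronglyMeasurable_fun_sum _ fun G hG => ?_
  obtain ⟨h1, h2⟩ := Finset.mem_filter.1 hG
  exact ((stronglyMeasurable_proj (X G) G).mono (graphSigma_mono (hF G h1 h2))).const_mul _

theorem IsAHKVariables.indep_graphSigma (h : IsAHKVariables Q ξ η ζ) {F G : BGraph}
    (hFG : Disjoint F.elems G.elems) : Indep (graphSigma ξ η ζ F) (graphSigma ξ η ζ G) Q := by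
  rw [graphSigma_eq_iSup, graphSigma_eq_iSup]
  exact indep_iSup_of_disjoint (fun a => (h.measurable_ahkVar a).comap_le)
    ((iIndepFun_iff_iIndep _ _ _).1 h.independent) hFG

theorem BGraph.disjoint_elems {F G : BGraph} (h : Disjoint F.verts G.verts) :
    Disjoint F.elems G.elems := by
  rw [Set.disjoint_left]
  rintro (i | j | e) h1 h2
  · have m1 : i ∈ F.rows := by simpa [BGraph.elems] using h1
    have m2 : i ∈ G.rows := by simpa [BGraph.elems] using h2
    exact Finset.disjoint_left.1 h (BGraph.inl_mem_verts.2 m1) (BGraph.inl_mem_verts.2 m2)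
  · have m1 : j ∈ F.cols := by simpa [BGraph.elems] using h1
    have m2 : j ∈ G.cols := by simpa [BGraph.elems] using h2
    exact Finset.disjoint_left.1 h (BGraph.inr_mem_verts.2 m1) (BGraph.inr_mem_verts.2 m2)
  · have m1 : e ∈ F.edges := by simpa [BGraph.elems] using h1
    have m2 : e ∈ G.edges := by simpa [BGraph.elems] using h2
    exact Finset.disjoint_left.1 h
      (BGraph.inl_mem_verts.2 (Finset.mem_product.1 (F.edges_subset m1)).1)
      (BGraph.inl_mem_verts.2 (Finset.mem_product.1 (G.edges_subset m2)).1)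

theorem BGraph.card_filter_verts_le (S : Finset BGraph) {d : ℕ} {A : Finset (ℕ ⊕ ℕ)}
    (hA : A.card = d) : (S.filter fun G => G.verts = A).card ≤ 2 ^ (d * d) := by
  have h1 : (S.filter fun G => G.verts = A).card ≤ ((A.toLeft ×ˢ A.toRight).powerset).card := by
    refine Finset.card_le_card_of_injOn (fun G => G.edges) ?_ ?_
    · intro G hG
      have hv := (Finset.mem_filter.1 hG).2
      exact Finset.mem_coe.2 (Finset.mem_powerset.2
        (BGraph.le_complete_toLeft_toRight hv.subset).2.2)
    · intro G hG G' hG' he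
      have hv := (Finset.mem_filter.1 hG).2
      have hv' := (Finset.mem_filter.1 hG').2
      have := Finset.disjSum_inj.1 (hv.trans hv'.symm)
      exact BGraph.ext this.1 this.2 he
  rw [Finset.card_powerset, Finset.card_product] at h1
  refine h1.trans (Nat.pow_le_pow_right two_pos (Nat.mul_le_mul ?_ ?_))
  · rw [← hA]; exact Finset.card_toLeft_le
  · rw [← hA]; exact Finset.card_toRight_le

/-- Weighted sums of projections on connected graphs with `d` nodes, grouped by node sets, form a
degenerate family. The factor `2 ^ (d * d)` bounds the number of graphs with given nodes. -/
theorem isDegenerateFamily_vertexSum (h : IsAHKVariables Q ξ η ζ) {I J : Finset ℕ} {d : ℕ}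
    {S : Finset BGraph}
    (hS : ∀ G ∈ S, G ≤ BGraph.complete I J ∧ G.numNodes = d ∧ G.Connected) (a : BGraph → ℝ)
    {X : BGraph → Ω' → ℝ} (hX : ∀ G, MemLp (X G) ⊤ Q) {β : ℝ}
    (hβ : ∀ G ∈ S, ∀ᵐ ω ∂Q, |a G * proj Q ξ η ζ (X G) G ω| ≤ β) (hβ0 : 0 ≤ β) :
    IsDegenerateFamily Q (I.disjSum J) d (2 ^ (d * d) * β) (vertexSum Q ξ η ζ S a X) := by
  have hpL : ∀ G, MemLp (proj Q ξ η ζ (X G) G) ⊤ Q := fun G => memLp_proj le_top (hX G) G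
  have hXi : ∀ G, Integrable (X G) Q := fun G => (hX G).integrable le_top
  have hX2 : ∀ G, MemLp (X G) 2 Q := fun G => (hX G).mono_exponent le_top
  have hvm : ∀ A, Measurable (vertexSum Q ξ η ζ S a X A) := fun A =>
    Finset.measurable_fun_sum _ fun G _ => (h.measurable_proj _ _).const_mul _
  have hvL : ∀ A, MemLp (vertexSum Q ξ η ζ S a X A) ⊤ Q := fun A =>
    memLp_finsetSum _ fun G _ => (hpL G).const_mul _
  refine ⟨hvm, fun A hA => ?_, ?_, ?_, ?_, ?_⟩
  · have h1 : ∀ᵐ ω ∂Q, ∀ G ∈ S, |a G * proj Q ξ η ζ (X G) G ω| ≤ β :=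
      (Finset.eventually_all _).2 hβ
    filter_upwards [h1] with ω hω
    refine (Finset.abs_sum_le_sum_abs _ _).trans ((Finset.sum_le_card_nsmul _ _ β fun G hG =>
      hω G (Finset.mem_filter.1 hG).1).trans ?_)
    rw [nsmul_eq_mul]
    refine mul_le_mul_of_nonneg_right ?_ hβ0
    exact_mod_cast BGraph.card_filter_verts_le S (Finset.mem_powersetCard.1 hA).2
  · intro A hA v hv g hg hgb
    -- the complete graph on all nodes but `v`
    set F := BGraph.complete ((I.disjSum J).erase v).toLeft ((I.disjSum J).erase v).toRight with hF
    have hFv : F.verts = (I.disjSum J).erase v := BGraph.verts_complete _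
    have hm : StronglyMeasurable[graphSigma ξ η ζ F] fun ω =>
        g (∑ B ∈ (I.disjSum J).powersetCard d with v ∉ B, vertexSum Q ξ η ζ S a X B ω) := by
      refine (hg.comp (StronglyMeasurable.measurable ?_)).stronglyMeasurable
      refine Finset.stronglyMeasurable_fun_sum _ fun B hB => ?_
      refine stronglyMeasurable_vertexSum S a X fun G hG hGB => ?_
      refine BGraph.le_complete_toLeft_toRight fun x hx => Finset.mem_erase.2 ⟨?_, ?_⟩
      · rintro rfl
        exact (Finset.mem_filter.1 hB).2 (hGB ▸ hx)
      · exact (Finset.mem_powersetCard.1 (Finset.mem_filter.1 hB).1).1 (hGB ▸ hx)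
    obtain ⟨C, hC⟩ := hgb
    have hmL : MemLp (fun ω =>
        g (∑ B ∈ (I.disjSum J).powersetCard d with v ∉ B, vertexSum Q ξ η ζ S a X B ω)) ⊤ Q :=
      memLp_top_of_bound (hm.mono (h.graphSigma_le F)).aestronglyMeasurable C
        (Eventually.of_forall fun ω => hC _)
    have hint : ∀ G, Integrable (fun ω => proj Q ξ η ζ (X G) G ω *
        g (∑ B ∈ (I.disjSum J).powersetCard d with v ∉ B, vertexSum Q ξ η ζ S a X B ω)) Q :=
      fun G => ((hpL G).mul_top hmL).integrable le_top
    have e1 : ∀ ω, vertexSum Q ξ η ζ S a X A ω *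
        g (∑ B ∈ (I.disjSum J).powersetCard d with v ∉ B, vertexSum Q ξ η ζ S a X B ω) =
        ∑ G ∈ S with G.verts = A, a G * (proj Q ξ η ζ (X G) G ω *
          g (∑ B ∈ (I.disjSum J).powersetCard d with v ∉ B, vertexSum Q ξ η ζ S a X B ω)) := by
      intro ω
      rw [vertexSum, Finset.sum_mul]
      simp only [mul_assoc]
    simp only [e1]
    rw [integral_finsetSum _ fun G _ => (hint G).const_mul _]
    refine Finset.sum_eq_zero fun G hG => ?_
    rw [integral_const_mul, h.integral_proj_mul_eq_zero (hXi G) (F := F) ?_ hm (hint G), mul_zero]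
    intro hle
    have := BGraph.verts_mono hle
    rw [hFv, (Finset.mem_filter.1 hG).2] at this
    exact (Finset.mem_erase.1 (this hv)).1 rfl
  · intro A hA B hB hAB
    have e1 : ∀ ω, vertexSum Q ξ η ζ S a X A ω * vertexSum Q ξ η ζ S a X B ω =
        ∑ G ∈ S with G.verts = A, ∑ G' ∈ S with G'.verts = B, (a G * a G') *
          (proj Q ξ η ζ (X G) G ω * proj Q ξ η ζ (X G') G' ω) := by
      intro ω
      rw [vertexSum, vertexSum, Finset.sum_mul_sum]
      refine Finset.sum_congr rfl fun G _ => Finset.sum_congr rfl fun G' _ => ?_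
      ring
    have hint : ∀ G G', Integrable (fun ω => (a G * a G') *
        (proj Q ξ η ζ (X G) G ω * proj Q ξ η ζ (X G') G' ω)) Q := fun G G' =>
      (((hpL G).mul_top (hpL G')).integrable le_top).const_mul _
    simp only [e1]
    rw [integral_finsetSum _ fun G _ => integrable_finsetSum _ fun G' _ => hint G G']
    refine Finset.sum_eq_zero fun G hG => ?_
    rw [integral_finsetSum _ fun G' _ => hint G G']
    refine Finset.sum_eq_zero fun G' hG' => ?_
    rw [integral_const_mul, h.integral_proj_mul_proj (hX2 G) (hX2 G'), mul_zero]
    rintro rfl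
    exact hAB ((Finset.mem_filter.1 hG).2.symm.trans (Finset.mem_filter.1 hG').2)
  · intro A hA B hB C hC D hD hdis
    have hm : ∀ A B : Finset (ℕ ⊕ ℕ), StronglyMeasurable[graphSigma ξ η ζ
        (BGraph.complete (A ∪ B).toLeft (A ∪ B).toRight)]
        fun ω => vertexSum Q ξ η ζ S a X A ω * vertexSum Q ξ η ζ S a X B ω := by
      intro A B
      refine (stronglyMeasurable_vertexSum S a X fun G _ hG => ?_).mul
        (stronglyMeasurable_vertexSum S a X fun G _ hG => ?_)
      · exact BGraph.le_complete_toLeft_toRight (hG ▸ Finset.subset_union_left)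
      · exact BGraph.le_complete_toLeft_toRight (hG ▸ Finset.subset_union_right)
    have hind : IndepFun (fun ω => vertexSum Q ξ η ζ S a X A ω * vertexSum Q ξ η ζ S a X B ω)
        (fun ω => vertexSum Q ξ η ζ S a X C ω * vertexSum Q ξ η ζ S a X D ω) Q := by
      rw [IndepFun_iff_Indep]
      refine indep_of_indep_of_le_left (indep_of_indep_of_le_right
        (h.indep_graphSigma (BGraph.disjoint_elems ?_)) (hm C D).measurable.comap_le)
        (hm A B).measurable.comap_le
      rw [BGraph.verts_complete, BGraph.verts_complete]
      exact hdis
    exact hind.integral_fun_mul_eq_mul_integral ((hvm A).mul (hvm B)).aestronglyMeasurable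
      ((hvm C).mul (hvm D)).aestronglyMeasurable
  · intro A hA B hB C hC D hD hAB hdis hcard
    have e1 : ∀ ω, (vertexSum Q ξ η ζ S a X A ω * vertexSum Q ξ η ζ S a X B ω) *
        (vertexSum Q ξ η ζ S a X C ω * vertexSum Q ξ η ζ S a X D ω) =
        ∑ G₁ ∈ S with G₁.verts = A, ∑ G₂ ∈ S with G₂.verts = B, ∑ G₃ ∈ S with G₃.verts = C,
          ∑ G₄ ∈ S with G₄.verts = D, (a G₁ * a G₂ * (a G₃ * a G₄)) *
          ((proj Q ξ η ζ (X G₁) G₁ ω * proj Q ξ η ζ (X G₂) G₂ ω) *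
            (proj Q ξ η ζ (X G₃) G₃ ω * proj Q ξ η ζ (X G₄) G₄ ω)) := by
      intro ω
      simp only [vertexSum]
      rw [Finset.sum_mul_sum, Finset.sum_mul_sum, Finset.sum_mul]
      refine Finset.sum_congr rfl fun G₁ _ => ?_
      rw [Finset.sum_mul]
      refine Finset.sum_congr rfl fun G₂ _ => ?_
      rw [Finset.mul_sum]
      refine Finset.sum_congr rfl fun G₃ _ => ?_
      rw [Finset.mul_sum]
      refine Finset.sum_congr rfl fun G₄ _ => ?_
      ring
    have hint : ∀ G₁ G₂ G₃ G₄, Integrable (fun ω => (a G₁ * a G₂ * (a G₃ * a G₄)) *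
          ((proj Q ξ η ζ (X G₁) G₁ ω * proj Q ξ η ζ (X G₂) G₂ ω) *
            (proj Q ξ η ζ (X G₃) G₃ ω * proj Q ξ η ζ (X G₄) G₄ ω))) Q := fun G₁ G₂ G₃ G₄ =>
      ((((hpL G₁).mul_top (hpL G₂)).mul_top ((hpL G₃).mul_top (hpL G₄))).integrable
        le_top).const_mul _
    -- a graph that is not covered by the other three makes the mixed moment vanish
    have hzero : ∀ G₁ G₂ G₃ G₄ : BGraph, ¬ G₁ ≤ G₂.union (G₃.union G₄) →
        ∫ ω, proj Q ξ η ζ (X G₁) G₁ ω * (proj Q ξ η ζ (X G₂) G₂ ω *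
          (proj Q ξ η ζ (X G₃) G₃ ω * proj Q ξ η ζ (X G₄) G₄ ω)) ∂Q = 0 := by
      intro G₁ G₂ G₃ G₄ hn
      refine h.integral_proj_mul_eq_zero (hXi G₁) hn
        (Z := fun ω => proj Q ξ η ζ (X G₂) G₂ ω *
          (proj Q ξ η ζ (X G₃) G₃ ω * proj Q ξ η ζ (X G₄) G₄ ω)) ?_
        (((hpL G₁).mul_top ((hpL G₂).mul_top ((hpL G₃).mul_top (hpL G₄)))).integrable le_top)
      have hle := BGraph.le_union_right G₂ (G₃.union G₄)
      exact ((stronglyMeasurable_proj _ _).mono (graphSigma_mono (BGraph.le_union_left _ _))).mul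
        (((stronglyMeasurable_proj _ _).mono
            (graphSigma_mono ((BGraph.le_union_left G₃ G₄).trans hle))).mul
          ((stronglyMeasurable_proj _ _).mono
            (graphSigma_mono ((BGraph.le_union_right G₃ G₄).trans hle))))
    simp only [e1]
    rw [integral_finsetSum _ fun G₁ _ => integrable_finsetSum _ fun G₂ _ =>
      integrable_finsetSum _ fun G₃ _ => integrable_finsetSum _ fun G₄ _ => hint G₁ G₂ G₃ G₄]
    refine Finset.sum_eq_zero fun G₁ hG₁ => ?_
    rw [integral_finsetSum _ fun G₂ _ =>
      integrable_finsetSum _ fun G₃ _ => integrable_finsetSum _ fun G₄ _ => hint G₁ G₂ G₃ G₄]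
    refine Finset.sum_eq_zero fun G₂ hG₂ => ?_
    rw [integral_finsetSum _ fun G₃ _ =>
      integrable_finsetSum _ fun G₄ _ => hint G₁ G₂ G₃ G₄]
    refine Finset.sum_eq_zero fun G₃ hG₃ => ?_
    rw [integral_finsetSum _ fun G₄ _ => hint G₁ G₂ G₃ G₄]
    refine Finset.sum_eq_zero fun G₄ hG₄ => ?_
    rw [integral_const_mul]
    obtain ⟨s₁, rfl⟩ := Finset.mem_filter.1 hG₁
    obtain ⟨s₂, rfl⟩ := Finset.mem_filter.1 hG₂
    obtain ⟨s₃, rfl⟩ := Finset.mem_filter.1 hG₃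
    obtain ⟨s₄, rfl⟩ := Finset.mem_filter.1 hG₄
    have hc : ∀ G ∈ S, G.verts.card = d := fun G hG => (BGraph.card_verts G).trans (hS G hG).2.1
    suffices hz : ∫ ω, (proj Q ξ η ζ (X G₁) G₁ ω * proj Q ξ η ζ (X G₂) G₂ ω) *
        (proj Q ξ η ζ (X G₃) G₃ ω * proj Q ξ η ζ (X G₄) G₄ ω) ∂Q = 0 by rw [hz, mul_zero]
    by_cases c₁ : G₁ ≤ G₂.union (G₃.union G₄)
    · by_cases c₂ : G₂ ≤ G₁.union (G₃.union G₄)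
      · by_cases c₃ : G₃ ≤ G₄.union (G₁.union G₂)
        · by_cases c₄ : G₄ ≤ G₃.union (G₁.union G₂)
          · have := BGraph.card_verts_quad_lt (hS G₁ s₁).2.2 (hc _ s₁) (hc _ s₂) (hc _ s₃)
              (hc _ s₄) c₁ c₂ c₃ c₄ hAB hdis
            omega
          · rw [← hzero G₄ G₃ G₁ G₂ c₄]
            exact integral_congr_ae (Eventually.of_forall fun ω => by ring)
        · rw [← hzero G₃ G₄ G₁ G₂ c₃]
          exact integral_congr_ae (Eventually.of_forall fun ω => by ring)
      · rw [← hzero G₂ G₁ G₃ G₄ c₂]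
        exact integral_congr_ae (Eventually.of_forall fun ω => by ring)
    · rw [← hzero G₁ G₂ G₃ G₄ c₁]
      exact integral_congr_ae (Eventually.of_forall fun ω => by ring)

end Family

/-! ### Counting labelled graphs and isomorphism classes -/

namespace BGraph

/-- The graphs with node sets `A` and `B`. -/
noncomputable def spanning (A B : Finset ℕ) : Finset BGraph :=
  (complete A B).subgraphs.filter fun G => G.rows = A ∧ G.cols = B

theorem mem_spanning {A B : Finset ℕ} {G : BGraph} :
    G ∈ spanning A B ↔ G.rows = A ∧ G.cols = B := by
  rw [spanning, Finset.mem_filter, mem_subgraphs, le_complete_iff]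
  exact ⟨fun h => h.2, fun h => ⟨⟨h.1.subset, h.2.subset⟩, h⟩⟩

/-- The subgraphs of `K_{m,n}` with `r` row nodes and `c` column nodes. -/
noncomputable def levelGraphs (m n r c : ℕ) : Finset BGraph :=
  (complete (Finset.range m) (Finset.range n)).subgraphs.filter fun G =>
    G.rows.card = r ∧ G.cols.card = c

theorem mem_levelGraphs {m n r c : ℕ} {G : BGraph} : G ∈ levelGraphs m n r c ↔
    (G.rows ⊆ Finset.range m ∧ G.cols ⊆ Finset.range n) ∧ G.rows.card = r ∧ G.cols.card = c := by
  rw [levelGraphs, Finset.mem_filter, mem_subgraphs, le_complete_iff]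

theorem sum_spanning_map {A B : Finset ℕ} (σ τ : Equiv.Perm ℕ) (f : BGraph → ℝ) :
    ∑ G ∈ spanning (A.map σ.toEmbedding) (B.map τ.toEmbedding), f G =
      ∑ G ∈ spanning A B, f (G.map σ τ) := by
  symm
  refine Finset.sum_bij (fun G _ => G.map σ τ) ?_ (fun _ _ _ _ h => map_injective σ τ h) ?_
    (fun _ _ => rfl)
  · intro G hG
    obtain ⟨h1, h2⟩ := mem_spanning.1 hG
    exact mem_spanning.2 ⟨by simp [map, h1], by simp [map, h2]⟩
  · intro F hF
    obtain ⟨G, rfl⟩ := exists_map_eq F σ τ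
    obtain ⟨h1, h2⟩ := mem_spanning.1 hF
    exact ⟨G, mem_spanning.2 ⟨Finset.map_injective _ h1, Finset.map_injective _ h2⟩, rfl⟩

/-- A sum of a relabelling-invariant function over all labelled graphs of given size. -/
theorem sum_levelGraphs (m n r c : ℕ) (f : BGraph → ℝ)
    (hf : ∀ G : BGraph, G.rows.card = r → G.cols.card = c → ∀ σ τ : Equiv.Perm ℕ,
      f (G.map σ τ) = f G) :
    ∑ G ∈ levelGraphs m n r c, f G =
      m.choose r * n.choose c * ∑ G ∈ spanning (Finset.range r) (Finset.range c), f G := by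
  have hmaps : ∀ G ∈ levelGraphs m n r c, (G.rows, G.cols) ∈
      (Finset.range m).powersetCard r ×ˢ (Finset.range n).powersetCard c := by
    intro G hG
    obtain ⟨⟨h1, h2⟩, h3, h4⟩ := mem_levelGraphs.1 hG
    exact Finset.mem_product.2 ⟨Finset.mem_powersetCard.2 ⟨h1, h3⟩,
      Finset.mem_powersetCard.2 ⟨h2, h4⟩⟩
  rw [← Finset.sum_fiberwise_of_maps_to hmaps]
  have hfib : ∀ AB ∈ (Finset.range m).powersetCard r ×ˢ (Finset.range n).powersetCard c,
      ∑ G ∈ levelGraphs m n r c with (G.rows, G.cols) = AB, f G =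
        ∑ G ∈ spanning (Finset.range r) (Finset.range c), f G := by
    rintro ⟨A, B⟩ hAB
    obtain ⟨hA, hB⟩ := Finset.mem_product.1 hAB
    obtain ⟨hAm, hAr⟩ := Finset.mem_powersetCard.1 hA
    obtain ⟨hBn, hBc⟩ := Finset.mem_powersetCard.1 hB
    have h1 : (levelGraphs m n r c).filter (fun G => (G.rows, G.cols) = (A, B)) =
        spanning A B := by
      ext G
      rw [Finset.mem_filter, mem_levelGraphs, mem_spanning, Prod.mk.injEq]
      refine ⟨fun h => h.2, ?_⟩
      rintro ⟨rfl, rfl⟩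
      exact ⟨⟨⟨hAm, hBn⟩, hAr, hBc⟩, rfl, rfl⟩
    obtain ⟨σ, -, hσ⟩ := exists_perm_fix_map (S := ∅) (I := Finset.range r) (I' := A)
      (Finset.empty_subset _) (Finset.empty_subset _) (by simp [hAr])
    obtain ⟨τ, -, hτ⟩ := exists_perm_fix_map (S := ∅) (I := Finset.range c) (I' := B)
      (Finset.empty_subset _) (Finset.empty_subset _) (by simp [hBc])
    rw [h1, ← hσ, ← hτ, sum_spanning_map]
    refine Finset.sum_congr rfl fun G hG => ?_
    obtain ⟨h2, h3⟩ := mem_spanning.1 hG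
    exact hf G (by simp [h2]) (by simp [h3]) σ τ
  rw [Finset.sum_congr rfl hfib, Finset.sum_const, Finset.card_product,
    Finset.card_powersetCard, Finset.card_powersetCard, Finset.card_range, Finset.card_range,
    nsmul_eq_mul, Nat.cast_mul]

instance finite_iso (G G' : BGraph) : Finite (Iso G G') := Subtype.finite

theorem card_iso_eq_autCard {G G' : BGraph} (h : Isomorphic G G') :
    Nat.card (Iso G G') = G.autCard := by
  obtain ⟨⟨⟨e, f⟩, hef⟩⟩ := h
  refine Nat.card_congr
    { toFun := fun x => ⟨(x.1.1.trans e.symm, x.1.2.trans f.symm), fun i j => ?_⟩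
      invFun := fun x => ⟨(x.1.1.trans e, x.1.2.trans f), fun i j => ?_⟩
      left_inv := fun x => ?_
      right_inv := fun x => ?_ }
  · rw [x.2 i j, hef]
    simp
  · exact (x.2 i j).trans (hef _ _)
  · refine Subtype.ext (Prod.ext ?_ ?_) <;> · ext; simp
  · refine Subtype.ext (Prod.ext ?_ ?_) <;> · ext; simp

theorem autCard_pos (G : BGraph) : 0 < G.autCard :=
  have : Nonempty (Iso G G) := isomorphic_equivalence.refl G
  Nat.card_pos

/-- The number of labellings of a graph with `r` row nodes and `c` column nodes, counted by its
bijections onto `[r]` and `[c]`: every labelled copy arises from `|Aut(G)|` of them. -/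
theorem card_isomorphic_mul_autCard {r c : ℕ} {G : BGraph} (hr : G.rows.card = r)
    (hc : G.cols.card = c) :
    Nat.card {S // S ∈ spanning (Finset.range r) (Finset.range c) ∧ Isomorphic G S} * G.autCard =
      r.factorial * c.factorial := by
  classical
  let P := (G.rows ≃ Finset.range r) × (G.cols ≃ Finset.range c)
  have hP : Nat.card P = r.factorial * c.factorial := by
    rw [Nat.card_prod, Nat.card_eq_fintype_card, Nat.card_eq_fintype_card,
      Fintype.card_equiv (Fintype.equivOfCardEq (by simp [hr])),
      Fintype.card_equiv (Fintype.equivOfCardEq (by simp [hc]))]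
    simp [hr, hc]
  -- a pair of bijections amounts to a labelled copy together with an isomorphism onto it
  let Φ : (Σ S : {S // S ∈ spanning (Finset.range r) (Finset.range c) ∧ Isomorphic G S},
      Iso G S.1) → P := fun x =>
    (x.2.1.1.trans (Equiv.setCongr (by
        have := (mem_spanning.1 x.1.2.1).1; ext i; simp [this])),
      x.2.1.2.trans (Equiv.setCongr (by
        have := (mem_spanning.1 x.1.2.1).2; ext i; simp [this])))
  have hΦ : Function.Bijective Φ := by
    constructor
    · rintro ⟨⟨S, hS, hGS⟩, ⟨⟨e, f⟩, hef⟩⟩ ⟨⟨S', hS', hGS'⟩, ⟨⟨e', f'⟩, hef'⟩⟩ h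
      obtain ⟨R, C, E, hE⟩ := S
      obtain ⟨R', C', E', hE'⟩ := S'
      obtain ⟨h1, h2⟩ := mem_spanning.1 hS
      obtain ⟨h3, h4⟩ := mem_spanning.1 hS'
      simp only at h1 h2 h3 h4
      subst h1 h2 h3 h4
      obtain ⟨he, hf⟩ := Prod.mk.inj h
      have he' : e = e' := by
        ext i
        have := congrArg (fun g => ((g i : Finset.range r) : ℕ)) he
        exact this
      have hf' : f = f' := by
        ext i
        have := congrArg (fun g => ((g i : Finset.range c) : ℕ)) hf
        exact this
      subst he' hf'
      have hEE : E = E' := by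
        ext ⟨a, b⟩
        constructor
        · intro hab
          have hm := Finset.mem_product.1 (hE hab)
          have h5 := (hef (e.symm ⟨a, hm.1⟩) (f.symm ⟨b, hm.2⟩))
          have h6 := (hef' (e.symm ⟨a, hm.1⟩) (f.symm ⟨b, hm.2⟩))
          simp only [Equiv.apply_symm_apply] at h5 h6
          exact h6.1 (h5.2 hab)
        · intro hab
          have hm := Finset.mem_product.1 (hE' hab)
          have h5 := (hef (e.symm ⟨a, hm.1⟩) (f.symm ⟨b, hm.2⟩))
          have h6 := (hef' (e.symm ⟨a, hm.1⟩) (f.symm ⟨b, hm.2⟩))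
          simp only [Equiv.apply_symm_apply] at h5 h6
          exact h5.1 (h6.2 hab)
      subst hEE
      rfl
    · rintro ⟨e, f⟩
      let E : Finset (ℕ × ℕ) := (Finset.range r ×ˢ Finset.range c).filter fun x =>
        ∃ (hx : x.1 ∈ Finset.range r) (hy : x.2 ∈ Finset.range c),
          ((e.symm ⟨x.1, hx⟩).1, (f.symm ⟨x.2, hy⟩).1) ∈ G.edges
      let S : BGraph := ⟨Finset.range r, Finset.range c, E, Finset.filter_subset _ _⟩
      let ι : Iso G S := ⟨(e, f), fun i j => by
        constructor
        · intro hij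
          refine Finset.mem_filter.2 ⟨Finset.mk_mem_product (e i).2 (f j).2, (e i).2, (f j).2, ?_⟩
          simpa using hij
        · intro hij
          obtain ⟨_, hx, hy, h⟩ := Finset.mem_filter.1 hij
          simpa using h⟩
      exact ⟨⟨⟨S, mem_spanning.2 ⟨rfl, rfl⟩, ⟨ι⟩⟩, ι⟩, rfl⟩
  have : Finite {S // S ∈ spanning (Finset.range r) (Finset.range c) ∧ Isomorphic G S} :=
    ((spanning (Finset.range r) (Finset.range c)).finite_toSet.subset fun S hS => hS.1).to_subtype
  have := Fintype.ofFinite {S // S ∈ spanning (Finset.range r) (Finset.range c) ∧ Isomorphic G S}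
  rw [← hP, ← Nat.card_congr (Equiv.ofBijective Φ hΦ), Nat.card_sigma]
  rw [Finset.sum_congr rfl fun S _ => card_iso_eq_autCard S.2.2, Finset.sum_const,
    Finset.card_univ, Nat.card_eq_fintype_card, smul_eq_mul]

theorem mem_Gamma_spanning {r c : ℕ} {G : BGraph} (hG : G ∈ Gamma r c) :
    G.rows = Finset.range r ∧ G.cols = Finset.range c := by
  obtain ⟨x, rfl⟩ := mem_Gamma.1 hG
  exact (Quotient.out x).2

/-- The orbit counting formula for sums over labelled graphs. -/
theorem sum_spanning_eq_sum_Gamma (r c : ℕ) (f : BGraph → ℝ)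
    (hf : ∀ G G' : BGraph, G.rows.card = r → G.cols.card = c → Isomorphic G G' → f G = f G') :
    ∑ G ∈ spanning (Finset.range r) (Finset.range c), f G =
      r.factorial * c.factorial * ∑ G ∈ Gamma r c, (G.autCard : ℝ)⁻¹ * f G := by
  classical
  have h1 : ∀ S ∈ spanning (Finset.range r) (Finset.range c),
      f S = ∑ G ∈ Gamma r c, if Isomorphic G S then f G else 0 := by
    intro S hS
    obtain ⟨hr, hc⟩ := mem_spanning.1 hS
    obtain ⟨G, ⟨hG, hSG⟩, huniq⟩ := existsUnique_mem_Gamma (r := r) (c := c) S (by simp [hr])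
      (by simp [hc])
    rw [Finset.sum_eq_single G]
    · rw [if_pos (isomorphic_equivalence.symm hSG)]
      exact hf S G (by simp [hr]) (by simp [hc]) hSG
    · intro G' hG' hne
      rw [if_neg]
      intro h
      exact hne (huniq G' ⟨hG', isomorphic_equivalence.symm h⟩)
    · intro h
      exact absurd hG h
  rw [Finset.sum_congr rfl h1, Finset.sum_comm, Finset.mul_sum]
  refine Finset.sum_congr rfl fun G hG => ?_
  obtain ⟨hr, hc⟩ := mem_Gamma_spanning hG
  have h2 := card_isomorphic_mul_autCard (r := r) (c := c) (G := G) (by simp [hr]) (by simp [hc])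
  have h3 : Nat.card {S // S ∈ spanning (Finset.range r) (Finset.range c) ∧ Isomorphic G S} =
      ((spanning (Finset.range r) (Finset.range c)).filter fun S => Isomorphic G S).card := by
    exact Nat.subtype_card _ fun S => Finset.mem_filter
  rw [h3] at h2
  have h4 : ((((spanning (Finset.range r) (Finset.range c)).filter
      fun S => Isomorphic G S).card : ℝ)) * G.autCard = r.factorial * c.factorial := by
    exact_mod_cast h2
  have h5 : (G.autCard : ℝ) ≠ 0 := by exact_mod_cast (autCard_pos G).ne'
  rw [← Finset.sum_filter, Finset.sum_const, nsmul_eq_mul, ← h4]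
  field_simp

end BGraph

/-! ### The Hoeffding-type expansion of the `U`-statistic -/

section Padding

/-- A set of `k` natural numbers, which contains `S` if `S` has at most `k` elements. -/
noncomputable def padTo (k : ℕ) (S : Finset ℕ) : Finset ℕ :=
  if hS : S.card ≤ k then (Infinite.exists_superset_card_eq S k hS).choose else Finset.range k

theorem card_padTo (k : ℕ) (S : Finset ℕ) : (padTo k S).card = k := by
  unfold padTo
  split_ifs with hS
  · exact (Infinite.exists_superset_card_eq S k hS).choose_spec.2
  · exact Finset.card_range k

theorem subset_padTo {k : ℕ} {S : Finset ℕ} (hS : S.card ≤ k) : S ⊆ padTo k S := by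
  rw [padTo, dif_pos hS]
  exact (Infinite.exists_superset_card_eq S k hS).choose_spec.1

/-- The probability that a uniformly chosen `p`-element subset of `[m]` contains a given set of
`r` elements (for `p ≤ m`). -/
noncomputable def inclProb (p m r : ℕ) : ℝ :=
  if r ≤ p then ((m.choose p : ℝ))⁻¹ * (m - r).choose (p - r) else 0

theorem card_filter_superset {p m : ℕ} {S : Finset ℕ} (hS : S ⊆ Finset.range m) :
    (((Finset.range m).powersetCard p).filter fun I => S ⊆ I).card =
      if S.card ≤ p then (m - S.card).choose (p - S.card) else 0 := by
  split_ifs with h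
  · have hc : (Finset.range m \ S).card = m - S.card := by
      rw [Finset.card_sdiff_of_subset hS, Finset.card_range]
    rw [← hc, ← Finset.card_powersetCard]
    refine Finset.card_nbij' (fun I => I \ S) (fun K => K ∪ S) ?_ ?_ ?_ ?_
    · intro I hI
      simp only [Finset.coe_filter, Finset.mem_powersetCard, Set.mem_ofPred_eq] at hI
      obtain ⟨⟨h1, h2⟩, h3⟩ := hI
      rw [Finset.mem_coe, Finset.mem_powersetCard, Finset.card_sdiff_of_subset h3, h2]
      exact ⟨Finset.sdiff_subset_sdiff h1 le_rfl, rfl⟩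
    · intro K hK
      rw [Finset.mem_coe, Finset.mem_powersetCard] at hK
      obtain ⟨h1, h2⟩ := hK
      have hdis : Disjoint K S := Finset.disjoint_of_subset_left h1 Finset.sdiff_disjoint
      simp only [Finset.coe_filter, Finset.mem_powersetCard, Set.mem_ofPred_eq]
      refine ⟨⟨Finset.union_subset (h1.trans Finset.sdiff_subset) hS, ?_⟩,
        Finset.subset_union_right⟩
      rw [Finset.card_union_of_disjoint hdis, h2]
      omega
    · intro I hI
      simp only [Finset.coe_filter, Set.mem_ofPred_eq] at hI
      exact Finset.sdiff_union_of_subset hI.2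
    · intro K hK
      rw [Finset.mem_coe, Finset.mem_powersetCard] at hK
      have hdis : Disjoint K S := Finset.disjoint_of_subset_left hK.1 Finset.sdiff_disjoint
      exact Finset.union_sdiff_cancel_right hdis
  · refine Finset.card_eq_zero.2 (Finset.filter_eq_empty_iff.2 fun I hI hSI => h ?_)
    rw [← (Finset.mem_powersetCard.1 hI).2]
    exact Finset.card_le_card hSI

end Padding

section Setting

variable {Ω' : Type*} [MeasurableSpace Ω'] {Q : Measure Ω'} [IsProbabilityMeasure Q]
  {ξ η : ℕ → Ω' → ℝ} {ζ : ℕ → ℕ → Ω' → ℝ} {p q : ℕ} {h h' : (Fin p → Fin q → ℝ) → ℝ}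
  {φ : ℝ × ℝ × ℝ → ℝ}

/-- A symmetric kernel that is square integrable at the matrix `(φ(ξ_i, η_j, ζ_{ij}))`. -/
structure IsSquareIntegrableKernel (Q : Measure Ω') (h : (Fin p → Fin q → ℝ) → ℝ)
    (φ : ℝ × ℝ × ℝ → ℝ) (ξ η : ℕ → Ω' → ℝ) (ζ : ℕ → ℕ → Ω' → ℝ) : Prop where
  ahk : IsAHKVariables Q ξ η ζ
  measurable_fun : Measurable φ
  measurable_kernel : Measurable h
  symm : IsSymmetricKernel h
  memLp : MemLp (kernelVar h φ ξ η ζ (Finset.range p) (Finset.range q)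
    (Finset.card_range p) (Finset.card_range q)) 2 Q

/-- The projection `p^G` for an arbitrary graph `G` with at most `p` row nodes and `q` column
nodes, computed from some kernel variable whose rows and columns contain those of `G`. -/
noncomputable def graphProj (Q : Measure Ω') (h : (Fin p → Fin q → ℝ) → ℝ) (φ : ℝ × ℝ × ℝ → ℝ)
    (ξ η : ℕ → Ω' → ℝ) (ζ : ℕ → ℕ → Ω' → ℝ) (G : BGraph) : Ω' → ℝ :=
  proj Q ξ η ζ (kernelVar h φ ξ η ζ (padTo p G.rows) (padTo q G.cols) (card_padTo _ _)
    (card_padTo _ _)) G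

namespace IsSquareIntegrableKernel

theorem memLp_kernelVar (K : IsSquareIntegrableKernel Q h φ ξ η ζ) {I J : Finset ℕ}
    (hI : I.card = p) (hJ : J.card = q) : MemLp (kernelVar h φ ξ η ζ I J hI hJ) 2 Q :=
  (identDistrib_kernelVar K.ahk K.measurable_kernel K.measurable_fun K.symm
    (Finset.card_range p) (Finset.card_range q) hI hJ).memLp_iff.1 K.memLp

theorem integrable_kernelVar (K : IsSquareIntegrableKernel Q h φ ξ η ζ) {I J : Finset ℕ}
    (hI : I.card = p) (hJ : J.card = q) : Integrable (kernelVar h φ ξ η ζ I J hI hJ) Q :=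
  (K.memLp_kernelVar hI hJ).integrable one_le_two

theorem memLp_graphProj (K : IsSquareIntegrableKernel Q h φ ξ η ζ) (G : BGraph) :
    MemLp (graphProj Q h φ ξ η ζ G) 2 Q :=
  memLp_proj one_le_two (K.memLp_kernelVar _ _) G

theorem integral_mul_graphProj (K : IsSquareIntegrableKernel Q h φ ξ η ζ) {F G : BGraph}
    (hFG : F ≠ G) : ∫ ω, graphProj Q h φ ξ η ζ F ω * graphProj Q h φ ξ η ζ G ω ∂Q = 0 :=
  K.ahk.integral_proj_mul_proj (K.memLp_kernelVar _ _) (K.memLp_kernelVar _ _) hFG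

/-- By orthogonality, second moments of linear combinations of projections add up. -/
theorem integral_sum_graphProj_sq (K : IsSquareIntegrableKernel Q h φ ξ η ζ)
    (S : Finset BGraph) (a : BGraph → ℝ) :
    ∫ ω, (∑ G ∈ S, a G * graphProj Q h φ ξ η ζ G ω) ^ 2 ∂Q =
      ∑ G ∈ S, a G ^ 2 * ∫ ω, graphProj Q h φ ξ η ζ G ω ^ 2 ∂Q := by
  have e1 : ∀ ω, (∑ G ∈ S, a G * graphProj Q h φ ξ η ζ G ω) ^ 2 =
      ∑ G ∈ S, ∑ G' ∈ S, (a G * a G') *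
        (graphProj Q h φ ξ η ζ G ω * graphProj Q h φ ξ η ζ G' ω) := by
    intro ω
    rw [sq, Finset.sum_mul_sum]
    refine Finset.sum_congr rfl fun G _ => Finset.sum_congr rfl fun G' _ => ?_
    ring
  have hint : ∀ G G', Integrable (fun ω => (a G * a G') *
      (graphProj Q h φ ξ η ζ G ω * graphProj Q h φ ξ η ζ G' ω)) Q := fun G G' =>
    ((K.memLp_graphProj G).integrable_mul (K.memLp_graphProj G')).const_mul _
  simp only [e1]
  rw [integral_finsetSum _ fun G _ => integrable_finsetSum _ fun G' _ => hint G G']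
  refine Finset.sum_congr rfl fun G hG => ?_
  rw [integral_finsetSum _ fun G' _ => hint G G', Finset.sum_eq_single G]
  · rw [integral_const_mul]
    simp only [sq]
  · intro G' _ hne
    rw [integral_const_mul, K.integral_mul_graphProj hne.symm, mul_zero]
  · intro hn
    exact absurd hG hn

theorem memLp_sum_graphProj (K : IsSquareIntegrableKernel Q h φ ξ η ζ)
    (S : Finset BGraph) (a : BGraph → ℝ) :
    MemLp (fun ω => ∑ G ∈ S, a G * graphProj Q h φ ξ η ζ G ω) 2 Q :=
  memLp_finsetSum _ fun G _ => (K.memLp_graphProj G).const_mul _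

theorem proj_ae_eq_graphProj (K : IsSquareIntegrableKernel Q h φ ξ η ζ) {I J : Finset ℕ}
    (hI : I.card = p) (hJ : J.card = q) {G : BGraph} (hG : G ≤ BGraph.complete I J) :
    proj Q ξ η ζ (kernelVar h φ ξ η ζ I J hI hJ) G =ᵐ[Q] graphProj Q h φ ξ η ζ G :=
  proj_kernelVar_ae_eq K.ahk K.measurable_kernel K.measurable_fun K.symm hI hJ _ _
    (K.integrable_kernelVar hI hJ) hG (BGraph.le_complete_iff.2
      ⟨subset_padTo (hI ▸ Finset.card_le_card hG.1),
        subset_padTo (hJ ▸ Finset.card_le_card hG.2.1)⟩)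

theorem identDistrib_graphProj_map (K : IsSquareIntegrableKernel Q h φ ξ η ζ) {G : BGraph}
    (hr : G.rows.card ≤ p) (hc : G.cols.card ≤ q) (σ τ : Equiv.Perm ℕ) :
    IdentDistrib (graphProj Q h φ ξ η ζ G) (graphProj Q h φ ξ η ζ (G.map σ τ)) Q Q := by
  refine (identDistrib_proj_kernelVar_map K.ahk K.measurable_kernel K.measurable_fun K.symm
    (card_padTo p G.rows) (card_padTo q G.cols) (K.integrable_kernelVar _ _) G σ τ).trans
    (IdentDistrib.of_ae_eq (K.ahk.measurable_proj _ _).aemeasurable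
      (K.proj_ae_eq_graphProj _ _ (BGraph.le_complete_iff.2 ⟨?_, ?_⟩)))
  · exact Finset.map_subset_map.2 (subset_padTo hr)
  · exact Finset.map_subset_map.2 (subset_padTo hc)

theorem integral_graphProj_sq_map (K : IsSquareIntegrableKernel Q h φ ξ η ζ) {G : BGraph}
    (hr : G.rows.card ≤ p) (hc : G.cols.card ≤ q) (σ τ : Equiv.Perm ℕ) :
    ∫ ω, graphProj Q h φ ξ η ζ (G.map σ τ) ω ^ 2 ∂Q = ∫ ω, graphProj Q h φ ξ η ζ G ω ^ 2 ∂Q :=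
  ((K.identDistrib_graphProj_map hr hc σ τ).comp (measurable_id.pow_const 2)).integral_eq.symm

theorem integral_graphProj_sq_le (K : IsSquareIntegrableKernel Q h φ ξ η ζ) (G : BGraph) :
    ∫ ω, graphProj Q h φ ξ η ζ G ω ^ 2 ∂Q ≤
      ∫ ω, kernelVar h φ ξ η ζ (Finset.range p) (Finset.range q) (Finset.card_range p)
        (Finset.card_range q) ω ^ 2 ∂Q := by
  refine (K.ahk.integral_proj_sq_le (K.memLp_kernelVar _ _) G).trans (le_of_eq ?_)
  exact ((identDistrib_kernelVar K.ahk K.measurable_kernel K.measurable_fun K.symm _ _ _ _).comp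
    (measurable_id.pow_const 2)).integral_eq

theorem ae_eq_zero_iff_integral_sq {f : Ω' → ℝ} (hf : MemLp f 2 Q) :
    f =ᵐ[Q] 0 ↔ ∫ ω, f ω ^ 2 ∂Q = 0 := by
  rw [integral_eq_zero_iff_of_nonneg (fun ω => sq_nonneg _) hf.integrable_sq]
  constructor
  · intro h0
    filter_upwards [h0] with ω hω
    simp [hω]
  · intro h0
    filter_upwards [h0] with ω hω
    simpa using hω

theorem stronglyMeasurable_kernelVar (K : IsSquareIntegrableKernel Q h φ ξ η ζ) {I J : Finset ℕ}
    (hI : I.card = p) (hJ : J.card = q) :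
    StronglyMeasurable[graphSigma ξ η ζ (BGraph.complete I J)] (kernelVar h φ ξ η ζ I J hI hJ) := by
  refine Measurable.stronglyMeasurable (measurable_kernelVar K.measurable_kernel
    K.measurable_fun hI hJ (fun i hi => ?_) (fun j hj => ?_) fun i hi j hj => ?_)
  · refine Measurable.mono (comap_measurable _) ?_ le_rfl
    exact le_sup_of_le_left (le_sup_of_le_left (le_iSup₂_of_le _ hi le_rfl))
  · refine Measurable.mono (comap_measurable _) ?_ le_rfl
    exact le_sup_of_le_left (le_sup_of_le_right (le_iSup₂_of_le _ hj le_rfl))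
  · refine Measurable.mono (comap_measurable _) ?_ le_rfl
    exact le_sup_of_le_right (le_iSup₂_of_le
      (f := fun (ij : ℕ × ℕ) (_ : ij ∈ (BGraph.complete I J).edges) =>
        MeasurableSpace.comap (ζ ij.1 ij.2) inferInstance)
      (i, j) (Finset.mk_mem_product hi hj) le_rfl)

theorem kernelVar_ae_eq_sum (K : IsSquareIntegrableKernel Q h φ ξ η ζ) {I J : Finset ℕ}
    (hI : I.card = p) (hJ : J.card = q) :
    ∀ᵐ ω ∂Q, kernelVar h φ ξ η ζ I J hI hJ ω =
      ∑ G ∈ (BGraph.complete I J).subgraphs, graphProj Q h φ ξ η ζ G ω := by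
  have h1 := sum_subgraphs_proj Q ξ η ζ (kernelVar h φ ξ η ζ I J hI hJ) (BGraph.complete I J)
  rw [condExp_of_stronglyMeasurable (K.ahk.graphSigma_le _) (K.stronglyMeasurable_kernelVar hI hJ)
    (K.integrable_kernelVar hI hJ)] at h1
  have h2 : ∀ᵐ ω ∂Q, ∀ G ∈ (BGraph.complete I J).subgraphs,
      proj Q ξ η ζ (kernelVar h φ ξ η ζ I J hI hJ) G ω = graphProj Q h φ ξ η ζ G ω :=
    (Finset.eventually_all _).2 fun G hG =>
      K.proj_ae_eq_graphProj hI hJ (BGraph.mem_subgraphs.1 hG)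
  filter_upwards [h2] with ω hω
  rw [← Finset.sum_congr rfl hω, ← Finset.sum_apply, h1]

/-- The expansion of the `U`-statistic: the coefficient of `p^G` is the proportion of the pairs
`(I, J)` such that `G ⊆ K_{I,J}`. -/
theorem uStat_ae_eq_sum (K : IsSquareIntegrableKernel Q h φ ξ η ζ) (m n : ℕ) :
    ∀ᵐ ω ∂Q, uStat h m n (ahkMatrix φ ξ η ζ ω) =
      ∑ G ∈ (BGraph.complete (Finset.range m) (Finset.range n)).subgraphs,
        inclProb p m G.rows.card * inclProb q n G.cols.card * graphProj Q h φ ξ η ζ G ω := by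
  classical
  have h1 : ∀ᵐ ω ∂Q, ∀ (I J : Finset ℕ) (hI : I.card = p) (hJ : J.card = q),
      kernelVar h φ ξ η ζ I J hI hJ ω =
        ∑ G ∈ (BGraph.complete I J).subgraphs, graphProj Q h φ ξ η ζ G ω := by
    simp only [ae_all_iff]
    exact fun I J hI hJ => K.kernelVar_ae_eq_sum hI hJ
  filter_upwards [h1] with ω hω
  have h2 : ∀ (I : {I // I ∈ (Finset.range m).powersetCard p})
      (J : {J // J ∈ (Finset.range n).powersetCard q}),
      h (submatrix (ahkMatrix φ ξ η ζ ω) I.1 J.1 (Finset.mem_powersetCard.1 I.2).2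
          (Finset.mem_powersetCard.1 J.2).2) =
        ∑ G ∈ (BGraph.complete (Finset.range m) (Finset.range n)).subgraphs,
          if G.rows ⊆ I.1 ∧ G.cols ⊆ J.1 then graphProj Q h φ ξ η ζ G ω else 0 := by
    intro I J
    have h3 := hω I.1 J.1 (Finset.mem_powersetCard.1 I.2).2 (Finset.mem_powersetCard.1 J.2).2
    refine Eq.trans h3 ?_
    rw [← Finset.sum_filter]
    refine Finset.sum_congr ?_ fun _ _ => rfl
    ext G
    rw [Finset.mem_filter, BGraph.mem_subgraphs, BGraph.mem_subgraphs, BGraph.le_complete_iff,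
      BGraph.le_complete_iff]
    exact ⟨fun hG => ⟨⟨hG.1.trans (Finset.mem_powersetCard.1 I.2).1,
      hG.2.trans (Finset.mem_powersetCard.1 J.2).1⟩, hG⟩, fun hG => hG.2⟩
  have h4 : ∀ G ∈ (BGraph.complete (Finset.range m) (Finset.range n)).subgraphs,
      ∑ I ∈ (Finset.range m).powersetCard p, ∑ J ∈ (Finset.range n).powersetCard q,
        (if G.rows ⊆ I ∧ G.cols ⊆ J then graphProj Q h φ ξ η ζ G ω else 0) =
      (((Finset.range m).powersetCard p).filter fun I => G.rows ⊆ I).card *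
        (((Finset.range n).powersetCard q).filter fun J => G.cols ⊆ J).card *
        graphProj Q h φ ξ η ζ G ω := by
    intro G _
    rw [← Finset.sum_product', ← Finset.sum_filter, Finset.filter_product
      (fun I => G.rows ⊆ I) (fun J => G.cols ⊆ J), Finset.sum_const, Finset.card_product,
      nsmul_eq_mul, Nat.cast_mul]
  rw [uStat]
  simp only [h2]
  have h5 : ∀ f : Finset ℕ → Finset ℕ → ℝ,
      ∑ I : {I // I ∈ (Finset.range m).powersetCard p},
        ∑ J : {J // J ∈ (Finset.range n).powersetCard q}, f I.1 J.1 =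
      ∑ I ∈ (Finset.range m).powersetCard p, ∑ J ∈ (Finset.range n).powersetCard q, f I J := by
    intro f
    rw [← Finset.sum_coe_sort ((Finset.range m).powersetCard p)]
    exact Finset.sum_congr rfl fun I _ =>
      Finset.sum_coe_sort ((Finset.range n).powersetCard q) (f I.1)
  rw [h5 fun I J => ∑ G ∈ (BGraph.complete (Finset.range m) (Finset.range n)).subgraphs,
          if G.rows ⊆ I ∧ G.cols ⊆ J then graphProj Q h φ ξ η ζ G ω else 0]
  have h6 : ∑ I ∈ (Finset.range m).powersetCard p, ∑ J ∈ (Finset.range n).powersetCard q,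
      ∑ G ∈ (BGraph.complete (Finset.range m) (Finset.range n)).subgraphs,
        (if G.rows ⊆ I ∧ G.cols ⊆ J then graphProj Q h φ ξ η ζ G ω else 0) =
      ∑ G ∈ (BGraph.complete (Finset.range m) (Finset.range n)).subgraphs,
        ∑ I ∈ (Finset.range m).powersetCard p, ∑ J ∈ (Finset.range n).powersetCard q,
        (if G.rows ⊆ I ∧ G.cols ⊆ J then graphProj Q h φ ξ η ζ G ω else 0) := by
    exact (Finset.sum_congr rfl fun I _ => Finset.sum_comm).trans Finset.sum_comm
  rw [h6, Finset.sum_congr rfl h4, Finset.mul_sum]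
  refine Finset.sum_congr rfl fun G hG => ?_
  obtain ⟨hr, hc⟩ := BGraph.le_complete_iff.1 (BGraph.mem_subgraphs.1 hG)
  rw [card_filter_superset hr, card_filter_superset hc, inclProb, inclProb]
  split_ifs <;> push_cast <;> ring

/-- The sum of `E[(p^G)²]` over the graphs with node sets `[r]` and `[c]`. -/
noncomputable def spanVar (Q : Measure Ω') (h : (Fin p → Fin q → ℝ) → ℝ) (φ : ℝ × ℝ × ℝ → ℝ)
    (ξ η : ℕ → Ω' → ℝ) (ζ : ℕ → ℕ → Ω' → ℝ) (r c : ℕ) : ℝ :=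
  ∑ G ∈ BGraph.spanning (Finset.range r) (Finset.range c),
    ∫ ω, graphProj Q h φ ξ η ζ G ω ^ 2 ∂Q

theorem spanVar_nonneg (r c : ℕ) : 0 ≤ spanVar Q h φ ξ η ζ r c :=
  Finset.sum_nonneg fun _ _ => integral_nonneg fun _ => sq_nonneg _

theorem sum_levelGraphs_integral_sq (K : IsSquareIntegrableKernel Q h φ ξ η ζ) (m n : ℕ)
    {r c : ℕ} (hr : r ≤ p) (hc : c ≤ q) :
    ∑ G ∈ BGraph.levelGraphs m n r c, ∫ ω, graphProj Q h φ ξ η ζ G ω ^ 2 ∂Q =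
      m.choose r * n.choose c * spanVar Q h φ ξ η ζ r c :=
  BGraph.sum_levelGraphs m n r c _ fun _ h1 h2 σ τ =>
    K.integral_graphProj_sq_map (h1.trans_le hr) (h2.trans_le hc) σ τ

theorem varTerm_eq (K : IsSquareIntegrableKernel Q h φ ξ η ζ) {r c : ℕ} (hr : r ≤ p)
    (hc : c ≤ q) :
    varTerm Q h φ ξ η ζ r c = (p.choose r * q.choose c : ℝ) ^ 2 * r.factorial * c.factorial *
      spanVar Q h φ ξ η ζ r c := by
  have h1 : spanVar Q h φ ξ η ζ r c = r.factorial * c.factorial * ∑ G ∈ BGraph.Gamma r c,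
      (G.autCard : ℝ)⁻¹ * ∫ ω, graphProj Q h φ ξ η ζ G ω ^ 2 ∂Q := by
    refine BGraph.sum_spanning_eq_sum_Gamma r c _ fun G G' h1 h2 hiso => ?_
    obtain ⟨σ, τ, rfl⟩ := hiso.exists_map_eq
    exact (K.integral_graphProj_sq_map (h1.trans_le hr) (h2.trans_le hc) σ τ).symm
  have h2 : ∑ G ∈ BGraph.Gamma r c, (G.autCard : ℝ)⁻¹ *
      ∫ ω, graphProj Q h φ ξ η ζ G ω ^ 2 ∂Q = ∑ G ∈ BGraph.Gamma r c, (G.autCard : ℝ)⁻¹ *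
      ∫ ω, kernelProj Q h φ ξ η ζ G ω ^ 2 ∂Q := by
    refine Finset.sum_congr rfl fun G hG => ?_
    obtain ⟨h3, h4⟩ := BGraph.mem_Gamma_spanning hG
    have h5 : kernelProj Q h φ ξ η ζ G =ᵐ[Q] graphProj Q h φ ξ η ζ G :=
      K.proj_ae_eq_graphProj _ _ (BGraph.le_complete_iff.2
        ⟨h3 ▸ Finset.range_mono hr, h4 ▸ Finset.range_mono hc⟩)
    congr 1
    refine integral_congr_ae ?_
    filter_upwards [h5] with ω hω
    rw [hω]
  rw [varTerm, h1, h2]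
  have f1 := Nat.choose_mul_factorial_mul_factorial hr
  have f2 := Nat.choose_mul_factorial_mul_factorial hc
  have f3 : (p.choose r : ℝ) * r.factorial * (p - r).factorial = p.factorial := by exact_mod_cast f1
  have f4 : (q.choose c : ℝ) * c.factorial * (q - c).factorial = q.factorial := by exact_mod_cast f2
  have n1 : ((p - r).factorial : ℝ) ≠ 0 := by exact_mod_cast (Nat.factorial_pos _).ne'
  have n2 : ((q - c).factorial : ℝ) ≠ 0 := by exact_mod_cast (Nat.factorial_pos _).ne'
  rw [← f3, ← f4]
  field_simp

end IsSquareIntegrableKernel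

end Setting

/-! ### Asymptotics of the variances of the levels -/

section InclProb

theorem inclProb_nonneg (p m r : ℕ) : 0 ≤ inclProb p m r := by
  unfold inclProb
  split_ifs <;> positivity

theorem inclProb_zero {p m : ℕ} (h : p ≤ m) : inclProb p m 0 = 1 := by
  have : (m.choose p : ℝ) ≠ 0 := by exact_mod_cast (Nat.choose_pos h).ne'
  simp [inclProb, this]

theorem inclProb_eq_zero {p m r : ℕ} (h : p < r) : inclProb p m r = 0 :=
  if_neg (by omega)

theorem inclProb_eq_div {p m r : ℕ} (hr : r ≤ p) (hm : p ≤ m) :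
    inclProb p m r = p.choose r / m.choose r := by
  have h1 : (m.choose p : ℝ) ≠ 0 := by exact_mod_cast (Nat.choose_pos hm).ne'
  have h2 : (m.choose r : ℝ) ≠ 0 := by exact_mod_cast (Nat.choose_pos (hr.trans hm)).ne'
  have h3 : (m.choose p : ℝ) * p.choose r = m.choose r * (m - r).choose (p - r) := by
    exact_mod_cast Nat.choose_mul hr
  rw [inclProb, if_pos hr, inv_mul_eq_div, div_eq_div_iff h1 h2]
  linarith

theorem tendsto_atTop_of_div {m : ℕ → ℕ} {ρ : ℝ} (hρ : 0 < ρ)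
    (h : Tendsto (fun N => (m N : ℝ) / (N : ℝ)) atTop (𝓝 ρ)) : Tendsto m atTop atTop := by
  have h1 := h.pos_mul_atTop hρ tendsto_natCast_atTop_atTop
  refine tendsto_natCast_atTop_iff.1 (h1.congr' ?_)
  filter_upwards [eventually_gt_atTop 0] with N hN
  have : (N : ℝ) ≠ 0 := by exact_mod_cast hN.ne'
  field_simp

theorem tendsto_choose_div_pow {m : ℕ → ℕ} {ρ : ℝ} (hρ : 0 < ρ)
    (h : Tendsto (fun N => (m N : ℝ) / (N : ℝ)) atTop (𝓝 ρ)) (r : ℕ) :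
    Tendsto (fun N => ((m N).choose r : ℝ) / (N : ℝ) ^ r) atTop (𝓝 (ρ ^ r / r.factorial)) := by
  have hm := tendsto_atTop_of_div hρ h
  have h1 : Tendsto (fun k : ℕ => (k.choose r : ℝ) / ((k : ℝ) ^ r / r.factorial)) atTop (𝓝 1) := by
    refine (Asymptotics.isEquivalent_iff_tendsto_one ?_).1 (isEquivalent_choose r)
    filter_upwards [eventually_gt_atTop 0] with k hk
    have : (k : ℝ) ≠ 0 := by exact_mod_cast hk.ne'
    positivity
  have h2 := (h1.comp hm).mul ((h.pow r).div_const (r.factorial : ℝ))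
  rw [one_mul] at h2
  refine h2.congr' ?_
  filter_upwards [hm.eventually_gt_atTop 0, eventually_gt_atTop 0] with N hN hN'
  have : (m N : ℝ) ≠ 0 := by exact_mod_cast hN.ne'
  have : (N : ℝ) ≠ 0 := by exact_mod_cast hN'.ne'
  simp only [Function.comp_apply, div_pow]
  field_simp

theorem tendsto_pow_mul_inclProb {m : ℕ → ℕ} {ρ : ℝ} (hρ : 0 < ρ)
    (h : Tendsto (fun N => (m N : ℝ) / (N : ℝ)) atTop (𝓝 ρ)) (p r : ℕ) :
    Tendsto (fun N : ℕ => (N : ℝ) ^ r * inclProb p (m N) r) atTop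
      (𝓝 (p.choose r * (r.factorial / ρ ^ r))) := by
  rcases le_or_gt r p with hr | hr
  · have h1 := ((tendsto_choose_div_pow hρ h r).inv₀ (by positivity)).const_mul (p.choose r : ℝ)
    rw [inv_div] at h1
    refine h1.congr' ?_
    filter_upwards [(tendsto_atTop_of_div hρ h).eventually_ge_atTop p] with N hN
    rw [inclProb_eq_div hr hN, inv_div]
    ring
  · simp [inclProb_eq_zero hr, Nat.choose_eq_zero_of_lt hr]

theorem tendsto_pow_mul_inclProb_sq {m : ℕ → ℕ} {ρ : ℝ} (hρ : 0 < ρ)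
    (h : Tendsto (fun N => (m N : ℝ) / (N : ℝ)) atTop (𝓝 ρ)) (p r : ℕ) :
    Tendsto (fun N : ℕ => (N : ℝ) ^ r * (inclProb p (m N) r ^ 2 * (m N).choose r)) atTop
      (𝓝 ((p.choose r : ℝ) ^ 2 * (r.factorial / ρ ^ r))) := by
  have h1 := ((tendsto_pow_mul_inclProb hρ h p r).pow 2).mul (tendsto_choose_div_pow hρ h r)
  have h2 : ((p.choose r : ℝ) * (r.factorial / ρ ^ r)) ^ 2 * (ρ ^ r / r.factorial) =
      (p.choose r : ℝ) ^ 2 * (r.factorial / ρ ^ r) := by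
    have : (r.factorial : ℝ) ≠ 0 := by exact_mod_cast (Nat.factorial_pos r).ne'
    field_simp
  rw [h2] at h1
  refine h1.congr' ?_
  filter_upwards [eventually_gt_atTop 0] with N hN
  have : (N : ℝ) ≠ 0 := by exact_mod_cast hN.ne'
  field_simp

end InclProb

theorem exists_eventually_le_of_tendsto {u : ℕ → ℝ} {L : ℝ} (hu : Tendsto u atTop (𝓝 L)) :
    ∃ C, 0 ≤ C ∧ ∀ᶠ N in atTop, u N ≤ C :=
  ⟨max (L + 1) 0, le_max_right _ _, (hu.eventually_lt_const (lt_add_one L)).mono fun _ hN =>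
    hN.le.trans (le_max_left _ _)⟩

section Levels

variable {Ω' : Type*} [MeasurableSpace Ω'] {Q : Measure Ω'} [IsProbabilityMeasure Q]
  {ξ η : ℕ → Ω' → ℝ} {ζ : ℕ → ℕ → Ω' → ℝ} {p q : ℕ} {h h' : (Fin p → Fin q → ℝ) → ℝ}
  {φ : ℝ × ℝ × ℝ → ℝ}

/-- The proportion of the pairs `(I, J)` with `I ∈ P_p([m])` and `J ∈ P_q([n])` such that
`G ⊆ K_{I,J}`, for a graph `G ⊆ K_{m,n}`. -/
noncomputable def graphCoeff (p q m n : ℕ) (G : BGraph) : ℝ :=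
  inclProb p m G.rows.card * inclProb q n G.cols.card

theorem graphCoeff_nonneg (p q m n : ℕ) (G : BGraph) : 0 ≤ graphCoeff p q m n G :=
  mul_nonneg (inclProb_nonneg _ _ _) (inclProb_nonneg _ _ _)

/-- The variance of the part of `U_{m,n}` that is carried by the graphs with `k` nodes. -/
noncomputable def levelVar (Q : Measure Ω') (h : (Fin p → Fin q → ℝ) → ℝ) (φ : ℝ × ℝ × ℝ → ℝ)
    (ξ η : ℕ → Ω' → ℝ) (ζ : ℕ → ℕ → Ω' → ℝ) (m n k : ℕ) : ℝ :=
  ∑ G ∈ (BGraph.complete (Finset.range m) (Finset.range n)).subgraphs with G.numNodes = k,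
    graphCoeff p q m n G ^ 2 * ∫ ω, graphProj Q h φ ξ η ζ G ω ^ 2 ∂Q

theorem sum_numNodes_eq (m n k : ℕ) (f : BGraph → ℝ) :
    ∑ G ∈ (BGraph.complete (Finset.range m) (Finset.range n)).subgraphs with G.numNodes = k, f G =
      ∑ rc ∈ Finset.HasAntidiagonal.antidiagonal k,
        ∑ G ∈ BGraph.levelGraphs m n rc.1 rc.2, f G := by
  classical
  rw [← Finset.sum_fiberwise_of_maps_to (t := Finset.HasAntidiagonal.antidiagonal k)
    (g := fun G : BGraph => (G.rows.card, G.cols.card))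
    (s := {G ∈ (BGraph.complete (Finset.range m) (Finset.range n)).subgraphs | G.numNodes = k})
    (fun G hG => Finset.HasAntidiagonal.mem_antidiagonal.2 (Finset.mem_filter.1 hG).2)]
  refine Finset.sum_congr rfl fun rc hrc => Finset.sum_congr ?_ fun _ _ => rfl
  have hrc' := Finset.HasAntidiagonal.mem_antidiagonal.1 hrc
  ext G
  rw [Finset.mem_filter, Finset.mem_filter, BGraph.levelGraphs, Finset.mem_filter]
  constructor
  · rintro ⟨⟨h1, -⟩, rfl⟩
    exact ⟨h1, rfl, rfl⟩
  · rintro ⟨h1, h2, h3⟩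
    exact ⟨⟨h1, by rw [BGraph.numNodes, h2, h3, hrc']⟩, Prod.ext h2 h3⟩

namespace IsSquareIntegrableKernel

theorem levelVar_eq (K : IsSquareIntegrableKernel Q h φ ξ η ζ) (m n k : ℕ) :
    levelVar Q h φ ξ η ζ m n k = ∑ rc ∈ Finset.HasAntidiagonal.antidiagonal k,
      (inclProb p m rc.1 ^ 2 * m.choose rc.1) * (inclProb q n rc.2 ^ 2 * n.choose rc.2) *
        spanVar Q h φ ξ η ζ rc.1 rc.2 := by
  rw [levelVar, sum_numNodes_eq]
  refine Finset.sum_congr rfl fun rc _ => ?_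
  have h1 : ∀ G ∈ BGraph.levelGraphs m n rc.1 rc.2,
      graphCoeff p q m n G ^ 2 * ∫ ω, graphProj Q h φ ξ η ζ G ω ^ 2 ∂Q =
        (inclProb p m rc.1 * inclProb q n rc.2) ^ 2 *
          ∫ ω, graphProj Q h φ ξ η ζ G ω ^ 2 ∂Q := by
    intro G hG
    rw [graphCoeff, (BGraph.mem_levelGraphs.1 hG).2.1, (BGraph.mem_levelGraphs.1 hG).2.2]
  rw [Finset.sum_congr rfl h1, ← Finset.mul_sum]
  rcases le_or_gt rc.1 p with hr | hr
  · rcases le_or_gt rc.2 q with hc | hc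
    · rw [K.sum_levelGraphs_integral_sq m n hr hc]
      ring
    · simp [inclProb_eq_zero hc]
  · simp [inclProb_eq_zero hr]

/-- The limit of `N^k` times the variance of the `k`-th level. -/
theorem tendsto_levelVar (K : IsSquareIntegrableKernel Q h φ ξ η ζ) {m n : ℕ → ℕ} {ρ ρ' : ℝ}
    (hρ : 0 < ρ) (hρ' : 0 < ρ') (hm : Tendsto (fun N => (m N : ℝ) / (N : ℝ)) atTop (𝓝 ρ))
    (hn : Tendsto (fun N => (n N : ℝ) / (N : ℝ)) atTop (𝓝 ρ')) (k : ℕ) :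
    Tendsto (fun N : ℕ => (N : ℝ) ^ k * levelVar Q h φ ξ η ζ (m N) (n N) k) atTop
      (𝓝 (∑ rc ∈ Finset.HasAntidiagonal.antidiagonal k,
        ((p.choose rc.1 : ℝ) ^ 2 * (rc.1.factorial / ρ ^ rc.1)) *
        ((q.choose rc.2 : ℝ) ^ 2 * (rc.2.factorial / ρ' ^ rc.2)) *
          spanVar Q h φ ξ η ζ rc.1 rc.2)) := by
  have h1 : ∀ N : ℕ, (N : ℝ) ^ k * levelVar Q h φ ξ η ζ (m N) (n N) k =
      ∑ rc ∈ Finset.HasAntidiagonal.antidiagonal k,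
        ((N : ℝ) ^ rc.1 * (inclProb p (m N) rc.1 ^ 2 * (m N).choose rc.1)) *
        ((N : ℝ) ^ rc.2 * (inclProb q (n N) rc.2 ^ 2 * (n N).choose rc.2)) *
        spanVar Q h φ ξ η ζ rc.1 rc.2 := by
    intro N
    rw [K.levelVar_eq, Finset.mul_sum]
    refine Finset.sum_congr rfl fun rc hrc => ?_
    rw [← Finset.HasAntidiagonal.mem_antidiagonal.1 hrc, pow_add]
    ring
  simp only [h1]
  exact tendsto_finsetSum _ fun rc _ => ((tendsto_pow_mul_inclProb_sq hρ hm p rc.1).mul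
    (tendsto_pow_mul_inclProb_sq hρ' hn q rc.2)).mul_const _

theorem limitVariance_eq (K : IsSquareIntegrableKernel Q h φ ξ η ζ) {d : ℕ} (hd : 1 ≤ d) (ρ : ℝ) :
    limitVariance Q h φ ξ η ζ d ρ = ∑ rc ∈ Finset.HasAntidiagonal.antidiagonal d,
      ((p.choose rc.1 : ℝ) ^ 2 * (rc.1.factorial / ρ ^ rc.1)) *
        ((q.choose rc.2 : ℝ) ^ 2 * (rc.2.factorial / (1 - ρ) ^ rc.2)) *
          spanVar Q h φ ξ η ζ rc.1 rc.2 := by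
  rw [limitVariance, ← Finset.sum_subset (s₁ := {rc ∈ Finset.range (p + 1) ×ˢ Finset.range (q + 1) |
    rc ≠ (0, 0) ∧ rc.1 + rc.2 = d}) (s₂ := Finset.HasAntidiagonal.antidiagonal d)]
  · refine Finset.sum_congr rfl fun rc hrc => ?_
    rw [Finset.mem_filter, Finset.mem_product, Finset.mem_range, Finset.mem_range] at hrc
    rw [K.varTerm_eq (by omega) (by omega)]
    ring
  · intro rc hrc
    exact Finset.HasAntidiagonal.mem_antidiagonal.2 (Finset.mem_filter.1 hrc).2.2
  · intro rc hrc hn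
    have h1 := Finset.HasAntidiagonal.mem_antidiagonal.1 hrc
    have h2 : ¬ (rc.1 ≤ p ∧ rc.2 ≤ q) := by
      rintro ⟨hr, hc⟩
      refine hn (Finset.mem_filter.2 ⟨Finset.mem_product.2 ⟨Finset.mem_range.2 (by omega),
        Finset.mem_range.2 (by omega)⟩, ?_, h1⟩)
      rintro rfl
      simp at h1
      omega
    rcases not_and_or.1 h2 with h3 | h3
    · rw [Nat.choose_eq_zero_of_lt (by omega : p < rc.1)]
      simp
    · rw [Nat.choose_eq_zero_of_lt (by omega : q < rc.2)]
      simp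

theorem spanVar_le (K : IsSquareIntegrableKernel Q h φ ξ η ζ) (r c : ℕ) :
    spanVar Q h φ ξ η ζ r c ≤
      (BGraph.spanning (Finset.range r) (Finset.range c)).card *
        ∫ ω, kernelVar h φ ξ η ζ (Finset.range p) (Finset.range q) (Finset.card_range p)
          (Finset.card_range q) ω ^ 2 ∂Q := by
  rw [spanVar, ← nsmul_eq_mul]
  exact Finset.sum_le_card_nsmul _ _ _ fun G _ => K.integral_graphProj_sq_le G

end IsSquareIntegrableKernel

/-- Uniformly in the kernel, the variances of the `k`-th level are of order `N^{-k}`. -/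
theorem exists_levelVar_le {m n : ℕ → ℕ} {ρ ρ' : ℝ}
    (hρ : 0 < ρ) (hρ' : 0 < ρ') (hm : Tendsto (fun N => (m N : ℝ) / (N : ℝ)) atTop (𝓝 ρ))
    (hn : Tendsto (fun N => (n N : ℝ) / (N : ℝ)) atTop (𝓝 ρ')) (p q k : ℕ) :
    ∃ C : ℝ, 0 ≤ C ∧ ∀ᶠ N : ℕ in atTop, ∀ {h : (Fin p → Fin q → ℝ) → ℝ},
      IsSquareIntegrableKernel Q h φ ξ η ζ →
        (N : ℝ) ^ k * levelVar Q h φ ξ η ζ (m N) (n N) k ≤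
          C * ∫ ω, kernelVar h φ ξ η ζ (Finset.range p) (Finset.range q) (Finset.card_range p)
            (Finset.card_range q) ω ^ 2 ∂Q := by
  set D : ℕ → ℝ := fun N => ∑ rc ∈ Finset.HasAntidiagonal.antidiagonal k,
        ((N : ℝ) ^ rc.1 * (inclProb p (m N) rc.1 ^ 2 * (m N).choose rc.1)) *
        ((N : ℝ) ^ rc.2 * (inclProb q (n N) rc.2 ^ 2 * (n N).choose rc.2)) *
        (BGraph.spanning (Finset.range rc.1) (Finset.range rc.2)).card with hD
  have h1 : Tendsto D atTop (𝓝 _) :=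
    tendsto_finsetSum _ fun rc _ => ((tendsto_pow_mul_inclProb_sq hρ hm p rc.1).mul
      (tendsto_pow_mul_inclProb_sq hρ' hn q rc.2)).mul_const _
  obtain ⟨C, hC0, hC⟩ := exists_eventually_le_of_tendsto h1
  refine ⟨C, hC0, hC.mono fun N hN h K => ?_⟩
  refine le_trans ?_ (mul_le_mul_of_nonneg_right hN (integral_nonneg fun ω => sq_nonneg _))
  rw [K.levelVar_eq, Finset.mul_sum, hD, Finset.sum_mul]
  refine Finset.sum_le_sum fun rc hrc => ?_
  rw [mul_assoc _ _ (∫ ω, _ ∂Q), ← Finset.HasAntidiagonal.mem_antidiagonal.1 hrc, pow_add]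
  refine le_trans (le_of_eq ?_) (mul_le_mul_of_nonneg_left (K.spanVar_le rc.1 rc.2)
    (by positivity))
  ring

/-- The coefficients of the graphs with `k` nodes are of order `N^{-k}`. -/
theorem exists_graphCoeff_le {m n : ℕ → ℕ} {ρ ρ' : ℝ}
    (hρ : 0 < ρ) (hρ' : 0 < ρ') (hm : Tendsto (fun N => (m N : ℝ) / (N : ℝ)) atTop (𝓝 ρ))
    (hn : Tendsto (fun N => (n N : ℝ) / (N : ℝ)) atTop (𝓝 ρ')) (p q k : ℕ) :
    ∃ C : ℝ, 0 ≤ C ∧ ∀ᶠ N : ℕ in atTop, ∀ G : BGraph, G.numNodes = k →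
      (N : ℝ) ^ k * graphCoeff p q (m N) (n N) G ≤ C := by
  have h1 : Tendsto (fun N : ℕ => ∑ rc ∈ Finset.HasAntidiagonal.antidiagonal k,
      ((N : ℝ) ^ rc.1 * inclProb p (m N) rc.1) * ((N : ℝ) ^ rc.2 * inclProb q (n N) rc.2)) atTop
      (𝓝 _) :=
    tendsto_finsetSum _ fun rc _ => (tendsto_pow_mul_inclProb hρ hm p rc.1).mul
      (tendsto_pow_mul_inclProb hρ' hn q rc.2)
  obtain ⟨C, hC0, hC⟩ := exists_eventually_le_of_tendsto h1
  refine ⟨C, hC0, hC.mono fun N hN G hG => le_trans ?_ hN⟩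
  · refine le_trans (le_of_eq ?_) (Finset.single_le_sum (f := fun rc : ℕ × ℕ =>
      ((N : ℝ) ^ rc.1 * inclProb p (m N) rc.1) * ((N : ℝ) ^ rc.2 * inclProb q (n N) rc.2))
      (fun rc _ => ?_) (Finset.HasAntidiagonal.mem_antidiagonal.2 hG :
        (G.rows.card, G.cols.card) ∈ Finset.HasAntidiagonal.antidiagonal k))
    · rw [graphCoeff, ← hG, BGraph.numNodes, pow_add]
      ring
    · have := inclProb_nonneg p (m N) rc.1
      have := inclProb_nonneg q (n N) rc.2
      positivity

end Levels

/-! ### Approximation in `L²` and characteristic functions -/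

section L2

variable {Ω : Type*} [MeasurableSpace Ω] {Q : Measure Ω}

theorem sq_integral_mul_le {f g : Ω → ℝ} (hf : MemLp f 2 Q) (hg : MemLp g 2 Q) :
    (∫ ω, f ω * g ω ∂Q) ^ 2 ≤ (∫ ω, f ω ^ 2 ∂Q) * ∫ ω, g ω ^ 2 ∂Q := by
  have h1 : ∀ s : ℝ, 0 ≤ (∫ ω, f ω ^ 2 ∂Q) * (s * s) + (2 * ∫ ω, f ω * g ω ∂Q) * s +
      ∫ ω, g ω ^ 2 ∂Q := by
    intro s
    have h2 : ∫ ω, (s * f ω + g ω) ^ 2 ∂Q = (∫ ω, f ω ^ 2 ∂Q) * (s * s) +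
        (2 * ∫ ω, f ω * g ω ∂Q) * s + ∫ ω, g ω ^ 2 ∂Q := by
      have e : ∀ ω, (s * f ω + g ω) ^ 2 = (s * s) * f ω ^ 2 + (2 * s) * (f ω * g ω) + g ω ^ 2 :=
        fun ω => by ring
      have hfg : Integrable (fun ω => f ω * g ω) Q := hf.integrable_mul hg
      have i1 : Integrable (fun ω => (s * s) * f ω ^ 2) Q := hf.integrable_sq.const_mul _
      have i2 : Integrable (fun ω => (2 * s) * (f ω * g ω)) Q := hfg.const_mul _
      have i3 : Integrable (fun ω => (s * s) * f ω ^ 2 + (2 * s) * (f ω * g ω)) Q := i1.add i2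
      simp only [e]
      rw [integral_add i3 hg.integrable_sq, integral_add i1 i2, integral_const_mul,
        integral_const_mul]
      ring
    rw [← h2]
    exact integral_nonneg fun ω => sq_nonneg _
  have h3 := discrim_le_zero h1
  rw [discrim] at h3
  linarith

variable [IsProbabilityMeasure Q]

theorem integral_abs_le_sqrt {f : Ω → ℝ} (hf : MemLp f 2 Q) :
    ∫ ω, |f ω| ∂Q ≤ √(∫ ω, f ω ^ 2 ∂Q) := by
  refine Real.le_sqrt_of_sq_le ?_
  have := sq_integral_mul_le hf.abs (memLp_const (μ := Q) (p := 2) (1 : ℝ))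
  simpa using this

theorem norm_integral_cexp_sub_le {f g : Ω → ℝ} (hf : MemLp f 2 Q) (hg : MemLp g 2 Q) (t : ℝ) :
    ‖(∫ ω, Complex.exp ((t * f ω : ℝ) * Complex.I) ∂Q) -
      ∫ ω, Complex.exp ((t * g ω : ℝ) * Complex.I) ∂Q‖ ≤
      |t| * √(∫ ω, (f ω - g ω) ^ 2 ∂Q) := by
  have hi : ∀ {f : Ω → ℝ}, MemLp f 2 Q →
      Integrable (fun ω => Complex.exp ((t * f ω : ℝ) * Complex.I)) Q := by
    intro f hf
    refine Integrable.of_bound ?_ 1 (ae_of_all _ fun ω => by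
      rw [Complex.norm_exp_ofReal_mul_I])
    exact (by fun_prop : Continuous fun x : ℝ =>
      Complex.exp ((t * x : ℝ) * Complex.I)).comp_aestronglyMeasurable hf.aestronglyMeasurable
  rw [← integral_sub (hi hf) (hi hg)]
  refine (norm_integral_le_integral_norm _).trans ?_
  have h1 : ∫ ω, ‖Complex.exp ((t * f ω : ℝ) * Complex.I) -
      Complex.exp ((t * g ω : ℝ) * Complex.I)‖ ∂Q ≤ ∫ ω, |t| * |f ω - g ω| ∂Q := by
    refine integral_mono ((hi hf).sub (hi hg)).norm
      (((hf.sub hg).integrable one_le_two).abs.const_mul _) fun ω => ?_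
    refine (norm_cexp_ofReal_mul_I_sub_le _ _).trans (le_of_eq ?_)
    rw [← mul_sub, abs_mul]
  refine h1.trans ?_
  rw [integral_const_mul]
  exact mul_le_mul_of_nonneg_left (integral_abs_le_sqrt (hf.sub hg)) (abs_nonneg t)

theorem tendsto_integral_sq_of_tendsto_sub {f g : ℕ → Ω → ℝ} (hf : ∀ N, MemLp (f N) 2 Q)
    (hg : ∀ N, MemLp (g N) 2 Q) {s : ℝ}
    (hs : Tendsto (fun N => ∫ ω, f N ω ^ 2 ∂Q) atTop (𝓝 s))
    (h0 : Tendsto (fun N => ∫ ω, (f N ω - g N ω) ^ 2 ∂Q) atTop (𝓝 0)) :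
    Tendsto (fun N => ∫ ω, g N ω ^ 2 ∂Q) atTop (𝓝 s) := by
  have h1 : Tendsto (fun N => ∫ ω, f N ω * (f N ω - g N ω) ∂Q) atTop (𝓝 0) := by
    have h2 := (hs.mul h0).sqrt
    rw [mul_zero, Real.sqrt_zero] at h2
    refine squeeze_zero_norm (fun N => ?_) h2
    exact Real.abs_le_sqrt (sq_integral_mul_le (hf N) ((hf N).sub (hg N)))
  have h3 : ∀ N, ∫ ω, g N ω ^ 2 ∂Q = ∫ ω, f N ω ^ 2 ∂Q - 2 * ∫ ω, f N ω * (f N ω - g N ω) ∂Q +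
      ∫ ω, (f N ω - g N ω) ^ 2 ∂Q := by
    intro N
    have e : ∀ ω, g N ω ^ 2 = f N ω ^ 2 - 2 * (f N ω * (f N ω - g N ω)) + (f N ω - g N ω) ^ 2 :=
      fun ω => by ring
    have i1 := (hf N).integrable_sq
    have i2 : Integrable (fun ω => 2 * (f N ω * (f N ω - g N ω))) Q :=
      ((hf N).integrable_mul ((hf N).sub (hg N))).const_mul _
    have i3 : Integrable (fun ω => (f N ω - g N ω) ^ 2) Q := ((hf N).sub (hg N)).integrable_sq
    have i4 : Integrable (fun ω => f N ω ^ 2 - 2 * (f N ω * (f N ω - g N ω))) Q := i1.sub i2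
    rw [← integral_const_mul, ← integral_sub i1 i2, ← integral_add i4 i3]
    exact integral_congr_ae (ae_of_all _ e)
  simp only [h3]
  simpa using (hs.sub (h1.const_mul 2)).add h0

end L2

/-! ### Reduction to the connected graphs of the principal level -/

section Reduction

variable {Ω' : Type*} [MeasurableSpace Ω'] {Q : Measure Ω'} [IsProbabilityMeasure Q]
  {ξ η : ℕ → Ω' → ℝ} {ζ : ℕ → ℕ → Ω' → ℝ} {p q : ℕ} {h h' : (Fin p → Fin q → ℝ) → ℝ}
  {φ : ℝ × ℝ × ℝ → ℝ}

open Classical in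
/-- The connected subgraphs of `K_{m,n}` with `d` nodes. -/
noncomputable def connGraphs (m n d : ℕ) : Finset BGraph :=
  {G ∈ (BGraph.complete (Finset.range m) (Finset.range n)).subgraphs |
    G.numNodes = d ∧ G.Connected}

open Classical in
theorem mem_connGraphs {m n d : ℕ} {G : BGraph} : G ∈ connGraphs m n d ↔
    G ≤ BGraph.complete (Finset.range m) (Finset.range n) ∧ G.numNodes = d ∧ G.Connected := by
  rw [connGraphs, Finset.mem_filter, BGraph.mem_subgraphs]

/-- The part of `U_{m,n}` that is carried by the connected graphs with `d` nodes. -/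
noncomputable def connSum (Q : Measure Ω') (h : (Fin p → Fin q → ℝ) → ℝ) (φ : ℝ × ℝ × ℝ → ℝ)
    (ξ η : ℕ → Ω' → ℝ) (ζ : ℕ → ℕ → Ω' → ℝ) (m n d : ℕ) (ω : Ω') : ℝ :=
  ∑ G ∈ connGraphs m n d, graphCoeff p q m n G * graphProj Q h φ ξ η ζ G ω

theorem graphCoeff_eq_zero {m n : ℕ} {G : BGraph} (hG : ¬ (G.rows.card ≤ p ∧ G.cols.card ≤ q)) :
    graphCoeff p q m n G = 0 := by
  rw [graphCoeff]
  rcases not_and_or.1 hG with h | h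
  · rw [inclProb_eq_zero (by omega), zero_mul]
  · rw [inclProb_eq_zero (by omega : q < _), mul_zero]

namespace IsSquareIntegrableKernel

theorem memLp_connSum (K : IsSquareIntegrableKernel Q h φ ξ η ζ) (m n d : ℕ) :
    MemLp (connSum Q h φ ξ η ζ m n d) 2 Q :=
  K.memLp_sum_graphProj _ _

/-- A level vanishes only if all its projections do, by orthogonality. -/
theorem integral_graphProj_sq_eq_zero_of_levelProj (K : IsSquareIntegrableKernel Q h φ ξ η ζ)
    {G : BGraph} (hr : G.rows.card ≤ p) (hc : G.cols.card ≤ q)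
    (h0 : levelProj Q h φ ξ η ζ G.numNodes =ᵐ[Q] 0) :
    ∫ ω, graphProj Q h φ ξ η ζ G ω ^ 2 ∂Q = 0 := by
  set S : Finset BGraph := {F ∈ (BGraph.complete (Finset.range p) (Finset.range q)).subgraphs |
    F.numNodes = G.numNodes} with hS
  have h1 : ∀ᵐ ω ∂Q, ∑ F ∈ S, (1 : ℝ) * graphProj Q h φ ξ η ζ F ω = 0 := by
    have h2 : ∀ᵐ ω ∂Q, ∀ F ∈ S, kernelProj Q h φ ξ η ζ F ω = graphProj Q h φ ξ η ζ F ω :=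
      (Finset.eventually_all _).2 fun F hF =>
        K.proj_ae_eq_graphProj _ _ (BGraph.mem_subgraphs.1 (Finset.mem_filter.1 hF).1)
    filter_upwards [h0, h2] with ω hω hω2
    rw [levelProj, Finset.sum_apply] at hω
    simp only [one_mul]
    rw [← Finset.sum_congr rfl hω2]
    exact hω
  have h3 := K.integral_sum_graphProj_sq S fun _ => 1
  have h4 : ∫ ω, (∑ F ∈ S, (1 : ℝ) * graphProj Q h φ ξ η ζ F ω) ^ 2 ∂Q = 0 := by
    rw [integral_congr_ae (g := fun _ => (0 : ℝ))]
    · simp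
    · filter_upwards [h1] with ω hω
      rw [hω]
      simp
  rw [h4] at h3
  have h5 := (Finset.sum_eq_zero_iff_of_nonneg fun F _ =>
    mul_nonneg (sq_nonneg (1 : ℝ)) (integral_nonneg fun ω => sq_nonneg _)).1 h3.symm
  obtain ⟨σ, -, hσ⟩ := exists_perm_fix_map (Finset.empty_subset G.rows)
    (Finset.empty_subset (Finset.range G.rows.card)) (by simp)
  obtain ⟨τ, -, hτ⟩ := exists_perm_fix_map (Finset.empty_subset G.cols)
    (Finset.empty_subset (Finset.range G.cols.card)) (by simp)
  have h6 := h5 (G.map σ τ) (Finset.mem_filter.2 ⟨BGraph.mem_subgraphs.2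
    (BGraph.le_complete_iff.2 ⟨?_, ?_⟩), ?_⟩)
  · rw [K.integral_graphProj_sq_map hr hc] at h6
    simpa using h6
  · change G.rows.map σ.toEmbedding ⊆ _
    rw [hσ]
    exact Finset.range_mono hr
  · change G.cols.map τ.toEmbedding ⊆ _
    rw [hτ]
    exact Finset.range_mono hc
  · simp [BGraph.numNodes, BGraph.map]

/-- In `U_{m,n}`, a graph with at most `d` nodes contributes to the variance only if it is
connected and has exactly `d` nodes. -/
theorem graphCoeff_mul_integral_sq_eq_zero (K : IsSquareIntegrableKernel Q h φ ξ η ζ) {m n d : ℕ}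
    (hd : IsPrincipalDegree Q h φ ξ η ζ d)
    (hconn : ∀ G, IsPrincipalSupportGraph Q h φ ξ η ζ d m n G → G.Connected)
    (hpm : p ≤ m) (hqn : q ≤ n) {G : BGraph}
    (hG : G ≤ BGraph.complete (Finset.range m) (Finset.range n)) (h1 : 1 ≤ G.numNodes)
    (hGd : G.numNodes ≤ d) (hGc : ¬ (G.numNodes = d ∧ G.Connected)) :
    graphCoeff p q m n G ^ 2 * ∫ ω, graphProj Q h φ ξ η ζ G ω ^ 2 ∂Q = 0 := by
  by_cases hfit : G.rows.card ≤ p ∧ G.cols.card ≤ q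
  swap
  · rw [graphCoeff_eq_zero hfit]
    simp
  refine mul_eq_zero_of_right _ ?_
  rcases hGd.lt_or_eq with hlt | heq
  · refine K.integral_graphProj_sq_eq_zero_of_levelProj hfit.1 hfit.2 ?_
    by_contra hne
    refine absurd (hd.2 ⟨h1, ?_, hne⟩) (by omega)
    rw [BGraph.numNodes]
    omega
  · by_contra hne
    refine hGc ⟨heq, hconn G ⟨heq, ?_⟩⟩
    obtain ⟨hr, hc⟩ := BGraph.le_complete_iff.1 hG
    obtain ⟨I, hI1, hI2, hI⟩ := Finset.exists_subsuperset_card_eq hr hfit.1 (by simpa using hpm)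
    obtain ⟨J, hJ1, hJ2, hJ⟩ := Finset.exists_subsuperset_card_eq hc hfit.2 (by simpa using hqn)
    have hGIJ : G ≤ BGraph.complete I J := BGraph.le_complete_iff.2 ⟨hI1, hJ1⟩
    refine ⟨I, J, hI, hJ, hI2, hJ2, hGIJ, fun h0 => hne ?_⟩
    exact (ae_eq_zero_iff_integral_sq (K.memLp_graphProj G)).1
      ((K.proj_ae_eq_graphProj hI hJ hGIJ).symm.trans h0)

theorem graphProj_empty (K : IsSquareIntegrableKernel Q h φ ξ η ζ) (ω : Ω') :
    graphProj Q h φ ξ η ζ BGraph.empty ω =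
      ∫ ω, kernelVar h φ ξ η ζ (Finset.range p) (Finset.range q) (Finset.card_range p)
        (Finset.card_range q) ω ∂Q := by
  rw [graphProj, proj_empty]
  exact (identDistrib_kernelVar K.ahk K.measurable_kernel K.measurable_fun K.symm
    _ _ _ _).integral_eq

/-- The variance of the connected part of the principal level. -/
theorem integral_connSum_sq (K : IsSquareIntegrableKernel Q h φ ξ η ζ) {m n d : ℕ}
    (hd : IsPrincipalDegree Q h φ ξ η ζ d)
    (hconn : ∀ G, IsPrincipalSupportGraph Q h φ ξ η ζ d m n G → G.Connected)
    (hpm : p ≤ m) (hqn : q ≤ n) :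
    ∫ ω, connSum Q h φ ξ η ζ m n d ω ^ 2 ∂Q = levelVar Q h φ ξ η ζ m n d := by
  have h0 := K.integral_sum_graphProj_sq (connGraphs m n d) (graphCoeff p q m n)
  refine h0.trans ?_
  rw [levelVar]
  refine Finset.sum_subset (fun G hG => ?_) fun G hG hG' => ?_
  · obtain ⟨h1, h2, -⟩ := mem_connGraphs.1 hG
    exact Finset.mem_filter.2 ⟨BGraph.mem_subgraphs.2 h1, h2⟩
  · obtain ⟨h1, h2⟩ := Finset.mem_filter.1 hG
    have h3 := BGraph.mem_subgraphs.1 h1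
    exact K.graphCoeff_mul_integral_sq_eq_zero hd hconn hpm hqn h3 (h2 ▸ hd.1.1) h2.le
      fun h4 => hG' (mem_connGraphs.2 ⟨h3, h4⟩)

theorem integral_connSum_sq_le (K : IsSquareIntegrableKernel Q h φ ξ η ζ) (m n d : ℕ) :
    ∫ ω, connSum Q h φ ξ η ζ m n d ω ^ 2 ∂Q ≤ levelVar Q h φ ξ η ζ m n d := by
  have h0 := K.integral_sum_graphProj_sq (connGraphs m n d) (graphCoeff p q m n)
  refine h0.le.trans ?_
  rw [levelVar]
  refine Finset.sum_le_sum_of_subset_of_nonneg (fun G hG => ?_) fun G _ _ =>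
    mul_nonneg (sq_nonneg _) (integral_nonneg fun ω => sq_nonneg _)
  obtain ⟨h1, h2, -⟩ := mem_connGraphs.1 hG
  exact Finset.mem_filter.2 ⟨BGraph.mem_subgraphs.2 h1, h2⟩

/-- Up to the levels above the principal degree, the centred `U`-statistic is its connected
part on the principal level. -/
theorem integral_remainder_sq_le (K : IsSquareIntegrableKernel Q h φ ξ η ζ) {m n d : ℕ}
    (hd : IsPrincipalDegree Q h φ ξ η ζ d)
    (hconn : ∀ G, IsPrincipalSupportGraph Q h φ ξ η ζ d m n G → G.Connected)
    (hpm : p ≤ m) (hqn : q ≤ n) :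
    ∫ ω, (uStat h m n (ahkMatrix φ ξ η ζ ω) -
        (∫ ω', kernelVar h φ ξ η ζ (Finset.range p) (Finset.range q) (Finset.card_range p)
          (Finset.card_range q) ω' ∂Q) - connSum Q h φ ξ η ζ m n d ω) ^ 2 ∂Q ≤
      ∑ k ∈ Finset.Ioc d (p + q), levelVar Q h φ ξ η ζ m n k := by
  classical
  set A := (BGraph.complete (Finset.range m) (Finset.range n)).subgraphs with hA
  set f : BGraph → ℝ := fun G =>
    graphCoeff p q m n G ^ 2 * ∫ ω, graphProj Q h φ ξ η ζ G ω ^ 2 ∂Q with hf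
  have hf0 : ∀ G, 0 ≤ f G := fun G =>
    mul_nonneg (sq_nonneg _) (integral_nonneg fun ω => sq_nonneg _)
  have hEA : BGraph.empty ∈ A := BGraph.mem_subgraphs.2
    ⟨Finset.empty_subset _, Finset.empty_subset _, Finset.empty_subset _⟩
  have hCA : connGraphs m n d ⊆ A.erase BGraph.empty := by
    intro G hG
    obtain ⟨h1, h2, -⟩ := mem_connGraphs.1 hG
    refine Finset.mem_erase.2 ⟨?_, BGraph.mem_subgraphs.2 h1⟩
    rintro rfl
    have := hd.1.1
    simp [BGraph.numNodes, BGraph.empty] at h2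
    omega
  have e1 : ∀ᵐ ω ∂Q, uStat h m n (ahkMatrix φ ξ η ζ ω) -
      (∫ ω', kernelVar h φ ξ η ζ (Finset.range p) (Finset.range q) (Finset.card_range p)
        (Finset.card_range q) ω' ∂Q) - connSum Q h φ ξ η ζ m n d ω =
      ∑ G ∈ A.erase BGraph.empty \ connGraphs m n d,
        graphCoeff p q m n G * graphProj Q h φ ξ η ζ G ω := by
    filter_upwards [K.uStat_ae_eq_sum m n] with ω hω
    rw [hω, ← Finset.add_sum_erase _ _ hEA, K.graphProj_empty, Finset.sum_sdiff_eq_sub hCA]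
    simp [BGraph.empty, inclProb_zero hpm, inclProb_zero hqn, connSum, graphCoeff]
  have e2 : ∀ G ∈ A.erase BGraph.empty \ connGraphs m n d, f G ≠ 0 →
      G.numNodes ∈ Finset.Ioc d (p + q) := by
    intro G hG hne
    obtain ⟨h1, h2⟩ := Finset.mem_sdiff.1 hG
    obtain ⟨h3, h4⟩ := Finset.mem_erase.1 h1
    have h5 := BGraph.mem_subgraphs.1 h4
    rw [Finset.mem_Ioc]
    constructor
    · by_contra hle
      refine hne (K.graphCoeff_mul_integral_sq_eq_zero hd hconn hpm hqn h5 ?_ (not_lt.1 hle)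
        fun h6 => h2 (mem_connGraphs.2 ⟨h5, h6⟩))
      by_contra h0
      have h7 : G.rows.card = 0 ∧ G.cols.card = 0 := by
        rw [BGraph.numNodes] at h0
        omega
      have hr := Finset.card_eq_zero.1 h7.1
      have hc := Finset.card_eq_zero.1 h7.2
      refine h3 (BGraph.ext hr hc (Finset.subset_empty.1 ?_))
      have := G.edges_subset
      rwa [hr, Finset.empty_product] at this
    · by_contra hlt
      refine hne ?_
      simp only [hf]
      rw [graphCoeff_eq_zero]
      · simp
      · rw [BGraph.numNodes] at hlt
        omega
  have e3 : ∑ k ∈ Finset.Ioc d (p + q), levelVar Q h φ ξ η ζ m n k =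
      ∑ G ∈ A with G.numNodes ∈ Finset.Ioc d (p + q), f G := by
    rw [← Finset.sum_fiberwise_of_maps_to (s := {G ∈ A | G.numNodes ∈ Finset.Ioc d (p + q)})
      (t := Finset.Ioc d (p + q)) (g := BGraph.numNodes) (fun G hG => (Finset.mem_filter.1 hG).2)]
    refine Finset.sum_congr rfl fun k hk => Finset.sum_congr ?_ fun _ _ => rfl
    ext G
    simp only [Finset.mem_filter]
    exact ⟨fun h1 => ⟨⟨h1.1, h1.2 ▸ hk⟩, h1.2⟩, fun h1 => ⟨h1.1.1, h1.2⟩⟩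
  rw [e3, integral_congr_ae (g := fun ω => (∑ G ∈ A.erase BGraph.empty \ connGraphs m n d,
    graphCoeff p q m n G * graphProj Q h φ ξ η ζ G ω) ^ 2) (by
      filter_upwards [e1] with ω hω
      rw [hω]), K.integral_sum_graphProj_sq, ← Finset.sum_filter_ne_zero]
  refine Finset.sum_le_sum_of_subset_of_nonneg (fun G hG => ?_) fun G _ _ => hf0 G
  obtain ⟨h1, h2⟩ := Finset.mem_filter.1 hG
  exact Finset.mem_filter.2
    ⟨(Finset.mem_erase.1 (Finset.mem_sdiff.1 h1).1).2, e2 G h1 h2⟩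

end IsSquareIntegrableKernel

end Reduction

/-! ### Truncation of the kernel -/

section Truncation

variable {Ω' : Type*} [MeasurableSpace Ω'] {Q : Measure Ω'} [IsProbabilityMeasure Q]
  {ξ η : ℕ → Ω' → ℝ} {ζ : ℕ → ℕ → Ω' → ℝ} {p q : ℕ} {h h' : (Fin p → Fin q → ℝ) → ℝ}
  {φ : ℝ × ℝ × ℝ → ℝ}

/-- Truncation of a real number to the interval `[-M, M]`. -/
noncomputable def trunc (M x : ℝ) : ℝ := max (min x M) (-M)

theorem abs_trunc_le {M : ℝ} (hM : 0 ≤ M) (x : ℝ) : |trunc M x| ≤ M := by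
  rw [trunc, abs_le]
  exact ⟨le_max_right _ _, max_le (min_le_right _ _) (by linarith)⟩

theorem trunc_eq_self {M x : ℝ} (hx : |x| ≤ M) : trunc M x = x := by
  rw [trunc, min_eq_left (abs_le.1 hx).2, max_eq_left (abs_le.1 hx).1]

theorem abs_sub_trunc_le {M : ℝ} (hM : 0 ≤ M) (x : ℝ) : |x - trunc M x| ≤ |x| := by
  rcases le_total |x| M with hx | hx
  · rw [trunc_eq_self hx]
    simp
  · rw [trunc]
    rcases le_total 0 x with h0 | h0
    · rw [abs_of_nonneg h0] at hx ⊢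
      rw [min_eq_right hx, max_eq_left (by linarith), abs_of_nonneg (by linarith)]
      linarith
    · rw [abs_of_nonpos h0] at hx ⊢
      rw [min_eq_left (by linarith), max_eq_right (by linarith), abs_of_nonpos (by linarith)]
      linarith

theorem measurable_trunc (M : ℝ) : Measurable (trunc M) := by
  unfold trunc
  fun_prop

namespace IsSquareIntegrableKernel

theorem trunc (K : IsSquareIntegrableKernel Q h φ ξ η ζ) {M : ℝ} (hM : 0 ≤ M) :
    IsSquareIntegrableKernel Q (fun y => RCE.trunc M (h y)) φ ξ η ζ where
  ahk := K.ahk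
  measurable_fun := K.measurable_fun
  measurable_kernel := (measurable_trunc M).comp K.measurable_kernel
  symm σ τ y := by simp only [K.symm σ τ y]
  memLp := by
    refine MemLp.of_bound ?_ M (ae_of_all _ fun ω => abs_trunc_le hM _)
    exact (measurable_trunc M).comp_aemeasurable
      K.memLp.aestronglyMeasurable.aemeasurable |>.aestronglyMeasurable

theorem sub (K : IsSquareIntegrableKernel Q h φ ξ η ζ)
    (K' : IsSquareIntegrableKernel Q h' φ ξ η ζ) :
    IsSquareIntegrableKernel Q (fun y => h y - h' y) φ ξ η ζ where
  ahk := K.ahk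
  measurable_fun := K.measurable_fun
  measurable_kernel := K.measurable_kernel.sub K'.measurable_kernel
  symm σ τ y := by simp only [K.symm σ τ y, K'.symm σ τ y]
  memLp := K.memLp.sub K'.memLp

theorem connSum_sub (K : IsSquareIntegrableKernel Q h φ ξ η ζ)
    (K' : IsSquareIntegrableKernel Q h' φ ξ η ζ) (m n d : ℕ) :
    ∀ᵐ ω ∂Q, connSum Q h φ ξ η ζ m n d ω - connSum Q h' φ ξ η ζ m n d ω =
      connSum Q (fun y => h y - h' y) φ ξ η ζ m n d ω := by
  have h1 : ∀ᵐ ω ∂Q, ∀ G ∈ connGraphs m n d, graphProj Q (fun y => h y - h' y) φ ξ η ζ G ω =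
      graphProj Q h φ ξ η ζ G ω - graphProj Q h' φ ξ η ζ G ω :=
    (Finset.eventually_all _).2 fun G _ =>
      proj_sub (K.integrable_kernelVar _ _) (K'.integrable_kernelVar _ _) G
  filter_upwards [h1] with ω hω
  rw [connSum, connSum, connSum, ← Finset.sum_sub_distrib]
  refine Finset.sum_congr rfl fun G hG => ?_
  rw [hω G hG]
  ring

/-- The truncation error vanishes in `L²`, by dominated convergence. -/
theorem tendsto_integral_sub_trunc_sq (K : IsSquareIntegrableKernel Q h φ ξ η ζ) {M : ℕ → ℝ}
    (hM0 : ∀ N, 0 ≤ M N) (hM : Tendsto M atTop atTop) :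
    Tendsto (fun N => ∫ ω, kernelVar (fun y => h y - RCE.trunc (M N) (h y)) φ ξ η ζ
      (Finset.range p) (Finset.range q) (Finset.card_range p) (Finset.card_range q) ω ^ 2 ∂Q)
      atTop (𝓝 0) := by
  set X := kernelVar h φ ξ η ζ (Finset.range p) (Finset.range q) (Finset.card_range p)
    (Finset.card_range q) with hX
  have h1 := tendsto_integral_of_dominated_convergence (μ := Q)
    (F := fun N ω => (X ω - RCE.trunc (M N) (X ω)) ^ 2) (f := fun _ => 0)
    (fun ω => X ω ^ 2) (fun N => ?_) K.memLp.integrable_sq (fun N => ae_of_all _ fun ω => ?_)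
    (ae_of_all _ fun ω => ?_)
  · rw [integral_zero] at h1
    exact h1
  · exact ((K.sub (K.trunc (hM0 N))).memLp.aestronglyMeasurable).pow 2
  · rw [Real.norm_eq_abs, abs_of_nonneg (sq_nonneg _)]
    exact sq_le_sq.2 (abs_sub_trunc_le (hM0 N) _)
  · refine tendsto_const_nhds.congr' ?_
    filter_upwards [hM.eventually_ge_atTop |X ω|] with N hN
    rw [trunc_eq_self hN]
    simp

end IsSquareIntegrableKernel

theorem total_vertexSum (m n d : ℕ) (a : BGraph → ℝ) (X : BGraph → Ω' → ℝ) (ω : Ω') :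
    IsDegenerateFamily.total ((Finset.range m).disjSum (Finset.range n)) d
      (vertexSum Q ξ η ζ (connGraphs m n d) a X) ω =
      ∑ G ∈ connGraphs m n d, a G * proj Q ξ η ζ (X G) G ω := by
  rw [IsDegenerateFamily.total]
  unfold vertexSum
  refine Finset.sum_fiberwise_of_maps_to (fun G hG => ?_) _
  obtain ⟨h1, h2, -⟩ := mem_connGraphs.1 hG
  rw [Finset.mem_powersetCard]
  exact ⟨BGraph.verts_mono h1, (BGraph.card_verts G).trans h2⟩

/-- The normal approximation for the connected part on a level, for a bounded kernel. -/
theorem exists_norm_charFun_connSum_le {d : ℕ} (hd : 1 ≤ d) {B : ℝ} (hB : 0 ≤ B) :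
    ∃ A : ℝ, 0 < A ∧ ∀ {m n : ℕ} {h : (Fin p → Fin q → ℝ) → ℝ} {M : ℝ},
      IsSquareIntegrableKernel Q h φ ξ η ζ → 0 < M → (∀ y, |h y| ≤ M) → 0 < m + n →
      (∀ G : BGraph, G.numNodes = d → ((m + n : ℕ) : ℝ) ^ d * graphCoeff p q m n G ≤ B) →
      ∀ (w : ℝ), 0 < w → w ^ 2 = ((m + n : ℕ) : ℝ) ^ d → ∀ t : ℝ,
      ‖(∫ ω, Complex.exp ((t * (w * connSum Q h φ ξ η ζ m n d ω) : ℝ) * Complex.I) ∂Q) -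
        Complex.exp (-((∫ ω, (w * connSum Q h φ ξ η ζ m n d ω) ^ 2 ∂Q) * t ^ 2 / 2 : ℝ))‖ ≤
      √(A * (M ^ 4 / (m + n : ℕ))) *
        ((d * (∫ ω, (w * connSum Q h φ ξ η ζ m n d ω) ^ 2 ∂Q) + 1) * t ^ 2 + |t|) * |t| := by
  obtain ⟨C, hC0, hC⟩ := exists_bound_proj (d + d * d)
  refine ⟨2 * d ^ 2 * (2 ^ (d * d) * (B * C)) ^ 4 * 2 ^ (4 * (2 * d - 1)) + 1, by positivity, ?_⟩
  intro m n h M K hM0 hM hN hcoeff w hw0 hw t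
  set N : ℝ := ((m + n : ℕ) : ℝ) with hNdef
  have hN0 : 0 < N := Nat.cast_pos.2 hN
  set X : BGraph → Ω' → ℝ := fun G => kernelVar h φ ξ η ζ (padTo p G.rows) (padTo q G.cols)
    (card_padTo _ _) (card_padTo _ _) with hX
  have hXb : ∀ G, ∀ᵐ ω ∂Q, |X G ω| ≤ M := fun G => ae_of_all _ fun ω => hM _
  have hXL : ∀ G, MemLp (X G) ⊤ Q := fun G =>
    memLp_top_of_bound (K.integrable_kernelVar _ _).aestronglyMeasurable M (hXb G)
  set β : ℝ := B * C * M / w with hβdef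
  have hβ0 : 0 ≤ β := by positivity
  have hβ : ∀ G ∈ connGraphs m n d,
      ∀ᵐ ω ∂Q, |(w * graphCoeff p q m n G) * proj Q ξ η ζ (X G) G ω| ≤ β := by
    intro G hG
    obtain ⟨-, h2, -⟩ := mem_connGraphs.1 hG
    have hcard : G.rows.card + G.cols.card + G.edges.card ≤ d + d * d := by
      have h3 := Finset.card_le_card G.edges_subset
      rw [Finset.card_product] at h3
      rw [BGraph.numNodes] at h2
      have h4 : G.rows.card * G.cols.card ≤ d * d := Nat.mul_le_mul (by omega) (by omega)
      omega
    filter_upwards [hC G hcard (X G) M hM0.le (hXb G)] with ω hω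
    have h5 : w * graphCoeff p q m n G ≤ B / w := by
      rw [le_div_iff₀ hw0]
      refine le_trans (le_of_eq ?_) (hcoeff G h2)
      rw [← hw]
      ring
    have h6 := graphCoeff_nonneg p q m n G
    rw [abs_mul, abs_of_nonneg (by positivity)]
    refine (mul_le_mul h5 hω (abs_nonneg _) (by positivity)).trans (le_of_eq ?_)
    rw [hβdef]
    ring
  have hfam := isDegenerateFamily_vertexSum K.ahk (fun G hG => mem_connGraphs.1 hG)
    (fun G => w * graphCoeff p q m n G) hXL hβ hβ0
  have htot : ∀ ω, IsDegenerateFamily.total ((Finset.range m).disjSum (Finset.range n)) d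
      (vertexSum Q ξ η ζ (connGraphs m n d) (fun G => w * graphCoeff p q m n G) X) ω =
      w * connSum Q h φ ξ η ζ m n d ω := by
    intro ω
    rw [total_vertexSum, connSum, Finset.mul_sum]
    exact Finset.sum_congr rfl fun G _ => mul_assoc _ _ _
  have hV : (((Finset.range m).disjSum (Finset.range n)).card : ℝ) = N := by
    rw [Finset.card_disjSum, Finset.card_range, Finset.card_range]
  have hmain := hfam.norm_charFun_sub_le (by positivity) hd
    (δ := √((2 * d ^ 2 * (2 ^ (d * d) * (B * C)) ^ 4 * 2 ^ (4 * (2 * d - 1)) + 1) * (M ^ 4 / N)))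
    (Real.sqrt_pos.2 (by positivity)) ?_ t
  · simpa only [htot] using hmain
  · rw [hV, Real.sq_sqrt (by positivity)]
    have hw4 : w ^ 4 = N * N ^ (2 * d - 1) := by
      rw [← pow_succ', show w ^ 4 = (w ^ 2) ^ 2 by ring, hw, ← pow_mul]
      congr 1
      omega
    have e : 2 * (d : ℝ) ^ 2 * (2 ^ (d * d) * β) ^ 4 *
        (2 ^ (4 * (2 * d - 1)) * N ^ (2 * d - 1)) =
        (2 * d ^ 2 * (2 ^ (d * d) * (B * C)) ^ 4 * 2 ^ (4 * (2 * d - 1))) * (M ^ 4 / N) := by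
      rw [hβdef, mul_pow _ (B * C * M / w), div_pow, hw4]
      field_simp
    rw [e]
    have : 0 ≤ M ^ 4 / N := by positivity
    nlinarith

end Truncation

/-! ### The limit of the characteristic functions -/

section Limit

variable {Ω' : Type*} [MeasurableSpace Ω'] {Q : Measure Ω'} [IsProbabilityMeasure Q]
  {ξ η : ℕ → Ω' → ℝ} {ζ : ℕ → ℕ → Ω' → ℝ} {p q : ℕ} {h h' : (Fin p → Fin q → ℝ) → ℝ}
  {φ : ℝ × ℝ × ℝ → ℝ}

theorem rpow_half_sq (N d : ℕ) : ((N : ℝ) ^ ((d : ℝ) / 2)) ^ 2 = (N : ℝ) ^ d := by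
  rw [← Real.rpow_mul_natCast (Nat.cast_nonneg N), ← Real.rpow_natCast (N : ℝ) d]
  congr 1
  push_cast
  ring

namespace IsSquareIntegrableKernel

theorem memLp_uStat (K : IsSquareIntegrableKernel Q h φ ξ η ζ) (m n : ℕ) :
    MemLp (fun ω => uStat h m n (ahkMatrix φ ξ η ζ ω)) 2 Q := by
  refine (memLp_congr_ae (K.uStat_ae_eq_sum m n)).2 (K.memLp_sum_graphProj _ (fun G =>
    inclProb p m G.rows.card * inclProb q n G.cols.card))

theorem tendsto_pow_mul_levelVar_of_lt (K : IsSquareIntegrableKernel Q h φ ξ η ζ) {m n : ℕ → ℕ}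
    {ρ ρ' : ℝ} (hρ : 0 < ρ) (hρ' : 0 < ρ')
    (hm : Tendsto (fun N => (m N : ℝ) / (N : ℝ)) atTop (𝓝 ρ))
    (hn : Tendsto (fun N => (n N : ℝ) / (N : ℝ)) atTop (𝓝 ρ')) {d k : ℕ} (hdk : d < k) :
    Tendsto (fun N : ℕ => (N : ℝ) ^ d * levelVar Q h φ ξ η ζ (m N) (n N) k) atTop (𝓝 0) := by
  have h1 : Tendsto (fun N : ℕ => (N : ℝ) ^ (k - d)) atTop atTop :=
    (tendsto_pow_atTop (by omega)).comp tendsto_natCast_atTop_atTop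
  refine ((K.tendsto_levelVar hρ hρ' hm hn k).div_atTop h1).congr' ?_
  filter_upwards [eventually_gt_atTop 0] with N hN
  have hN' : (N : ℝ) ≠ 0 := by exact_mod_cast hN.ne'
  have h2 : (N : ℝ) ^ k = (N : ℝ) ^ d * (N : ℝ) ^ (k - d) := by
    rw [← pow_add]
    congr 1
    omega
  rw [h2]
  field_simp

/-- The characteristic functions of the rescaled `U`-statistics converge to the Gaussian one:
up to errors that vanish in `L²`, the kernel may be truncated at a slowly growing level and only
connected graphs on the principal level count. -/
theorem tendsto_integral_cexp_uStat (K : IsSquareIntegrableKernel Q h φ ξ η ζ) {m n : ℕ → ℕ}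
    (hmn : ∀ N, m N + n N = N) {ρ : ℝ} (hρ0 : 0 < ρ) (hρ1 : ρ < 1)
    (hm : Tendsto (fun N => (m N : ℝ) / (N : ℝ)) atTop (𝓝 ρ)) {d : ℕ}
    (hd : IsPrincipalDegree Q h φ ξ η ζ d)
    (hconn : ∀ N G, IsPrincipalSupportGraph Q h φ ξ η ζ d (m N) (n N) G → G.Connected) (t : ℝ) :
    Tendsto (fun N : ℕ => ∫ ω, Complex.exp ((t * ((N : ℝ) ^ ((d : ℝ) / 2) *
      (uStat h (m N) (n N) (ahkMatrix φ ξ η ζ ω) -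
        ∫ ω', kernelVar h φ ξ η ζ (Finset.range p) (Finset.range q) (Finset.card_range p)
          (Finset.card_range q) ω' ∂Q)) : ℝ) * Complex.I) ∂Q) atTop
      (𝓝 (Complex.exp (-(limitVariance Q h φ ξ η ζ d ρ * t ^ 2 / 2 : ℝ)))) := by
  have hd1 : 1 ≤ d := hd.1.1
  have hρ' : 0 < 1 - ρ := by linarith
  have hn : Tendsto (fun N => (n N : ℝ) / (N : ℝ)) atTop (𝓝 (1 - ρ)) := by
    refine (hm.const_sub 1).congr' ?_
    filter_upwards [eventually_gt_atTop 0] with N hN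
    have hN' : (N : ℝ) ≠ 0 := by exact_mod_cast hN.ne'
    have h1 : (m N : ℝ) + n N = N := by exact_mod_cast hmn N
    rw [eq_div_iff hN', sub_mul, div_mul_cancel₀ _ hN']
    linarith
  have hpm := (tendsto_atTop_of_div hρ0 hm).eventually_ge_atTop p
  have hqn := (tendsto_atTop_of_div hρ' hn).eventually_ge_atTop q
  set μ : ℝ := ∫ ω', kernelVar h φ ξ η ζ (Finset.range p) (Finset.range q) (Finset.card_range p)
    (Finset.card_range q) ω' ∂Q with hμ
  set σ2 := limitVariance Q h φ ξ η ζ d ρ with hσ2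
  set w : ℕ → ℝ := fun N => (N : ℝ) ^ ((d : ℝ) / 2) with hw
  have hw2 : ∀ N, w N ^ 2 = (N : ℝ) ^ d := fun N => rpow_half_sq N d
  -- any level that tends to infinity more slowly than `N ^ (1 / 4)` would do
  set M : ℕ → ℝ := fun N => (N : ℝ) ^ (1 / 8 : ℝ) with hMdef
  have hM0 : ∀ N, 0 ≤ M N := fun N => by positivity
  have hMtop : Tendsto M atTop atTop :=
    (tendsto_rpow_atTop (by norm_num)).comp tendsto_natCast_atTop_atTop
  have hM4 : Tendsto (fun N : ℕ => M N ^ 4 / (N : ℝ)) atTop (𝓝 0) := by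
    refine ((tendsto_rpow_neg_atTop (by norm_num : (0 : ℝ) < 1 / 2)).comp
      tendsto_natCast_atTop_atTop).congr' ?_
    filter_upwards [eventually_gt_atTop 0] with N hN
    have hN' : (N : ℝ) ≠ 0 := by exact_mod_cast hN.ne'
    simp only [hMdef, Function.comp_apply]
    rw [← Real.rpow_mul_natCast (Nat.cast_nonneg N), ← Real.rpow_sub_one hN']
    norm_num
  set R : ℕ → Ω' → ℝ := fun N ω => w N * (uStat h (m N) (n N) (ahkMatrix φ ξ η ζ ω) - μ) with hR
  set X : ℕ → Ω' → ℝ := fun N ω => w N * connSum Q h φ ξ η ζ (m N) (n N) d ω with hX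
  set X' : ℕ → Ω' → ℝ := fun N ω =>
    w N * connSum Q (fun y => RCE.trunc (M N) (h y)) φ ξ η ζ (m N) (n N) d ω with hX'
  have hRL : ∀ N, MemLp (R N) 2 Q := fun N =>
    ((K.memLp_uStat _ _).sub (memLp_const μ)).const_mul _
  have hXL : ∀ N, MemLp (X N) 2 Q := fun N => (K.memLp_connSum _ _ _).const_mul _
  have hXL' : ∀ N, MemLp (X' N) 2 Q := fun N => ((K.trunc (hM0 N)).memLp_connSum _ _ _).const_mul _
  have hRX : Tendsto (fun N => ∫ ω, (R N ω - X N ω) ^ 2 ∂Q) atTop (𝓝 0) := by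
    have h1 : Tendsto (fun N : ℕ => ∑ k ∈ Finset.Ioc d (p + q),
        (N : ℝ) ^ d * levelVar Q h φ ξ η ζ (m N) (n N) k) atTop (𝓝 0) := by
      have := tendsto_finsetSum (Finset.Ioc d (p + q)) fun k hk =>
        K.tendsto_pow_mul_levelVar_of_lt hρ0 hρ' hm hn (Finset.mem_Ioc.1 hk).1
      simpa using this
    refine squeeze_zero' (Eventually.of_forall fun N => integral_nonneg fun ω => sq_nonneg _) ?_ h1
    filter_upwards [hpm, hqn] with N h2 h3
    have e : ∀ ω, (R N ω - X N ω) ^ 2 = (N : ℝ) ^ d * (uStat h (m N) (n N) (ahkMatrix φ ξ η ζ ω) -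
        μ - connSum Q h φ ξ η ζ (m N) (n N) d ω) ^ 2 := by
      intro ω
      rw [← hw2]
      simp only [hR, hX]
      ring
    simp only [e]
    rw [integral_const_mul, ← Finset.mul_sum]
    exact mul_le_mul_of_nonneg_left (K.integral_remainder_sq_le hd (hconn N) h2 h3)
      (by positivity)
  have hXs : Tendsto (fun N => ∫ ω, X N ω ^ 2 ∂Q) atTop (𝓝 σ2) := by
    rw [hσ2, K.limitVariance_eq hd1]
    refine (K.tendsto_levelVar hρ0 hρ' hm hn d).congr' ?_
    filter_upwards [hpm, hqn] with N h2 h3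
    simp only [hX, mul_pow, hw2]
    rw [integral_const_mul, K.integral_connSum_sq hd (hconn N) h2 h3]
  have hXX' : Tendsto (fun N => ∫ ω, (X N ω - X' N ω) ^ 2 ∂Q) atTop (𝓝 0) := by
    obtain ⟨C, hC0, hC⟩ := exists_levelVar_le (Q := Q) (φ := φ) (ξ := ξ) (η := η) (ζ := ζ)
      hρ0 hρ' hm hn p q d
    have h1 := (K.tendsto_integral_sub_trunc_sq hM0 hMtop).const_mul C
    rw [mul_zero] at h1
    refine squeeze_zero' (Eventually.of_forall fun N => integral_nonneg fun ω => sq_nonneg _) ?_ h1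
    filter_upwards [hC] with N hCN
    have K' := K.sub (K.trunc (hM0 N))
    refine le_trans ?_ (hCN K')
    have e : ∀ᵐ ω ∂Q, (X N ω - X' N ω) ^ 2 = (N : ℝ) ^ d *
        connSum Q (fun y => h y - RCE.trunc (M N) (h y)) φ ξ η ζ (m N) (n N) d ω ^ 2 := by
      filter_upwards [K.connSum_sub (K.trunc (hM0 N)) (m N) (n N) d] with ω hω
      rw [← hω, ← hw2]
      simp only [hX, hX']
      ring
    rw [integral_congr_ae e, integral_const_mul]
    exact mul_le_mul_of_nonneg_left (K'.integral_connSum_sq_le _ _ _) (by positivity)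
  have hXs' := tendsto_integral_sq_of_tendsto_sub hXL hXL' hXs hXX'
  have hgauss : Tendsto (fun N => (∫ ω, Complex.exp ((t * X' N ω : ℝ) * Complex.I) ∂Q) -
      Complex.exp (-((∫ ω, X' N ω ^ 2 ∂Q) * t ^ 2 / 2 : ℝ))) atTop (𝓝 0) := by
    obtain ⟨B, hB0, hB⟩ := exists_graphCoeff_le hρ0 hρ' hm hn p q d
    obtain ⟨A, hA0, hA⟩ := exists_norm_charFun_connSum_le (p := p) (q := q) (Q := Q) (φ := φ)
      (ξ := ξ) (η := η) (ζ := ζ) hd1 hB0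
    have h1 : Tendsto (fun N : ℕ => √(A * (M N ^ 4 / (N : ℝ))) *
        ((d * (∫ ω, X' N ω ^ 2 ∂Q) + 1) * t ^ 2 + |t|) * |t|) atTop (𝓝 0) := by
      have h2 := (((hM4.const_mul A).sqrt).mul
        ((((hXs'.const_mul (d : ℝ)).add_const 1).mul_const (t ^ 2)).add_const |t|)).mul_const |t|
      simpa using h2
    refine squeeze_zero_norm' ?_ h1
    filter_upwards [hB, eventually_gt_atTop 0] with N hBN hN
    have hN' : (0 : ℝ) < N := Nat.cast_pos.2 hN
    have h3 := hA (m := m N) (n := n N) (K.trunc (hM0 N)) (Real.rpow_pos_of_pos hN' _)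
      (fun y => abs_trunc_le (hM0 N) _) (by rw [hmn]; exact hN) (by rw [hmn]; exact hBN) (w N)
      (Real.rpow_pos_of_pos hN' _) (by rw [hmn]; exact hw2 N) t
    rw [hmn] at h3
    exact h3
  have hdiff : ∀ {f g : ℕ → Ω' → ℝ}, (∀ N, MemLp (f N) 2 Q) → (∀ N, MemLp (g N) 2 Q) →
      Tendsto (fun N => ∫ ω, (f N ω - g N ω) ^ 2 ∂Q) atTop (𝓝 0) →
      Tendsto (fun N => (∫ ω, Complex.exp ((t * f N ω : ℝ) * Complex.I) ∂Q) -
        ∫ ω, Complex.exp ((t * g N ω : ℝ) * Complex.I) ∂Q) atTop (𝓝 0) := by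
    intro f g hf hg h0
    have h1 := h0.sqrt.const_mul |t|
    rw [Real.sqrt_zero, mul_zero] at h1
    exact squeeze_zero_norm (fun N => norm_integral_cexp_sub_le (hf N) (hg N) t) h1
  have hexp : Tendsto (fun N => Complex.exp (-((∫ ω, X' N ω ^ 2 ∂Q) * t ^ 2 / 2 : ℝ))) atTop
      (𝓝 (Complex.exp (-(σ2 * t ^ 2 / 2 : ℝ)))) := by
    have hc : Continuous fun s : ℝ => Complex.exp (-(s * t ^ 2 / 2 : ℝ)) := by fun_prop
    exact (hc.tendsto σ2).comp hXs'
  have hsum := (((hdiff hRL hXL hRX).add (hdiff hXL hXL' hXX')).add hgauss).add hexp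
  simp only [zero_add, add_zero] at hsum
  refine hsum.congr fun N => ?_
  ring

theorem limitVariance_nonneg (K : IsSquareIntegrableKernel Q h φ ξ η ζ) {ρ : ℝ} (hρ0 : 0 < ρ)
    (hρ1 : ρ < 1) {d : ℕ} (hd : 1 ≤ d) : 0 ≤ limitVariance Q h φ ξ η ζ d ρ := by
  have hρ' : 0 < 1 - ρ := by linarith
  rw [K.limitVariance_eq hd]
  refine Finset.sum_nonneg fun rc _ => mul_nonneg (by positivity) (spanVar_nonneg _ _)

end IsSquareIntegrableKernel

end Limit

/-! ### Measurability of the `U`-statistic -/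

theorem submatrix_range {p q : ℕ} (y : ℕ → ℕ → ℝ) :
    submatrix y (Finset.range p) (Finset.range q) (Finset.card_range p) (Finset.card_range q) =
      fun (k : Fin p) (l : Fin q) => y k l := by
  have h1 : ∀ (r : ℕ) (k : Fin r),
      (Finset.range r).orderEmbOfFin (Finset.card_range r) k = (k : ℕ) := by
    intro r k
    rw [← Finset.orderEmbOfFin_unique (s := Finset.range r) (Finset.card_range r)
      (f := fun k : Fin r => (k : ℕ)) (fun x => Finset.mem_range.2 x.2) Fin.val_strictMono]
  funext k l
  rw [submatrix, h1, h1]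

theorem measurable_submatrix {p q : ℕ} {I J : Finset ℕ} (hI : I.card = p) (hJ : J.card = q) :
    Measurable fun y : ℕ → ℕ → ℝ => submatrix y I J hI hJ := by
  unfold submatrix
  fun_prop

theorem measurable_uStat {p q : ℕ} {h : (Fin p → Fin q → ℝ) → ℝ} (hm : Measurable h) (m n : ℕ) :
    Measurable fun y : ℕ → ℕ → ℝ => uStat h m n y := by
  unfold uStat
  exact (Finset.measurable_fun_sum _ fun I _ => Finset.measurable_fun_sum _ fun J _ =>
    hm.comp (measurable_submatrix _ _)).const_mul _

end RCE

theorem mainTheorem1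
    {Ω : Type*} [MeasurableSpace Ω] (P : Measure Ω) [IsProbabilityMeasure P]
    {Ω' : Type*} [MeasurableSpace Ω'] (Q : Measure Ω') [IsProbabilityMeasure Q]
    -- a dissociated row-column exchangeable matrix and its AHK representation
    (Y : ℕ → ℕ → Ω → ℝ) (hYm : ∀ i j, Measurable (Y i j))
    (hYexch : RCE.IsRowColExchangeable P Y) (hYdiss : RCE.IsDissociated P Y)
    (φ : ℝ × ℝ × ℝ → ℝ) (ξ η : ℕ → Ω' → ℝ) (ζ : ℕ → ℕ → Ω' → ℝ)
    (hAHK : RCE.IsAHKRepresentation P Y Q φ ξ η ζ)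
    -- a symmetric square-integrable kernel
    {p q : ℕ} (h : (Fin p → Fin q → ℝ) → ℝ) (hm : Measurable h)
    (hsymm : RCE.IsSymmetricKernel h)
    (hL2 : MemLp (fun ω => h (fun k l => Y k l ω)) 2 P)
    -- the balanced asymptotic regime
    (m n : ℕ → ℕ) (hmn : ∀ N, m N + n N = N) (ρ : ℝ) (hρ0 : 0 < ρ) (hρ1 : ρ < 1)
    (hρ : Tendsto (fun N => (m N : ℝ) / (N : ℝ)) atTop (𝓝 ρ))
    -- the principal degree, and connectedness of all principal support graphs
    (d : ℕ) (hd : RCE.IsPrincipalDegree Q h φ ξ η ζ d)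
    (hconn : ∀ N G, RCE.IsPrincipalSupportGraph Q h φ ξ η ζ d (m N) (n N) G → G.Connected) :
    0 ≤ RCE.limitVariance Q h φ ξ η ζ d ρ ∧
    TendstoInDistribution
      (fun (N : ℕ) ω => (N : ℝ) ^ ((d : ℝ) / 2) *
        (RCE.uStat h (m N) (n N) (fun i j => Y i j ω) - ∫ ω', h (fun k l => Y k l ω') ∂P))
      atTop id (fun _ => P)
      (gaussianReal 0 (RCE.limitVariance Q h φ ξ η ζ d ρ).toNNReal) := by
  -- the law of the kernel at the array of AHK variables is the law of the kernel at `Y`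
  have hker : IdentDistrib (fun ω => h (fun k l => Y k l ω))
      (RCE.kernelVar h φ ξ η ζ (Finset.range p) (Finset.range q) (Finset.card_range p)
        (Finset.card_range q)) P Q := by
    have h1 := hAHK.identDistrib.comp
      (hm.comp (RCE.measurable_submatrix (Finset.card_range p) (Finset.card_range q)))
    have h2 : (fun ω => h (fun k l => Y k l ω)) = (h ∘ fun y => RCE.submatrix y (Finset.range p)
        (Finset.range q) (Finset.card_range p) (Finset.card_range q)) ∘ fun ω i j => Y i j ω :=
      funext fun ω => congrArg h (RCE.submatrix_range fun i j => Y i j ω).symm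
    rw [h2]
    exact h1
  have K : RCE.IsSquareIntegrableKernel Q h φ ξ η ζ :=
    { ahk := hAHK.isAHKVariables
      measurable_fun := hAHK.measurable_fun
      measurable_kernel := hm
      symm := hsymm
      memLp := hker.memLp_iff.1 hL2 }
  have hσ := K.limitVariance_nonneg hρ0 hρ1 hd.1.1
  set c : ℝ := ∫ ω', h (fun k l => Y k l ω') ∂P with hc
  have hUm : ∀ N : ℕ, Measurable fun y : ℕ → ℕ → ℝ =>
      (N : ℝ) ^ ((d : ℝ) / 2) * (RCE.uStat h (m N) (n N) y - c) := fun N =>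
    ((RCE.measurable_uStat hm _ _).sub_const _).const_mul _
  have hYm' : Measurable fun ω (i j : ℕ) => Y i j ω :=
    measurable_pi_lambda _ fun i => measurable_pi_lambda _ fun j => hYm i j
  refine ⟨hσ, ⟨fun N => ((hUm N).comp hYm').aemeasurable, by fun_prop, ?_⟩⟩
  refine ProbabilityMeasure.tendsto_iff_tendsto_charFun.2 fun t => ?_
  have hlim := K.tendsto_integral_cexp_uStat hmn hρ0 hρ1 hρ hd hconn t
  rw [← hker.integral_eq] at hlim
  have e1 : charFun ((gaussianReal 0 (RCE.limitVariance Q h φ ξ η ζ d ρ).toNNReal).map id) t =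
      Complex.exp (-(RCE.limitVariance Q h φ ξ η ζ d ρ * t ^ 2 / 2 : ℝ)) := by
    rw [Measure.map_id, charFun_gaussianReal, Real.coe_toNNReal _ hσ]
    congr 1
    push_cast
    ring
  have e2 : ∀ N : ℕ, charFun (P.map fun ω => (N : ℝ) ^ ((d : ℝ) / 2) *
      (RCE.uStat h (m N) (n N) (fun i j => Y i j ω) - c)) t =
      ∫ ω, Complex.exp ((t * ((N : ℝ) ^ ((d : ℝ) / 2) *
        (RCE.uStat h (m N) (n N) (RCE.ahkMatrix φ ξ η ζ ω) - c)) : ℝ) * Complex.I) ∂Q := by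
    intro N
    have h2 := hAHK.identDistrib.comp (hUm N)
    have h3 : P.map (fun ω => (N : ℝ) ^ ((d : ℝ) / 2) *
      (RCE.uStat h (m N) (n N) (fun i j => Y i j ω) - c)) = Q.map fun ω =>
      (N : ℝ) ^ ((d : ℝ) / 2) * (RCE.uStat h (m N) (n N) (RCE.ahkMatrix φ ξ η ζ ω) - c) :=
      h2.map_eq
    have h4 : AEMeasurable (fun ω => (N : ℝ) ^ ((d : ℝ) / 2) *
        (RCE.uStat h (m N) (n N) (RCE.ahkMatrix φ ξ η ζ ω) - c)) Q := h2.aemeasurable_snd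
    rw [h3, charFun_apply_real, integral_map h4 (by fun_prop)]
    push_cast
    rfl
  change Tendsto (fun N : ℕ => charFun (P.map fun ω => (N : ℝ) ^ ((d : ℝ) / 2) *
      (RCE.uStat h (m N) (n N) (fun i j => Y i j ω) - c)) t) atTop (𝓝 (charFun
      ((gaussianReal 0 (RCE.limitVariance Q h φ ξ η ζ d ρ).toNNReal).map id) t))
  rw [e1]
  simp only [e2]
  exact hlim
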